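/- Let $N\ge 1$ be an integer, $r>0$, $0<t<t_*<\infty$, and let $R$ be one of the seven affine types $A_N, B_N, B_N^\vee, C_N, C_N^\vee, BC_N, D_N$, where $N\ge 2$ for type $D_N$. For $v,\tau\in\mathbb C$, $\operatorname{Im}\tau>0$, let $$\vartheta_1(v;\tau)=i\sum_{n\in\mathbb Z}(-1)^n e^{\pi i\tau(n-1/2)^2}e^{\pi i v(2n-1)},\qquad \vartheta_2(v;\tau)=\sum_{n\in\mathbb Z}e^{\pi i\tau(n-1/2)^2}e^{\pi i v(2n-1)},$$ $$\Theta^A(\sigma,z,\tau)=e^{2\pi i\sigma z}\vartheta_2(\sigma\tau+z;\tau),\qquad \Theta^B(\sigma,z,\tau)=e^{2\pi i\sigma z}\vartheta_1(\sigma\tau+z;\tau)-e^{-2\pi i\sigma z}\vartheta_1(\sigma\tau-z;\tau),$$ $$\Theta^{C}(\sigma,z,\tau)=e^{2\pi i\sigma z}\vartheta_2(\sigma\tau+z;\tau)- e^{-2\pi i\sigma z}\vartheta_2(\sigma\tau-z;\tau),\qquad \Theta^{D}(\sigma,z,\tau)=e^{2\pi i\sigma z}\vartheta_2(\sigma\tau+z;\tau)+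 e^{-2\pi i\sigma z}\vartheta_2(\sigma\tau-z;\tau).$$ Put $\sharp(R)=A$ for $R=A_N$; $\sharp(R)=B$ for $R=B_N,B_N^\vee$; $\sharp(R)=C$ for $R=C_N,C_N^\vee,BC_N$; $\sharp(R)=D$ for $R=D_N$. Put $J^R(j)=j-\frac12$ for $R=A_N,C_N^\vee$; $J^R(j)=j-1$ for $R=B_N,B_N^\vee,D_N$; $J^R(j)=j$ for $R=C_N,BC_N$. Let $\mathcal N^R=N,\ 2N-1,\ 2N,\ 2(N+1),\ 2N,\ 2N+1,\ 2(N-1)$ for $R=A_N,B_N,B_N^\vee,C_N,C_N^\vee,BC_N,D_N$, respectively. With $\xi(x)=\frac{x}{2\pi r}$ and $\tau(s)=\frac{is}{2\pi r^2}$ define, for $j=1,\dots,N$, $$M^R_j(x,s)=\Theta^{\sharp(R)}\big(J^R(j)/\mathcal N^R,\ \mathcal N^R\xi(x),\ (\mathcal N^R)^2\tau(s)\big),$$ $$m^R_j(t_*)=2\pi r\,c^R_j\,\vartheta_2\big(\mathcal N^R J^R(j)\tau(t_*);(\mathcal N^R)^2\tau(t_*)\big),$$ where $c^R_j=2$ if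 $j=1$ and $R\in\{B_N,B_N^\vee,D_N\}$, or if $j=N$ and $R=D_N$, and $c^R_j=1$ otherwise. Let $S=[0,2\pi r)$ if $R=A_N$ and $S=[0,\pi r]$ otherwise, and let $$p^R_t(x)=\frac{\det_{1\le j,k\le N}\big[\overline{M^R_j(x_k,t_*-t)}\big]\ \det_{1\le j,k\le N}\big[M^R_j(x_k,t)\big]}{\prod_{n=1}^N m^R_n(t_*)},\qquad x\in S^N.$$ **Theorem 3.4.** The constants $m^R_n(t_*)$ are positive real numbers. The function $p^R_t$ is real, nonnegative and symmetric on $S^N$, and $p^R_t(x)\,dx$ is a probability measure on $\{x\in S^N: x_1<\dots<x_N\}$. So it defines an $N$-point process $\Xi=\sum_{j=1}^N\delta_{X_j}$ on $S$. This process is determinantal with the correlation kernel $$K^R_t(x,y)=\sum_{n=1}^N\frac{M^R_n(x,t)\,\overline{M^R_n(y,t_*-t)}}{m^R_n(t_*)},\qquad x,y\in S.$$ That is, $K^R_t$ is continuous on $S\times S$, and for every $1\le n\le N$ the $n$-point correlation function $$\rho_n(x_1,\dots,x_n)=\frac1{(N-n)!}\int_{S^{N-n}}p^R_t(x_1,\dots,x_N)\,dx_{n+1}\cdots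 dx_N$$ (the integral being absolutely convergent) satisfies $\rho_n(x_1,\dots,x_n)=\det_{1\le j,k\le n}[K^R_t(x_j,x_k)]$ for all $x_1,\dots,x_n\in S$. Moreover $\rho_n$ is the correlation function of the random measure $\Xi$: $\mathbb E[\Xi(A_1)\cdots\Xi(A_n)]=\int_{A_1\times\cdots\times A_n}\rho_n(x)\,dx$ for pairwise disjoint Borel sets $A_1,\dots,A_n\subseteq S$. -/

import Mathlib

open MeasureTheory

noncomputable section

namespace EllipticDPP

/-! ### Jacobi theta functions -/

/-- `ϑ₁(v; τ) = i ∑_{n ∈ ℤ} (-1)^n q^{(n-1/2)^2} z^{2n-1}` with `q = e^{πiτ}`, `z = e^{πiv}`. -/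
def theta1 (v τ : ℂ) : ℂ :=
  Complex.I * ∑' n : ℤ, (-1 : ℂ) ^ n *
    Complex.exp (Real.pi * Complex.I * τ * ((n : ℂ) - 1 / 2) ^ 2) *
    Complex.exp (Real.pi * Complex.I * v * (2 * (n : ℂ) - 1))

/-- `ϑ₂(v; τ) = ∑_{n ∈ ℤ} q^{(n-1/2)^2} z^{2n-1}` with `q = e^{πiτ}`, `z = e^{πiv}`. -/
def theta2 (v τ : ℂ) : ℂ :=
  ∑' n : ℤ,
    Complex.exp (Real.pi * Complex.I * τ * ((n : ℂ) - 1 / 2) ^ 2) *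
    Complex.exp (Real.pi * Complex.I * v * (2 * (n : ℂ) - 1))

/-! ### The four theta functions of types `A`, `B`, `C`, `D` -/

def bigThetaA (σ : ℝ) (z τ : ℂ) : ℂ :=
  Complex.exp (2 * Real.pi * Complex.I * σ * z) * theta2 (σ * τ + z) τ

def bigThetaB (σ : ℝ) (z τ : ℂ) : ℂ :=
  Complex.exp (2 * Real.pi * Complex.I * σ * z) * theta1 (σ * τ + z) τ -
    Complex.exp (-(2 * Real.pi * Complex.I * σ * z)) * theta1 (σ * τ - z) τ

def bigThetaC (σ : ℝ) (z τ : ℂ) : ℂ :=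
  Complex.exp (2 * Real.pi * Complex.I * σ * z) * theta2 (σ * τ + z) τ -
    Complex.exp (-(2 * Real.pi * Complex.I * σ * z)) * theta2 (σ * τ - z) τ

def bigThetaD (σ : ℝ) (z τ : ℂ) : ℂ :=
  Complex.exp (2 * Real.pi * Complex.I * σ * z) * theta2 (σ * τ + z) τ +
    Complex.exp (-(2 * Real.pi * Complex.I * σ * z)) * theta2 (σ * τ - z) τ

/-- The seven families of affine root systems; `Bv` and `Cv` stand for `B^∨` and `C^∨`. -/
inductive AffineType
  | A | B | Bv | C | Cv | BC | D

namespace AffineType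

/-- `Θ^{♯(R)}`. -/
def bigTheta : AffineType → ℝ → ℂ → ℂ → ℂ
  | A => bigThetaA
  | B => bigThetaB
  | Bv => bigThetaB
  | C => bigThetaC
  | Cv => bigThetaC
  | BC => bigThetaC
  | D => bigThetaD

/-- `J^R(j)`, for `j = 1, 2, …, N`. -/
def J : AffineType → ℕ → ℝ
  | A, j => (j : ℝ) - 1 / 2
  | B, j => (j : ℝ) - 1
  | Bv, j => (j : ℝ) - 1
  | C, j => (j : ℝ)
  | Cv, j => (j : ℝ) - 1 / 2
  | BC, j => (j : ℝ)
  | D, j => (j : ℝ) - 1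

/-- `𝒩^R`, as a function of the number `N` of points. -/
def curlyN : AffineType → ℕ → ℝ
  | A, N => (N : ℝ)
  | B, N => 2 * (N : ℝ) - 1
  | Bv, N => 2 * (N : ℝ)
  | C, N => 2 * ((N : ℝ) + 1)
  | Cv, N => 2 * (N : ℝ)
  | BC, N => 2 * (N : ℝ) + 1
  | D, N => 2 * ((N : ℝ) - 1)

/-- The state space: `[0, 2πr)` for type `A` and `[0, πr]` for the other types. -/
def stateSpace : AffineType → ℝ → Set ℝ
  | A, r => Set.Ico 0 (2 * Real.pi * r)
  | _, r => Set.Icc 0 (Real.pi * r)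

end AffineType

/-- `ξ(x) = x / (2πr)`. -/
def xi (r x : ℝ) : ℝ := x / (2 * Real.pi * r)

/-- `τ(t) = i t / (2πr²)`. -/
def tau (r t : ℝ) : ℂ := Complex.I * t / (2 * Real.pi * r ^ 2)

/-- `M^R_j(x, t) = Θ^{♯(R)}(J^R(j) / 𝒩^R, 𝒩^R ξ(x); (𝒩^R)² τ(t))`, for `j = 1, 2, …, N`. -/
def M (R : AffineType) (N : ℕ) (r : ℝ) (j : ℕ) (x t : ℝ) : ℂ :=
  R.bigTheta (R.J j / R.curlyN N) ((R.curlyN N : ℂ) * (xi r x : ℂ))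
    ((R.curlyN N : ℂ) ^ 2 * tau r t)

/-- `2πr ϑ₂(𝒩^R J^R(j) τ(t⋆); (𝒩^R)² τ(t⋆))`. -/
def mGeneric (R : AffineType) (N : ℕ) (r tstar : ℝ) (j : ℕ) : ℂ :=
  2 * Real.pi * r *
    theta2 ((R.curlyN N : ℂ) * (R.J j : ℂ) * tau r tstar) ((R.curlyN N : ℂ) ^ 2 * tau r tstar)

/-- The constants `m^R_j(t⋆)`, `j = 1, 2, …, N`.  The generic value is doubled for `j = 1` in the
types `B`, `B^∨`, `D` (where `J^R(1) = 0`), and for `j = N` in type `D` (where `J^R(N) = N - 1`). -/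
def m (R : AffineType) (N : ℕ) (r tstar : ℝ) (j : ℕ) : ℂ :=
  match R with
  | .A => mGeneric .A N r tstar j
  | .B => if j = 1 then 2 * mGeneric .B N r tstar j else mGeneric .B N r tstar j
  | .Bv => if j = 1 then 2 * mGeneric .Bv N r tstar j else mGeneric .Bv N r tstar j
  | .C => mGeneric .C N r tstar j
  | .Cv => mGeneric .Cv N r tstar j
  | .BC => mGeneric .BC N r tstar j
  | .D => if j = 1 ∨ j = N then 2 * mGeneric .D N r tstar j else mGeneric .D N r tstar j

/-- `q^R_t(x) = det[conj M_j(x_k, t⋆ - t)] · det[M_j(x_k, t)]`, where `j` and `k` run through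
`1, 2, …, N` (the index `j : Fin N` stands for `j + 1`). -/
def q (R : AffineType) (N : ℕ) (r tstar t : ℝ) (x : Fin N → ℝ) : ℂ :=
  (Matrix.of fun j k : Fin N =>
      (starRingEnd ℂ) (M R N r ((j : ℕ) + 1) (x k) (tstar - t))).det *
    (Matrix.of fun j k : Fin N => M R N r ((j : ℕ) + 1) (x k) t).det

/-- The normalized weight `q^R_t(x) / ∏_{n=1}^N m_n(t⋆)`, a priori a complex number. -/
def weight (R : AffineType) (N : ℕ) (r tstar t : ℝ) (x : Fin N → ℝ) : ℂ :=
  q R N r tstar t x / ∏ n ∈ Finset.Icc 1 N, m R N r tstar n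

/-- The density `p^R_t(x)`, as a real number. -/
def density (R : AffineType) (N : ℕ) (r tstar t : ℝ) (x : Fin N → ℝ) : ℝ :=
  (weight R N r tstar t x).re

/-- The kernel `K^R_t(x, y) = ∑_{n=1}^N M_n(x, t) conj(M_n(y, t⋆ - t)) / m_n(t⋆)`. -/
def kernel (R : AffineType) (N : ℕ) (r tstar t : ℝ) (x y : ℝ) : ℂ :=
  ∑ n ∈ Finset.Icc 1 N,
    1 / m R N r tstar n * M R N r n x t * (starRingEnd ℂ) (M R N r n y (tstar - t))

/-! ### Point processes with a density, and determinantal point processes -/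

/-- The product set `S^n`. -/
def power (S : Set ℝ) (n : ℕ) : Set (Fin n → ℝ) := Set.univ.pi fun _ => S

/-- The Weyl alcove `{x ∈ S^N : x_1 < x_2 < ⋯ < x_N}`. -/
def alcove (S : Set ℝ) (N : ℕ) : Set (Fin N → ℝ) := {x | x ∈ power S N ∧ StrictMono x}

/-- The law `p(x) dx` of the ordered points `X = (X_1 < ⋯ < X_N)`. -/
def pointsLaw {N : ℕ} (S : Set ℝ) (p : (Fin N → ℝ) → ℝ) : Measure (Fin N → ℝ) :=
  (volume.restrict (alcove S N)).withDensity fun x => ENNReal.ofReal (p x)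

/-- The point measure `Ξ = ∑_j δ_{X_j}`. -/
def pointMeasure {N : ℕ} (X : Fin N → ℝ) : Measure ℝ := ∑ j, Measure.dirac (X j)

/-- The configuration `(x_1, …, x_n, y_1, …, y_{N-n})`. -/
def glue {n N : ℕ} (h : n ≤ N) (x : Fin n → ℝ) (y : Fin (N - n) → ℝ) : Fin N → ℝ :=
  fun i => Fin.append x y (Fin.cast (Nat.add_sub_of_le h).symm i)

/-- The `n`-point correlation function
`ρ_n(x_1, …, x_n) = 1 / (N - n)! ∫_{S^{N-n}} p(x_1, …, x_n, x_{n+1}, …, x_N) dx_{n+1} ⋯ dx_N`. -/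
def correlation {n N : ℕ} (h : n ≤ N) (S : Set ℝ) (p : (Fin N → ℝ) → ℝ) (x : Fin n → ℝ) : ℝ :=
  1 / ((N - n).factorial : ℝ) * ∫ y in power S (N - n), p (glue h x y)

/-- The function `p` on `S^N` defines an `N`-point process on `S`: it is a nonnegative symmetric
function for which the law `p(x) dx` of the ordered points has total mass one. -/
structure DefinesPointProcess {N : ℕ} (S : Set ℝ) (p : (Fin N → ℝ) → ℝ) : Prop where
  nonneg : ∀ x ∈ power S N, 0 ≤ p x
  symm : ∀ (σ : Equiv.Perm (Fin N)), ∀ x ∈ power S N, p (x ∘ σ) = p x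
  prob : IsProbabilityMeasure (pointsLaw S p)

/-- The `N`-point process on `S` with density `p` is determinantal with correlation kernel `K`:
`K` is continuous on `S × S`, and `ρ_n(x_1, …, x_n) = det[K(x_j, x_k)]` on `S^n`, `1 ≤ n ≤ N`.
The field `moments` says that these `ρ_n` are the correlation functions of the random point
measure `Ξ`, that is, `E[Ξ(A_1) ⋯ Ξ(A_n)] = ∫_{A_1 × ⋯ × A_n} ρ_n` for pairwise disjoint Borel
subsets `A_i` of `S`. -/
structure IsDeterminantal {N : ℕ} (S : Set ℝ) (p : (Fin N → ℝ) → ℝ) (K : ℝ → ℝ → ℂ) : Prop where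
  continuousOn : ContinuousOn (fun z : ℝ × ℝ => K z.1 z.2) (S ×ˢ S)
  integrable : ∀ (n : ℕ) (h : n ≤ N), 1 ≤ n → ∀ x ∈ power S n,
    IntegrableOn (fun y => p (glue h x y)) (power S (N - n))
  det_eq : ∀ (n : ℕ) (h : n ≤ N), 1 ≤ n → ∀ x ∈ power S n,
    (correlation h S p x : ℂ) = (Matrix.of fun j k : Fin n => K (x j) (x k)).det
  moments : ∀ (n : ℕ) (h : n ≤ N), 1 ≤ n → ∀ A : Fin n → Set ℝ,
    (∀ i, MeasurableSet (A i)) → (∀ i, A i ⊆ S) → Pairwise (Function.onFun Disjoint A) →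
    ∫⁻ X, ∏ i, pointMeasure X (A i) ∂(pointsLaw S p) =
      ∫⁻ x in Set.univ.pi A, ENNReal.ofReal (correlation h S p x)

end EllipticDPP

end

/-!
The functions `M^R_j(·, s)` are, up to constants, absolutely convergent trigonometric series with
Gaussian coefficients. Their frequencies are those congruent to `J^R(j) - 𝒩^R / 2` modulo `𝒩^R`,
folded by `x ↦ -x` outside type `A`. Different `j` have disjoint sets of frequencies, also after
the reflection, so that Parseval's formula gives the biorthogonality `integral_conj_M_mul_M`:
`∫ conj M_j(x, s) M_l(x, t) dx = δ_{jl} m_j(s + t)`. A frequency set that is stable under `k ↦ -k`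
counts twice, which accounts for the factors `c^R_j = 2`.

With `s = t_* - t`, biorthogonality says that `K^R_t` reproduces itself under integration and has
trace `N`, while `p^R_t(x) = det[K^R_t(x_j, x_k)]` by multiplicativity of the determinant. For
such a kernel, integrating one point out of the determinant of order `n + 1` gives `N - n` times
the determinant of order `n` (`integral_kernelDet_snoc`, by expanding a bordered determinant), and
the correlation functions follow. The integral of a symmetric function over `S^N` is `N!` times
that over the ordered configurations. This gives the total mass, and also the moments
`𝔼[Ξ(A_1) ⋯ Ξ(A_n)]`, since the product counts `n`-tuples of distinct points when the `A_i` are disjoint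
(`isDeterminantal_of_reproducing`).

It remains to see that `p^R_t` is nonnegative. Complex conjugation multiplies
`D_s(x) = det[M_j(x_k, s)]` by a sign that does not depend on `s`, so `conj D_s(x) * D_t(x)` is real
(`exists_conj_detM`). At distinct interior points `D_s(x)` does not vanish (`detM_ne_zero`):
otherwise some nonzero combination `F` of the `M_j(·, s)` would vanish at `N` distinct interior
points. But `F` is entire and quasi-periodic for a rectangular lattice. Divided by a product of
odd theta functions with the known zeros of `F`, it becomes an entire function whose modulus is
doubly periodic, hence a constant by Liouville's theorem. This determines the multipliers of `F`
and excludes further real zeros (`constraints_of_real_zeros`), and in each of the seven types one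
of these two consequences is violated (`eq_zero_of_zeros`). Therefore `conj D_s(x) * D_t(x)` keeps
its sign as `s` varies, and it is `|D_t(x)|² > 0` at `s = t` (`re_conj_detM_mul_detM_pos`).
Configurations on the boundary of `S^N` are limits of interior ones, and for coinciding points the
determinant vanishes.
-/

/-! ### Bordered determinants -/

/-- Expansion of a determinant bordered by one row and one column, in the case where the inner
block may be cancelled. -/
theorem det_fromBlocks_adjugate_of_ne_zero {R : Type*} [CommRing R] [IsDomain R] {n : ℕ}
    (A : Matrix (Fin n) (Fin n) R) (u : Matrix (Fin n) Unit R) (v : Matrix Unit (Fin n) R)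
    (d : Matrix Unit Unit R) (hA : A.det ≠ 0) :
    (Matrix.fromBlocks A u v d).det = d () () * A.det - (v * A.adjugate * u) () () := by
  have h : Matrix.fromBlocks A u v d *
      Matrix.fromBlocks 1 (-(A.adjugate * u)) 0 (A.det • (1 : Matrix Unit Unit R)) =
      Matrix.fromBlocks A 0 v (A.det • d - v * A.adjugate * u) := by
    rw [Matrix.fromBlocks_multiply]
    congr 1
    · simp
    · rw [Matrix.mul_neg, ← Matrix.mul_assoc, Matrix.mul_adjugate]
      simp
    · simp
    · simp only [Matrix.mul_neg, ← Matrix.mul_assoc, Matrix.mul_smul, Matrix.mul_one]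
      abel
  have h2 := congrArg Matrix.det h
  rw [Matrix.det_mul, Matrix.det_fromBlocks_zero₂₁, Matrix.det_fromBlocks_zero₁₂] at h2
  simp only [Matrix.det_one, one_mul, Matrix.det_unique, Matrix.smul_apply, Matrix.sub_apply,
    Matrix.one_apply_eq, smul_eq_mul, mul_one] at h2
  have h3 : A.det * (Matrix.fromBlocks A u v d).det =
      A.det * (d () () * A.det - (v * A.adjugate * u) () ()) := by
    rw [mul_comm, h2]
    simp only [PUnit.default_eq_unit]
    ring
  exact mul_left_cancel₀ hA h3

/-- Expansion of a determinant bordered by one row and one column. -/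
theorem det_fromBlocks_adjugate {R : Type*} [CommRing R] [IsDomain R] {n : ℕ}
    (A : Matrix (Fin n) (Fin n) R) (u : Matrix (Fin n) Unit R) (v : Matrix Unit (Fin n) R)
    (d : Matrix Unit Unit R) :
    (Matrix.fromBlocks A u v d).det = d () () * A.det - (v * A.adjugate * u) () () := by
  -- The generic matrix `X + A` over `R[X]` has nonzero determinant; specialize at `X = 0`.
  have h := det_fromBlocks_adjugate_of_ne_zero (Matrix.charmatrix (-A)) (u.map Polynomial.C)
    (v.map Polynomial.C) (d.map Polynomial.C) (Matrix.charpoly_monic (-A)).ne_zero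
  have hev : (Matrix.charmatrix (-A)).map (Polynomial.evalRingHom (0 : R)) = A := by
    ext i j
    by_cases hij : i = j
    · subst hij; simp [Matrix.charmatrix_apply_eq]
    · simp [Matrix.charmatrix_apply_ne _ _ _ hij]
  have hC : ∀ {m k : Type} (B : Matrix m k R),
      (B.map Polynomial.C).map (Polynomial.evalRingHom (0 : R)) = B := by
    intro m k B
    ext i j
    simp
  have h2 := congrArg (Polynomial.evalRingHom (0 : R)) h
  rw [RingHom.map_sub, RingHom.map_mul, RingHom.map_det, RingHom.map_det] at h2
  have h4 : (Polynomial.evalRingHom (0 : R)) ((v.map Polynomial.C *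
      (Matrix.charmatrix (-A)).adjugate * u.map Polynomial.C) () ()) =
      (v * A.adjugate * u) () () := by
    have : ((v.map Polynomial.C * (Matrix.charmatrix (-A)).adjugate *
        u.map Polynomial.C).map (Polynomial.evalRingHom (0 : R))) = v * A.adjugate * u := by
      rw [Matrix.map_mul, Matrix.map_mul, hC, hC]
      have := RingHom.map_adjugate (Polynomial.evalRingHom (0 : R)) (Matrix.charmatrix (-A))
      rw [RingHom.mapMatrix_apply, RingHom.mapMatrix_apply, hev] at this
      rw [this]
    exact congrFun (congrFun this ()) ()
  rw [h4] at h2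
  simp only [RingHom.mapMatrix_apply, Matrix.fromBlocks_map, hev, hC] at h2
  simpa using h2

/-! ### Integrating out points of a determinant with a reproducing kernel -/

/-- The determinant `det[K(x_j, x_k)]`. -/
noncomputable def kernelDet (K : ℝ → ℝ → ℂ) {n : ℕ} (x : Fin n → ℝ) : ℂ :=
  (Matrix.of fun j k : Fin n => K (x j) (x k)).det

theorem kernelDet_comp_equiv (K : ℝ → ℝ → ℂ) {n m : ℕ} (e : Fin m ≃ Fin n) (x : Fin n → ℝ) :
    kernelDet K (x ∘ e) = kernelDet K x := by
  unfold kernelDet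
  rw [← Matrix.det_submatrix_equiv_self e]
  rfl

theorem continuous_kernelDet {K : ℝ → ℝ → ℂ} (hK : Continuous (Function.uncurry K)) (n : ℕ) :
    Continuous (fun x : Fin n → ℝ => kernelDet K x) := by
  unfold kernelDet
  refine Continuous.matrix_det ?_
  refine continuous_matrix fun i j => ?_
  exact hK.comp (f := fun x : Fin n → ℝ => (x i, x j)) (by fun_prop)

theorem kernelDet_snoc (K : ℝ → ℝ → ℂ) {n : ℕ} (x : Fin n → ℝ) (y : ℝ) :
    kernelDet K (Fin.snoc x y : Fin (n + 1) → ℝ) = K y y * kernelDet K x -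
      ∑ i, ∑ j, (Matrix.of fun j k : Fin n => K (x j) (x k)).adjugate i j *
        (K (x j) y * K y (x i)) := by
  have h := det_fromBlocks_adjugate (Matrix.of fun j k : Fin n => K (x j) (x k))
    (Matrix.of fun j _ => K (x j) y) (Matrix.of fun _ j => K y (x j)) (Matrix.of fun _ _ => K y y)
  rw [← Matrix.det_submatrix_equiv_self
    ((finSumFinEquiv (m := n) (n := 1)).symm.trans
      (Equiv.sumCongr (Equiv.refl _) (Equiv.equivPUnit (Fin 1))))] at h
  have h2 : (Matrix.fromBlocks (Matrix.of fun j k : Fin n => K (x j) (x k))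
      (Matrix.of fun j (_ : Unit) => K (x j) y) (Matrix.of fun (_ : Unit) j => K y (x j))
      (Matrix.of fun (_ _ : Unit) => K y y)).submatrix
    ((finSumFinEquiv (m := n) (n := 1)).symm.trans
      (Equiv.sumCongr (Equiv.refl _) (Equiv.equivPUnit (Fin 1))))
    ((finSumFinEquiv (m := n) (n := 1)).symm.trans
      (Equiv.sumCongr (Equiv.refl _) (Equiv.equivPUnit (Fin 1)))) =
      Matrix.of fun j k : Fin (n + 1) => K ((Fin.snoc x y : Fin (n + 1) → ℝ) j)
        ((Fin.snoc x y : Fin (n + 1) → ℝ) k) := by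
    have e1 : ∀ i : Fin n, (finSumFinEquiv (m := n) (n := 1)).symm i.castSucc = Sum.inl i :=
      fun i => finSumFinEquiv_symm_apply_castAdd i
    have e2 : (finSumFinEquiv (m := n) (n := 1)).symm (Fin.last n) = Sum.inr 0 :=
      finSumFinEquiv_symm_apply_natAdd (m := n) (0 : Fin 1)
    ext i j
    refine Fin.lastCases ?_ (fun i => ?_) i <;> refine Fin.lastCases ?_ (fun j => ?_) j <;>
      simp [e1, e2]
  rw [h2] at h
  rw [kernelDet, h]
  congr 1
  rw [Matrix.mul_apply, Finset.sum_comm]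
  refine Finset.sum_congr rfl fun j _ => ?_
  rw [Matrix.mul_apply, Finset.sum_mul]
  refine Finset.sum_congr rfl fun i _ => ?_
  simp only [Matrix.of_apply]
  ring

theorem integrable_of_continuous_of_isBounded {n : ℕ} {E : Type*} [NormedAddCommGroup E]
    {S : Set ℝ} (hb : Bornology.IsBounded S) {f : (Fin n → ℝ) → E} (hf : Continuous f) :
    IntegrableOn f (EllipticDPP.power S n) := by
  have hc : IsCompact (Set.univ.pi fun _ : Fin n => closure S) :=
    isCompact_univ_pi fun _ => hb.isCompact_closure
  exact (hf.continuousOn.integrableOn_compact hc).mono_set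
    (Set.pi_mono fun _ _ => subset_closure)

theorem integrableOn_of_continuous_of_isBounded {E : Type*} [NormedAddCommGroup E]
    {S : Set ℝ} (hb : Bornology.IsBounded S) {f : ℝ → E} (hf : Continuous f) :
    IntegrableOn f S :=
  (hf.continuousOn.integrableOn_compact hb.isCompact_closure).mono_set subset_closure

/-- Integrating out one point: for a kernel `K` that is a projection of trace `N`,
`∫ det[K]_{n+1} dx_{n+1} = (N - n) det[K]_n`. -/
theorem integral_kernelDet_snoc {S : Set ℝ} (hb : Bornology.IsBounded S)
    {K : ℝ → ℝ → ℂ} (hK : Continuous (Function.uncurry K)) {N : ℂ}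
    (hrep : ∀ x z, ∫ y in S, K x y * K y z = K x z) (htr : ∫ y in S, K y y = N)
    {n : ℕ} (x : Fin n → ℝ) :
    ∫ y in S, kernelDet K (Fin.snoc x y : Fin (n + 1) → ℝ) = (N - n) * kernelDet K x := by
  have c1 : ∀ a, Continuous fun y => K a y := fun a => hK.comp (Continuous.prodMk_right a)
  have c2 : ∀ a, Continuous fun y => K y a := fun a => hK.comp (Continuous.prodMk_left a)
  have c3 : Continuous fun y => K y y := hK.comp (continuous_id.prodMk continuous_id)
  simp_rw [kernelDet_snoc]
  have i1 : ∀ i j, Integrable (fun y => (Matrix.of fun j k : Fin n => K (x j) (x k)).adjugate i j *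
        (K (x j) y * K y (x i))) (volume.restrict S) := fun i j =>
    integrableOn_of_continuous_of_isBounded hb (continuous_const.mul ((c1 _).mul (c2 _)))
  rw [integral_sub]
  · rw [integral_mul_const, htr, integral_finsetSum _
      (fun i _ => integrable_finsetSum _ fun j _ => i1 i j)]
    have : ∀ i, ∫ y in S, ∑ j, (Matrix.of fun j k : Fin n => K (x j) (x k)).adjugate i j *
        (K (x j) y * K y (x i)) = kernelDet K x := by
      intro i
      rw [integral_finsetSum _ (fun j _ => i1 i j)]
      simp_rw [integral_const_mul, hrep]
      have h := congrFun (congrFun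
        (Matrix.adjugate_mul (Matrix.of fun j k : Fin n => K (x j) (x k))) i) i
      rw [Matrix.mul_apply] at h
      simpa [kernelDet] using h
    simp_rw [this]
    simp
    ring
  · exact integrableOn_of_continuous_of_isBounded hb (c3.mul continuous_const)
  · exact integrable_finsetSum _ fun i _ => integrable_finsetSum _ fun j _ => i1 i j

/-- Fubini for the last coordinate over a power of `S`. -/
theorem setIntegral_power_succ {S : Set ℝ} (hb : Bornology.IsBounded S) {m : ℕ}
    {f : (Fin (m + 1) → ℝ) → ℂ} (hf : Continuous f) :
    ∫ y in EllipticDPP.power S (m + 1), f y =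
      ∫ y in EllipticDPP.power S m, ∫ a in S, f (Fin.snoc y a : Fin (m + 1) → ℝ) := by
  have hvol : ∀ k, (volume : Measure (Fin k → ℝ)).restrict (EllipticDPP.power S k) =
      Measure.pi fun _ => volume.restrict S := fun k =>
    Measure.restrict_pi_pi (fun _ : Fin k => (volume : Measure ℝ)) fun _ => S
  have hmp := (measurePreserving_piFinSuccAbove
    (fun _ : Fin (m + 1) => (volume : Measure ℝ).restrict S) (Fin.last m)).symm
  have hi : Integrable f (Measure.pi fun _ : Fin (m + 1) => volume.restrict S) := by
    have := integrable_of_continuous_of_isBounded hb hf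
    rwa [IntegrableOn, hvol] at this
  rw [hvol, hvol, ← hmp.integral_comp' f, integral_prod_symm]
  · simp [MeasurableEquiv.piFinSuccAbove_symm_apply, Fin.insertNthEquiv, Fin.insertNth_last']
  · exact hmp.integrable_comp_of_integrable hi

/-- Integrating out `m` points of a determinant with a reproducing kernel of trace `N`. -/
theorem integral_kernelDet_append {S : Set ℝ} (hb : Bornology.IsBounded S)
    {K : ℝ → ℝ → ℂ} (hK : Continuous (Function.uncurry K)) {N : ℂ}
    (hrep : ∀ x z, ∫ y in S, K x y * K y z = K x z) (htr : ∫ y in S, K y y = N)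
    {n : ℕ} (x : Fin n → ℝ) (m : ℕ) :
    ∫ y in EllipticDPP.power S m, kernelDet K (Fin.append x y) =
      (∏ i ∈ Finset.range m, (N - (n + i : ℕ))) * kernelDet K x := by
  induction m with
  | zero =>
    have h : ∀ y : Fin 0 → ℝ, kernelDet K (Fin.append x y) = kernelDet K x := fun y => by
      have : Fin.append x y = x := by
        rw [Subsingleton.elim y Fin.elim0, Fin.append_elim0]; rfl
      exact congrArg (kernelDet K) this
    have hp : EllipticDPP.power S 0 = Set.univ := by
      ext; simp [EllipticDPP.power]
    simp_rw [h, hp]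
    simp [measureReal_def, volume_pi]
  | succ m ih =>
    have hc : Continuous fun y : Fin (m + 1) → ℝ => kernelDet K (Fin.append x y) := by
      refine (continuous_kernelDet hK _).comp ?_
      refine continuous_pi fun i => ?_
      refine Fin.addCases (fun i => ?_) (fun i => ?_) i
      · simpa using continuous_const
      · simpa using continuous_apply i
    rw [setIntegral_power_succ hb hc]
    have h1 : ∀ y : Fin m → ℝ, ∫ a in S, kernelDet K
        (Fin.append x (Fin.snoc y a : Fin (m + 1) → ℝ)) =
          (N - (n + m : ℕ)) * kernelDet K (Fin.append x y) := by
      intro y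
      rw [← integral_kernelDet_snoc hb hK hrep htr]
      refine integral_congr_ae (Filter.Eventually.of_forall fun a => ?_)
      exact congrArg (kernelDet K) (Fin.append_snoc x y a)
    simp_rw [h1]
    rw [integral_const_mul, ih, Finset.prod_range_succ]
    ring

/-! ### Symmetric functions on a power and on its alcove -/

theorem measurableSet_power {S : Set ℝ} (hS : MeasurableSet S) (n : ℕ) :
    MeasurableSet (EllipticDPP.power S n) :=
  MeasurableSet.univ_pi fun _ => hS

theorem measurableSet_alcove {S : Set ℝ} (hS : MeasurableSet S) (N : ℕ) :
    MeasurableSet (EllipticDPP.alcove S N) := by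
  have : EllipticDPP.alcove S N = EllipticDPP.power S N ∩
      ⋂ i : Fin N, ⋂ j : Fin N, {x | i < j → x i < x j} := by
    ext x
    simp [EllipticDPP.alcove, StrictMono]
  rw [this]
  refine (measurableSet_power hS N).inter ?_
  refine MeasurableSet.iInter fun i => MeasurableSet.iInter fun j => ?_
  by_cases h : i < j
  · simpa [h] using measurableSet_lt (measurable_pi_apply i) (measurable_pi_apply j)
  · simp [h]

theorem comp_perm_mem_power {S : Set ℝ} {N : ℕ} (σ : Equiv.Perm (Fin N)) {x : Fin N → ℝ}
    (hx : x ∈ EllipticDPP.power S N) : x ∘ σ ∈ EllipticDPP.power S N :=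
  fun i _ => hx (σ i) (Set.mem_univ _)

theorem measurePreserving_comp_perm {N : ℕ} (σ : Equiv.Perm (Fin N)) :
    MeasurePreserving (fun x : Fin N → ℝ => x ∘ σ) volume volume := by
  have h := volume_measurePreserving_piCongrLeft (fun _ : Fin N => ℝ) σ.symm
  have h2 : (fun x : Fin N → ℝ => x ∘ σ) =
      MeasurableEquiv.piCongrLeft (fun _ : Fin N => ℝ) σ.symm := by
    funext x i
    have := Equiv.piCongrLeft_apply_apply (fun _ : Fin N => ℝ) σ.symm x (σ i)
    rw [Equiv.symm_apply_apply] at this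
    exact this.symm
  rw [h2]
  exact h

theorem ae_injective (N : ℕ) : ∀ᵐ x : Fin N → ℝ, Function.Injective x := by
  have h : ∀ i j : Fin N, i ≠ j → ∀ᵐ x : Fin N → ℝ, x i ≠ x j := by
    intro i j hij
    let W : Submodule ℝ (Fin N → ℝ) :=
      LinearMap.ker (LinearMap.proj (R := ℝ) (φ := fun _ : Fin N => ℝ) i - LinearMap.proj j)
    have hW : W ≠ ⊤ := by
      intro h
      have : Pi.single i (1 : ℝ) ∈ W := by rw [h]; trivial
      simp [W, LinearMap.mem_ker, hij] at this
    have h0 := Measure.addHaar_submodule volume W hW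
    refine measure_mono_null ?_ h0
    intro x hx
    have : x i = x j := by simpa using hx
    simp [W, this]
  have h2 : ∀ᵐ x : Fin N → ℝ, ∀ i j : Fin N, i ≠ j → x i ≠ x j := by
    rw [ae_all_iff]; intro i
    rw [ae_all_iff]; intro j
    by_cases hij : i = j
    · simp [hij]
    · filter_upwards [h i j hij] with x hx _ using hx
  filter_upwards [h2] with x hx i j hij
  by_contra hne
  exact hx i j hne hij

/-- A symmetric function has the same integral over each of the `N!` chambers of `S^N`. -/
theorem lintegral_power_eq_factorial_mul {S : Set ℝ} (hS : MeasurableSet S) {N : ℕ}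
    {f : (Fin N → ℝ) → ENNReal}
    (hsymm : ∀ σ : Equiv.Perm (Fin N), ∀ x ∈ EllipticDPP.power S N, f (x ∘ σ) = f x) :
    ∫⁻ x in EllipticDPP.power S N, f x =
      (N.factorial : ENNReal) * ∫⁻ x in EllipticDPP.alcove S N, f x := by
  let C : Equiv.Perm (Fin N) → Set (Fin N → ℝ) := fun σ =>
    (fun x : Fin N → ℝ => x ∘ σ) ⁻¹' EllipticDPP.alcove S N
  have hCm : ∀ σ, MeasurableSet (C σ) := fun σ =>
    (measurePreserving_comp_perm σ).measurable (measurableSet_alcove hS N)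
  have hCp : ∀ σ, C σ ⊆ EllipticDPP.power S N := by
    intro σ x hx
    have := comp_perm_mem_power σ.symm (hx : x ∘ σ ∈ EllipticDPP.alcove S N).1
    simpa [Function.comp_assoc] using this
  have hdisj : Pairwise (Function.onFun Disjoint C) := by
    intro σ τ hστ
    refine Set.disjoint_left.2 fun x hx hy => hστ ?_
    have h1 : StrictMono (x ∘ σ) := hx.2
    have h2 : StrictMono (x ∘ τ) := hy.2
    -- A bijection of `Fin N` that preserves the order is the identity.
    have h3 : StrictMono (σ.symm ∘ τ) := by
      intro a b hab
      have := h2 hab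
      rw [Function.comp_apply, Function.comp_apply] at this
      by_contra hle
      have h4 := h1.monotone (not_lt.1 hle)
      simp only [Function.comp_apply, Equiv.apply_symm_apply] at h4
      exact absurd this (not_lt.2 h4)
    have h5 : (σ.symm ∘ τ) = id := by
      have : Set.range (σ.symm ∘ τ) = Set.range (id : Fin N → Fin N) := by
        rw [Set.range_id, Set.range_eq_univ]
        exact σ.symm.surjective.comp τ.surjective
      exact (StrictMono.range_inj h3 strictMono_id).1 this
    ext i
    have := congrFun h5 i
    simp only [Function.comp_apply, id] at this
    rw [Equiv.symm_apply_eq] at this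
    rw [this]
  have hae : EllipticDPP.power S N =ᵐ[volume] ⋃ σ, C σ := by
    filter_upwards [ae_injective N] with x hx
    refine propext ⟨fun h => ?_, fun h => ?_⟩
    · have hx' : x ∈ EllipticDPP.power S N := h
      refine Set.mem_iUnion.2 ⟨Tuple.sort x, comp_perm_mem_power _ hx', ?_⟩
      exact (Tuple.monotone_sort x).strictMono_of_injective
        (hx.comp (Tuple.sort x).injective)
    · obtain ⟨σ, hσ⟩ := Set.mem_iUnion.1 (h : x ∈ ⋃ σ, C σ)
      exact hCp σ hσ
  rw [setLIntegral_congr hae, lintegral_iUnion hCm hdisj, tsum_fintype]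
  have hC : ∀ σ, ∫⁻ x in C σ, f x = ∫⁻ x in EllipticDPP.alcove S N, f x := by
    intro σ
    rw [setLIntegral_congr_fun (g := fun x => f (x ∘ σ)) (hCm σ)
      (fun x hx => (hsymm σ x (hCp σ hx)).symm)]
    have hemb : MeasurableEmbedding (fun x : Fin N → ℝ => x ∘ σ) := by
      refine (MeasurableEquiv.mk (Equiv.arrowCongr σ.symm (Equiv.refl ℝ)) ?_ ?_).measurableEmbedding
      · exact measurable_pi_lambda _ fun i => measurable_pi_apply _
      · exact measurable_pi_lambda _ fun i => measurable_pi_apply _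
    exact (measurePreserving_comp_perm σ).setLIntegral_comp_preimage_emb hemb f _
  simp_rw [hC]
  rw [Finset.sum_const, Finset.card_univ, Fintype.card_perm, Fintype.card_fin, nsmul_eq_mul]

/-! ### The joint intensities of a random point measure with a density -/

theorem continuous_glue {n N : ℕ} (h : n ≤ N) :
    Continuous fun z : (Fin n → ℝ) × (Fin (N - n) → ℝ) => EllipticDPP.glue h z.1 z.2 := by
  refine continuous_pi fun i => ?_
  unfold EllipticDPP.glue
  generalize Fin.cast (Nat.add_sub_of_le h).symm i = k
  refine Fin.addCases (fun i => ?_) (fun i => ?_) k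
  · simpa using (by fun_prop : Continuous fun a : (Fin n → ℝ) × (Fin (N - n) → ℝ) => a.1 i)
  · simpa using (by fun_prop : Continuous fun a : (Fin n → ℝ) × (Fin (N - n) → ℝ) => a.2 i)

theorem glue_castLE {n N : ℕ} (h : n ≤ N) (x : Fin n → ℝ) (y : Fin (N - n) → ℝ) (i : Fin n) :
    EllipticDPP.glue h x y (Fin.castLE h i) = x i := by
  have : Fin.cast (Nat.add_sub_of_le h).symm (Fin.castLE h i) = Fin.castAdd (N - n) i := by
    ext; simp
  rw [EllipticDPP.glue, this, Fin.append_left]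

theorem measurePreserving_glue {n N : ℕ} (h : n ≤ N) :
    MeasurePreserving (fun z : (Fin n → ℝ) × (Fin (N - n) → ℝ) => EllipticDPP.glue h z.1 z.2)
      (volume.prod volume) volume := by
  let e : Fin n ⊕ Fin (N - n) ≃ Fin N :=
    finSumFinEquiv.trans (finCongr (Nat.add_sub_of_le h))
  have h1 := volume_measurePreserving_sumPiEquivProdPi_symm (fun _ : Fin n ⊕ Fin (N - n) => ℝ)
  have h2 := volume_measurePreserving_piCongrLeft (fun _ : Fin N => ℝ) e
  have h3 := h2.comp h1
  suffices h5 : (fun z : (Fin n → ℝ) × (Fin (N - n) → ℝ) => EllipticDPP.glue h z.1 z.2) =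
      (MeasurableEquiv.piCongrLeft (fun _ : Fin N => ℝ) e) ∘
        (MeasurableEquiv.sumPiEquivProdPi (fun _ : Fin n ⊕ Fin (N - n) => ℝ)).symm by
    rw [h5]
    exact h3
  funext z
  funext i
  obtain ⟨k, rfl⟩ := e.surjective i
  have h4 := Equiv.piCongrLeft_apply_apply (fun _ : Fin N => ℝ) e
    ((MeasurableEquiv.sumPiEquivProdPi (fun _ : Fin n ⊕ Fin (N - n) => ℝ)).symm z) k
  rw [Function.comp_apply]
  refine Eq.trans ?_ h4.symm
  rcases k with k | k
  · have : EllipticDPP.glue h z.1 z.2 (e (Sum.inl k)) = z.1 k := by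
      simp [EllipticDPP.glue, e]
    exact this
  · have : EllipticDPP.glue h z.1 z.2 (e (Sum.inr k)) = z.2 k := by
      simp [EllipticDPP.glue, e]
    exact this

theorem glue_mem_power_iff {S : Set ℝ} {n N : ℕ} (h : n ≤ N) (x : Fin n → ℝ)
    (y : Fin (N - n) → ℝ) :
    EllipticDPP.glue h x y ∈ EllipticDPP.power S N ↔
      x ∈ EllipticDPP.power S n ∧ y ∈ EllipticDPP.power S (N - n) := by
  constructor
  · intro hz
    refine ⟨fun i _ => ?_, fun i _ => ?_⟩
    · rw [← glue_castLE h x y i]; exact hz _ trivial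
    · have := hz (Fin.cast (Nat.add_sub_of_le h) (Fin.natAdd n i)) trivial
      simpa [EllipticDPP.glue] using this
  · rintro ⟨hx, hy⟩ i _
    show EllipticDPP.glue h x y i ∈ S
    rw [EllipticDPP.glue]
    generalize Fin.cast (Nat.add_sub_of_le h).symm i = k
    refine Fin.addCases (fun i => ?_) (fun i => ?_) k
    · simpa using hx i trivial
    · simpa using hy i trivial

theorem exists_perm_extending {n N : ℕ} (h : n ≤ N) (g : Fin n ↪ Fin N) :
    ∃ σ : Equiv.Perm (Fin N), ∀ i, σ (Fin.castLE h i) = g i := by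
  have := Equiv.Perm.isMultiplyPretransitive (Fin N) n
  obtain ⟨σ, hσ⟩ := MulAction.exists_smul_eq (Equiv.Perm (Fin N)) (Fin.castLEEmb h) g
  exact ⟨σ, fun i => by rw [← hσ]; rfl⟩

/-- `Ξ(A_1) ⋯ Ξ(A_n)` counts the `n`-tuples of distinct points with the `i`-th one in `A_i`. -/
theorem prod_pointMeasure {n N : ℕ} (X : Fin N → ℝ) {A : Fin n → Set ℝ}
    (hA : ∀ i, MeasurableSet (A i)) (hdisj : Pairwise (Function.onFun Disjoint A)) :
    ∏ i, EllipticDPP.pointMeasure X (A i) =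
      ∑ g : Fin n ↪ Fin N, ∏ i, (A i).indicator (1 : ℝ → ENNReal) (X (g i)) := by
  have h1 : ∀ i, EllipticDPP.pointMeasure X (A i) =
      ∑ j, (A i).indicator (1 : ℝ → ENNReal) (X j) := by
    intro i
    rw [EllipticDPP.pointMeasure, Measure.finsetSum_apply]
    exact Finset.sum_congr rfl fun j _ => Measure.dirac_apply' _ (hA i)
  simp_rw [h1]
  rw [Finset.prod_univ_sum, Fintype.piFinset_univ]
  symm
  refine Finset.sum_bij_ne_zero (fun g _ _ => (g : Fin n → Fin N)) (fun _ _ _ => Finset.mem_univ _)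
    (fun g _ _ g' _ _ hgg => DFunLike.coe_injective hgg) ?_ (fun _ _ _ => rfl)
  intro g _ hg
  have hinj : Function.Injective g := by
    intro i j hij
    by_contra hne
    have hi : ∀ k, X (g k) ∈ A k := by
      intro k
      by_contra hk
      exact hg (Finset.prod_eq_zero (Finset.mem_univ k) (Set.indicator_of_notMem hk _))
    exact Set.disjoint_left.1 (hdisj hne) (hi i) (by rw [hij]; exact hi j)
  exact ⟨⟨g, hinj⟩, Finset.mem_univ _, hg, rfl⟩

theorem prod_indicator_eq {n : ℕ} (A : Fin n → Set ℝ) (x : Fin n → ℝ) :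
    ∏ i, (A i).indicator (1 : ℝ → ENNReal) (x i) =
      (Set.univ.pi A).indicator (1 : (Fin n → ℝ) → ENNReal) x := by
  by_cases hx : x ∈ Set.univ.pi A
  · rw [Set.indicator_of_mem hx]
    exact Finset.prod_eq_one fun i _ => Set.indicator_of_mem (hx i trivial) _
  · rw [Set.indicator_of_notMem hx]
    simp only [Set.mem_pi, Set.mem_univ, true_implies, not_forall] at hx
    obtain ⟨i, hi⟩ := hx
    exact Finset.prod_eq_zero (Finset.mem_univ i) (Set.indicator_of_notMem hi _)

/-- The factorial moments of the point process with symmetric density `p` are given by the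
marginals of `p`. -/
theorem lintegral_prod_pointMeasure {S : Set ℝ} (hS : MeasurableSet S) {n N : ℕ} (h : n ≤ N)
    {p : (Fin N → ℝ) → ℝ} (hp : Measurable p)
    (hsymm : ∀ (σ : Equiv.Perm (Fin N)), ∀ x ∈ EllipticDPP.power S N, p (x ∘ σ) = p x)
    {A : Fin n → Set ℝ} (hA : ∀ i, MeasurableSet (A i)) (hAS : ∀ i, A i ⊆ S)
    (hdisj : Pairwise (Function.onFun Disjoint A)) :
    ((N - n).factorial : ENNReal) *
      ∫⁻ X, ∏ i, EllipticDPP.pointMeasure X (A i) ∂(EllipticDPP.pointsLaw S p) =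
      ∫⁻ x in Set.univ.pi A, ∫⁻ y in EllipticDPP.power S (N - n),
        ENNReal.ofReal (p (EllipticDPP.glue h x y)) := by
  let I : (Fin n ↪ Fin N) → (Fin N → ℝ) → ENNReal := fun g X =>
    ∏ i, (A i).indicator (1 : ℝ → ENNReal) (X (g i))
  let P : (Fin N → ℝ) → ENNReal := fun X => ENNReal.ofReal (p X)
  have hPm : Measurable P := hp.ennreal_ofReal
  have hIm : ∀ g, Measurable (I g) := fun g => by
    refine Finset.measurable_prod _ fun i _ => ?_
    exact (measurable_one.indicator (hA i)).comp (measurable_pi_apply (g i))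
  have hPI : ∀ g, Measurable fun X => P X * I g X := fun g => hPm.mul (hIm g)
  let B := ∫⁻ x in Set.univ.pi A, ∫⁻ y in EllipticDPP.power S (N - n),
        ENNReal.ofReal (p (EllipticDPP.glue h x y))
  have hPs : ∀ (σ : Equiv.Perm (Fin N)), ∀ x ∈ EllipticDPP.power S N, P (x ∘ σ) = P x :=
    fun σ x hx => by simp only [P, hsymm σ x hx]
  have hbase : ∫⁻ X in EllipticDPP.power S N, P X * I (Fin.castLEEmb h) X = B := by
    rw [← lintegral_indicator (measurableSet_power hS N),
      ← (measurePreserving_glue h).lintegral_comp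
        ((hPI _).indicator (measurableSet_power hS N))]
    have hm : Measurable fun z : (Fin n → ℝ) × (Fin (N - n) → ℝ) =>
        (EllipticDPP.power S N).indicator (fun X => P X * I (Fin.castLEEmb h) X)
          (EllipticDPP.glue h z.1 z.2) :=
      ((hPI _).indicator (measurableSet_power hS N)).comp (measurePreserving_glue h).measurable
    rw [lintegral_prod _ hm.aemeasurable]
    show _ = ∫⁻ x in Set.univ.pi A, _
    rw [← lintegral_indicator (MeasurableSet.univ_pi hA)]
    refine lintegral_congr fun x => ?_
    have hI : ∀ y, I (Fin.castLEEmb h) (EllipticDPP.glue h x y) =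
        (Set.univ.pi A).indicator (1 : (Fin n → ℝ) → ENNReal) x := by
      intro y
      rw [← prod_indicator_eq]
      refine Finset.prod_congr rfl fun i _ => ?_
      rw [Fin.castLEEmb_apply, glue_castLE]
    by_cases hx : x ∈ Set.univ.pi A
    · rw [Set.indicator_of_mem hx, ← lintegral_indicator (measurableSet_power hS _)]
      refine lintegral_congr fun y => ?_
      have hxS : x ∈ EllipticDPP.power S n := fun i hi => hAS i (hx i hi)
      by_cases hy : y ∈ EllipticDPP.power S (N - n)
      · rw [Set.indicator_of_mem ((glue_mem_power_iff h x y).2 ⟨hxS, hy⟩), Set.indicator_of_mem hy,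
          hI, Set.indicator_of_mem hx]
        simp [P]
      · rw [Set.indicator_of_notMem (fun hz => hy ((glue_mem_power_iff h x y).1 hz).2),
          Set.indicator_of_notMem hy]
    · rw [Set.indicator_of_notMem hx]
      refine (lintegral_congr fun y => ?_).trans lintegral_zero
      refine Set.indicator_apply_eq_zero.2 fun _ => ?_
      show P _ * I (Fin.castLEEmb h) (EllipticDPP.glue h x y) = 0
      rw [hI, Set.indicator_of_notMem hx, mul_zero]
  have hI : ∀ g, ∫⁻ X in EllipticDPP.power S N, P X * I g X = B := by
    intro g
    obtain ⟨σ, hσ⟩ := exists_perm_extending h g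
    rw [← hbase]
    have hpre : (fun x : Fin N → ℝ => x ∘ σ) ⁻¹' EllipticDPP.power S N =
        EllipticDPP.power S N := by
      ext x
      refine ⟨fun hx => ?_, comp_perm_mem_power σ⟩
      have := comp_perm_mem_power σ.symm (hx : x ∘ σ ∈ EllipticDPP.power S N)
      simpa [Function.comp_assoc] using this
    rw [← (measurePreserving_comp_perm σ).setLIntegral_comp_preimage (measurableSet_power hS N)
      (hPI (Fin.castLEEmb h)), hpre]
    refine setLIntegral_congr_fun (measurableSet_power hS N) fun X hX => ?_
    show P X * I g X = P (X ∘ σ) * I (Fin.castLEEmb h) (X ∘ σ)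
    rw [hPs σ X hX]
    congr 1
    refine Finset.prod_congr rfl fun i _ => ?_
    simp [hσ]
  let G : (Fin N → ℝ) → ENNReal := fun X => ∑ g, I g X
  have hGm : Measurable G := Finset.measurable_sum _ fun g _ => hIm g
  have hGs : ∀ (σ : Equiv.Perm (Fin N)) x, G (x ∘ σ) = G x := by
    intro σ x
    exact Fintype.sum_equiv (Equiv.embeddingCongr (Equiv.refl _) σ) _ _ fun g => rfl
  have hpow : ∫⁻ X in EllipticDPP.power S N, P X * G X = (N.descFactorial n : ENNReal) * B := by
    simp_rw [G, Finset.mul_sum]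
    rw [lintegral_finsetSum _ fun g _ => hPI g]
    simp_rw [hI]
    rw [Finset.sum_const, Finset.card_univ, Fintype.card_embedding_eq, Fintype.card_fin,
      Fintype.card_fin, nsmul_eq_mul]
  have hsum := lintegral_power_eq_factorial_mul hS (f := fun X => P X * G X)
    fun σ x hx => by simp only [hPs σ x hx, hGs]
  have hlaw : ∫⁻ X, ∏ i, EllipticDPP.pointMeasure X (A i) ∂(EllipticDPP.pointsLaw S p) =
      ∫⁻ X in EllipticDPP.alcove S N, P X * G X := by
    rw [EllipticDPP.pointsLaw]
    simp_rw [prod_pointMeasure _ hA hdisj]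
    rw [lintegral_withDensity_eq_lintegral_mul _ hPm hGm]
    rfl
  rw [hlaw]
  rw [hpow, ← Nat.factorial_mul_descFactorial h] at hsum
  have hd : (N.descFactorial n : ENNReal) ≠ 0 := by
    exact_mod_cast (Nat.descFactorial_pos.2 h).ne'
  push_cast at hsum
  rw [mul_comm ((N - n).factorial : ENNReal), mul_assoc] at hsum
  exact ((ENNReal.mul_right_inj hd (ENNReal.natCast_ne_top _)).1 hsum).symm

/-! ### Determinantal point processes from projection kernels -/

theorem prod_range_sub_eq_factorial (n m : ℕ) :
    ∏ i ∈ Finset.range m, (((n + m : ℕ) : ℂ) - (n + i : ℕ)) = m.factorial := by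
  rw [← Finset.prod_range_add_one_eq_factorial, Nat.cast_prod,
    ← Finset.prod_range_reflect]
  refine Finset.prod_congr rfl fun i hi => ?_
  have hi' := Finset.mem_range.1 hi
  rw [sub_eq_iff_eq_add]
  norm_cast
  omega

/-- A nonnegative function of the form `det[K(x_j, x_k)]`, where `K` is a projection kernel of
rank `N` on `S`, is the density of a determinantal `N`-point process. -/
theorem isDeterminantal_of_reproducing {S : Set ℝ} (hS : MeasurableSet S)
    (hb : Bornology.IsBounded S) {N : ℕ} {p : (Fin N → ℝ) → ℝ} {K : ℝ → ℝ → ℂ}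
    (hK : Continuous (Function.uncurry K))
    (hrep : ∀ x z, ∫ y in S, K x y * K y z = K x z) (htr : ∫ y in S, K y y = N)
    (hp : Continuous p) (hreal : ∀ x ∈ EllipticDPP.power S N, (p x : ℂ) = kernelDet K x)
    (hpos : ∀ x ∈ EllipticDPP.power S N, 0 ≤ p x) :
    EllipticDPP.DefinesPointProcess S p ∧ EllipticDPP.IsDeterminantal S p K := by
  have hsymm : ∀ (σ : Equiv.Perm (Fin N)), ∀ x ∈ EllipticDPP.power S N, p (x ∘ σ) = p x := by
    intro σ x hx
    have h := hreal _ (comp_perm_mem_power σ hx)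
    rw [kernelDet_comp_equiv, ← hreal x hx] at h
    exact_mod_cast h
  have hint : ∀ (n : ℕ) (h : n ≤ N) (x : Fin n → ℝ),
      IntegrableOn (fun y => p (EllipticDPP.glue h x y)) (EllipticDPP.power S (N - n)) :=
    fun n h x => integrable_of_continuous_of_isBounded hb
      (hp.comp ((continuous_glue h).comp (Continuous.prodMk_right x)))
  have hglue : ∀ (n : ℕ) (h : n ≤ N), ∀ x ∈ EllipticDPP.power S n,
      ((∫ y in EllipticDPP.power S (N - n), p (EllipticDPP.glue h x y) : ℝ) : ℂ) =
        (N - n).factorial * kernelDet K x := by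
    intro n h x hx
    rw [← integral_complex_ofReal]
    have h1 : ∀ y ∈ EllipticDPP.power S (N - n), (p (EllipticDPP.glue h x y) : ℂ) =
        kernelDet K (Fin.append x y) := by
      intro y hy
      rw [hreal _ ((glue_mem_power_iff h x y).2 ⟨hx, hy⟩)]
      exact kernelDet_comp_equiv K (finCongr (Nat.add_sub_of_le h).symm) (Fin.append x y)
    rw [setIntegral_congr_fun (measurableSet_power hS _) h1,
      integral_kernelDet_append hb hK hrep htr]
    congr 1
    have h2 := prod_range_sub_eq_factorial n (N - n)
    rwa [Nat.add_sub_of_le h] at h2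
  have hcorr : ∀ (n : ℕ) (h : n ≤ N), ∀ x ∈ EllipticDPP.power S n,
      (EllipticDPP.correlation h S p x : ℂ) = kernelDet K x := by
    intro n h x hx
    rw [EllipticDPP.correlation]
    push_cast
    rw [hglue n h x hx]
    have : ((N - n).factorial : ℂ) ≠ 0 := by exact_mod_cast (Nat.factorial_pos _).ne'
    field_simp
  have hmom : ∀ (n : ℕ) (h : n ≤ N) (A : Fin n → Set ℝ), (∀ i, MeasurableSet (A i)) →
      (∀ i, A i ⊆ S) → Pairwise (Function.onFun Disjoint A) →
      ∫⁻ X, ∏ i, EllipticDPP.pointMeasure X (A i) ∂(EllipticDPP.pointsLaw S p) =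
        ∫⁻ x in Set.univ.pi A, ENNReal.ofReal (EllipticDPP.correlation h S p x) := by
    intro n h A hA hAS hdisj
    have h1 := lintegral_prod_pointMeasure hS h hp.measurable hsymm hA hAS hdisj
    have h2 : ∀ x ∈ Set.univ.pi A, ∫⁻ y in EllipticDPP.power S (N - n),
        ENNReal.ofReal (p (EllipticDPP.glue h x y)) =
          ((N - n).factorial : ENNReal) * ENNReal.ofReal (EllipticDPP.correlation h S p x) := by
      intro x hx
      have hxS : x ∈ EllipticDPP.power S n := fun i hi => hAS i (hx i hi)
      rw [← ofReal_integral_eq_lintegral_ofReal (hint n h x)]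
      · rw [← ENNReal.ofReal_natCast, ← ENNReal.ofReal_mul (by positivity), EllipticDPP.correlation,
          ← mul_assoc, mul_one_div_cancel, one_mul]
        exact_mod_cast (Nat.factorial_pos _).ne'
      · refine (ae_restrict_iff' (measurableSet_power hS _)).2 (Filter.Eventually.of_forall ?_)
        intro y hy
        exact hpos _ ((glue_mem_power_iff h x y).2 ⟨hxS, hy⟩)
    rw [setLIntegral_congr_fun (MeasurableSet.univ_pi hA) h2,
      lintegral_const_mul' _ _ (ENNReal.natCast_ne_top _)] at h1
    exact (ENNReal.mul_right_inj (by exact_mod_cast (Nat.factorial_pos _).ne')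
      (ENNReal.natCast_ne_top _)).1 h1
  refine ⟨⟨hpos, hsymm, ⟨?_⟩⟩, ⟨hK.continuousOn, fun n h _ x _ => hint n h x,
    fun n h _ x hx => hcorr n h x hx, fun n h _ A => hmom n h A⟩⟩
  -- The total mass is the moment of order `0`.
  have h0 := hmom 0 (Nat.zero_le N) Fin.elim0 (fun i => i.elim0) (fun i => i.elim0)
    (fun i => i.elim0)
  have hc : ∀ x, EllipticDPP.correlation (Nat.zero_le N) S p x = 1 := by
    intro x
    have := hcorr 0 (Nat.zero_le N) x (fun i _ => i.elim0)
    rw [kernelDet, Matrix.det_isEmpty] at this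
    exact_mod_cast this
  simp_rw [hc] at h0
  simpa [volume_pi, Measure.pi_of_empty] using h0

/-! ### An odd theta function in product form -/

/-- The infinite product `∏_{m ≥ 0} (1 - q^m w)`. -/
noncomputable def qProd (q w : ℂ) : ℂ := ∏' m : ℕ, (1 - q ^ m * w)

theorem summable_norm_pow_mul {q : ℂ} (hq : ‖q‖ < 1) (w : ℂ) :
    Summable fun m : ℕ => ‖-(q ^ m * w)‖ := by
  simpa [norm_mul, norm_pow] using
    (summable_geometric_of_lt_one (norm_nonneg q) hq).mul_right ‖w‖

theorem qProd_eq_mul {q : ℂ} (hq : ‖q‖ < 1) (w : ℂ) :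
    qProd q w = (1 - w) * qProd q (q * w) := by
  have h : Multipliable fun m : ℕ => 1 - q ^ (m + 1) * w := by
    have := multipliable_one_add_of_summable (summable_norm_pow_mul hq (q * w))
    refine this.congr fun m => ?_
    rw [pow_succ]
    ring
  have h1 : qProd q w = (1 - q ^ 0 * w) * ∏' m : ℕ, (1 - q ^ (m + 1) * w) :=
    tprod_eq_zero_mul' (f := fun m : ℕ => 1 - q ^ m * w) h
  have h2 : qProd q (q * w) = ∏' m : ℕ, (1 - q ^ (m + 1) * w) :=
    tprod_congr fun m => by rw [pow_succ]; ring
  rw [h1, h2, pow_zero, one_mul]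

theorem qProd_ne_zero {q : ℂ} (hq : ‖q‖ < 1) {w : ℂ} (hw : ∀ m : ℕ, q ^ m * w ≠ 1) :
    qProd q w ≠ 0 := by
  have := tprod_one_add_ne_zero_of_summable (f := fun m : ℕ => -(q ^ m * w))
    (fun m h => hw m (by linear_combination -h)) (summable_norm_pow_mul hq w)
  simpa [qProd, sub_eq_add_neg] using this

theorem differentiable_qProd {q : ℂ} (hq : ‖q‖ < 1) : Differentiable ℂ (qProd q) := by
  have h : HasProdLocallyUniformlyOn (fun (m : ℕ) w => 1 + -(q ^ m * w))
      (fun w => ∏' m : ℕ, (1 + -(q ^ m * w))) Set.univ := by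
    apply hasProdLocallyUniformlyOn_of_forall_compact isOpen_univ
    intro K _ hK
    obtain ⟨C, hC⟩ := hK.isBounded.exists_norm_le
    have hu : Summable fun m : ℕ => ‖q‖ ^ m * C :=
      (summable_geometric_of_lt_one (norm_nonneg q) hq).mul_right C
    refine hu.hasProdUniformlyOn_nat_one_add hK (.of_forall fun m w hw => ?_)
      (fun m => by fun_prop)
    rw [norm_neg, norm_mul, norm_pow]
    exact mul_le_mul_of_nonneg_left (hC w hw) (by positivity)
  have h2 := h.differentiableOn
    (.of_forall fun _ => by simpa [Finset.prod_fn] using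
      DifferentiableOn.finsetProd (fun _ _ => by fun_prop)) isOpen_univ
  have h3 : qProd q = fun w => ∏' m : ℕ, (1 + -(q ^ m * w)) := by
    funext w
    simp [qProd, sub_eq_add_neg]
  rw [h3]
  exact differentiableOn_univ.1 h2

/-- The nome `e^{-T}`. -/
noncomputable def nome (T : ℝ) : ℂ := Complex.exp (-(T : ℂ))

theorem norm_nome_lt_one {T : ℝ} (hT : 0 < T) : ‖nome T‖ < 1 := by
  rw [nome, Complex.norm_exp]
  simpa using hT

/-- The product `e^{-iz/2} ∏_{m ≥ 0} (1 - q^m e^{iz}) (1 - q^{m+1} e^{-iz})` with `q = e^{-T}`,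
which is proportional to the Jacobi theta function with simple zeros at `2πℤ + iTℤ`. -/
noncomputable def oddTheta (T : ℝ) (z : ℂ) : ℂ :=
  Complex.exp (-(Complex.I * z) / 2) * qProd (nome T) (Complex.exp (Complex.I * z)) *
    qProd (nome T) (nome T * Complex.exp (-(Complex.I * z)))

theorem differentiable_oddTheta {T : ℝ} (hT : 0 < T) : Differentiable ℂ (oddTheta T) := by
  have h := differentiable_qProd (norm_nome_lt_one hT)
  have h1 : Differentiable ℂ fun z => qProd (nome T) (Complex.exp (Complex.I * z)) :=
    h.comp (by fun_prop)
  have h2 : Differentiable ℂ fun z => qProd (nome T) (nome T * Complex.exp (-(Complex.I * z))) :=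
    h.comp (by fun_prop)
  unfold oddTheta
  fun_prop

theorem oddTheta_add_two_pi (T : ℝ) (z : ℂ) : oddTheta T (z + 2 * Real.pi) = -oddTheta T z := by
  have h1 : Complex.exp (Complex.I * (z + 2 * Real.pi)) = Complex.exp (Complex.I * z) := by
    rw [← Complex.exp_periodic (Complex.I * z)]
    ring_nf
  have h2 : Complex.exp (-(Complex.I * (z + 2 * Real.pi))) = Complex.exp (-(Complex.I * z)) := by
    rw [Complex.exp_neg, h1, Complex.exp_neg]
  have h3 : Complex.exp (-(Complex.I * (z + 2 * Real.pi)) / 2) =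
      -Complex.exp (-(Complex.I * z) / 2) := by
    have : -(Complex.I * (z + 2 * Real.pi)) / 2 = -(Complex.I * z) / 2 - Real.pi * Complex.I := by
      ring
    rw [this, Complex.exp_sub, Complex.exp_pi_mul_I]
    ring
  rw [oddTheta, h1, h2, h3, oddTheta]
  ring

theorem oddTheta_add_mul_I {T : ℝ} (hT : 0 < T) (z : ℂ) :
    oddTheta T (z + T * Complex.I) =
      -(Complex.exp (T / 2) * Complex.exp (-(Complex.I * z))) * oddTheta T z := by
  set w := Complex.exp (Complex.I * z) with hw
  have hw0 : w ≠ 0 := Complex.exp_ne_zero _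
  have hq0 : nome T ≠ 0 := Complex.exp_ne_zero _
  have hI : Complex.I * (z + T * Complex.I) = Complex.I * z + -T := by
    linear_combination (T : ℂ) * Complex.I_mul_I
  have h1 : Complex.exp (Complex.I * (z + T * Complex.I)) = nome T * w := by
    rw [hI, Complex.exp_add, nome, hw, mul_comm]
  have h2 : nome T * Complex.exp (-(Complex.I * (z + T * Complex.I))) = w⁻¹ := by
    rw [Complex.exp_neg, h1]
    field_simp
  have h3 : Complex.exp (-(Complex.I * (z + T * Complex.I)) / 2) =
      Complex.exp (T / 2) * Complex.exp (-(Complex.I * z) / 2) := by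
    rw [hI, ← Complex.exp_add]
    ring_nf
  have h4 : Complex.exp (-(Complex.I * z)) = w⁻¹ := by rw [Complex.exp_neg]
  have h5 : qProd (nome T) (nome T * w) * qProd (nome T) w⁻¹ =
      -w⁻¹ * (qProd (nome T) w * qProd (nome T) (nome T * w⁻¹)) := by
    rw [qProd_eq_mul (norm_nome_lt_one hT) w, qProd_eq_mul (norm_nome_lt_one hT) w⁻¹]
    field_simp
    ring
  rw [oddTheta, h1, h2, h3, oddTheta, h4, ← hw]
  linear_combination Complex.exp (T / 2) * Complex.exp (-(Complex.I * z) / 2) * h5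

theorem exists_eq_lattice_of_oddTheta_eq_zero {T : ℝ} (hT : 0 < T) {z : ℂ}
    (hz : oddTheta T z = 0) : ∃ m l : ℤ, z = 2 * Real.pi * m + l * (T * Complex.I) := by
  have key : ∀ l : ℤ, Complex.exp (Complex.I * z) = nome T ^ l →
      ∃ m l : ℤ, z = 2 * Real.pi * m + l * (T * Complex.I) := by
    intro l hl
    have h1 : Complex.exp (Complex.I * z + l * T) = 1 := by
      rw [Complex.exp_add, hl, nome, ← Complex.exp_int_mul, ← Complex.exp_add]
      simp
    obtain ⟨m, hm⟩ := Complex.exp_eq_one_iff.1 h1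
    refine ⟨m, l, ?_⟩
    linear_combination (-Complex.I) * hm + (z - 2 * Real.pi * m) * Complex.I_mul_I
  have hq0 : nome T ≠ 0 := Complex.exp_ne_zero _
  by_contra hne
  have hno : ∀ l : ℤ, Complex.exp (Complex.I * z) ≠ nome T ^ l := fun l hl => hne (key l hl)
  refine mul_ne_zero (mul_ne_zero (Complex.exp_ne_zero _) ?_) ?_ hz
  · refine qProd_ne_zero (norm_nome_lt_one hT) fun m hm => hno (-m) ?_
    rw [zpow_neg, zpow_natCast]
    exact eq_inv_of_mul_eq_one_right hm
  · refine qProd_ne_zero (norm_nome_lt_one hT) fun m hm => hno (m + 1) ?_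
    rw [← mul_assoc, Complex.exp_neg, ← pow_succ, mul_inv_eq_one₀ (Complex.exp_ne_zero _)] at hm
    rw [← hm]
    norm_cast

theorem qProd_nome_ne_zero {T : ℝ} (hT : 0 < T) : qProd (nome T) (nome T) ≠ 0 := by
  refine qProd_ne_zero (norm_nome_lt_one hT) fun m hm => ?_
  have h := congrArg norm hm
  rw [← pow_succ, norm_pow, norm_one] at h
  exact absurd h (pow_lt_one₀ (norm_nonneg _) (norm_nome_lt_one hT) (Nat.succ_ne_zero m)).ne

theorem deriv_oddTheta_zero_ne_zero {T : ℝ} (hT : 0 < T) : deriv (oddTheta T) 0 ≠ 0 := by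
  have hq := norm_nome_lt_one hT
  let R : ℂ → ℂ := fun z => Complex.exp (-(Complex.I * z) / 2) *
    qProd (nome T) (nome T * Complex.exp (Complex.I * z)) *
    qProd (nome T) (nome T * Complex.exp (-(Complex.I * z)))
  have hR : Differentiable ℂ R := by
    have h1 : Differentiable ℂ fun z => qProd (nome T) (nome T * Complex.exp (Complex.I * z)) :=
      (differentiable_qProd hq).comp (by fun_prop)
    have h2 : Differentiable ℂ fun z =>
        qProd (nome T) (nome T * Complex.exp (-(Complex.I * z))) :=
      (differentiable_qProd hq).comp (by fun_prop)
    fun_prop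
  have hfac : oddTheta T = fun z => (1 - Complex.exp (Complex.I * z)) * R z := by
    funext z
    rw [oddTheta, qProd_eq_mul hq (Complex.exp (Complex.I * z))]
    ring
  have hE : HasDerivAt (fun z => 1 - Complex.exp (Complex.I * z)) (-Complex.I) 0 := by
    have := (((hasDerivAt_id (0 : ℂ)).const_mul Complex.I).cexp).const_sub 1
    simpa using this
  have hd := hE.mul (hR 0).hasDerivAt
  have hd' : HasDerivAt (oddTheta T) (-Complex.I * R 0) 0 := by
    rw [hfac]
    simpa [Pi.mul_def] using hd
  rw [hd'.deriv]
  refine mul_ne_zero (neg_ne_zero.2 Complex.I_ne_zero) ?_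
  have h0 := qProd_nome_ne_zero hT
  simp [R, h0]

theorem deriv_ne_zero_of_quasiPeriod {f u : ℂ → ℂ} (hf : Differentiable ℂ f)
    (hu : Differentiable ℂ u) (hu0 : ∀ z, u z ≠ 0) {ω : ℂ} (h : ∀ z, f (z + ω) = u z * f z)
    (z : ℂ) :
    (f (z + ω) = 0 ∧ deriv f (z + ω) ≠ 0) ↔ (f z = 0 ∧ deriv f z ≠ 0) := by
  have h0 : f (z + ω) = 0 ↔ f z = 0 := by
    rw [h]; simp [hu0]
  rw [h0]
  refine and_congr_right fun hz => ?_
  have h1 : deriv f (z + ω) = u z * deriv f z := by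
    rw [← deriv_comp_add_const f ω z]
    have : (fun z => f (z + ω)) = fun z => u z * f z := funext h
    rw [this]
    have := ((hu z).hasDerivAt.mul (hf z).hasDerivAt).deriv
    simpa [hz, Pi.mul_def] using this
  rw [h1]
  simp [hu0]

theorem forall_int_mul_of_iff {p : ℂ → Prop} {ω : ℂ} (h : ∀ z, p (z + ω) ↔ p z) {z : ℂ}
    (hz : p z) (m : ℤ) : p (z + m * ω) := by
  induction m using Int.induction_on with
  | zero => simpa using hz
  | succ k ih =>
    have := (h (z + (k : ℤ) * ω)).2 ih
    convert this using 1
    push_cast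
    ring
  | pred k ih =>
    refine (h _).1 ?_
    convert ih using 1
    push_cast
    ring

/-- The zeros of the odd theta function are simple. -/
theorem deriv_oddTheta_ne_zero {T : ℝ} (hT : 0 < T) {z : ℂ} (hz : oddTheta T z = 0) :
    deriv (oddTheta T) z ≠ 0 := by
  obtain ⟨m, l, rfl⟩ := exists_eq_lattice_of_oddTheta_eq_zero hT hz
  have hd := differentiable_oddTheta hT
  have s1 := deriv_ne_zero_of_quasiPeriod hd (u := fun _ => -1) (by fun_prop) (by simp)
    (ω := 2 * Real.pi) (fun z => by rw [oddTheta_add_two_pi]; ring)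
  have s2 := deriv_ne_zero_of_quasiPeriod hd
    (u := fun z => -(Complex.exp (T / 2) * Complex.exp (-(Complex.I * z)))) (by fun_prop)
    (fun z => neg_ne_zero.2 (mul_ne_zero (Complex.exp_ne_zero _) (Complex.exp_ne_zero _)))
    (ω := T * Complex.I) (oddTheta_add_mul_I hT)
  have h0 : oddTheta T 0 = 0 ∧ deriv (oddTheta T) 0 ≠ 0 := by
    refine ⟨?_, deriv_oddTheta_zero_ne_zero hT⟩
    rw [oddTheta, qProd_eq_mul (norm_nome_lt_one hT) (Complex.exp _)]
    simp
  have h1 := forall_int_mul_of_iff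
    (p := fun z => oddTheta T z = 0 ∧ deriv (oddTheta T) z ≠ 0) s1 h0 m
  have h2 := forall_int_mul_of_iff
    (p := fun z => oddTheta T z = 0 ∧ deriv (oddTheta T) z ≠ 0) s2 h1 l
  convert h2.2 using 2
  ring

/-! ### Counting the real zeros of quasi-periodic entire functions -/

/-- An entire function that vanishes at the zeros of `G`, all simple, is a multiple of `G`. -/
theorem exists_differentiable_mul_eq {F G : ℂ → ℂ} (hF : Differentiable ℂ F)
    (hG : Differentiable ℂ G) (hzero : ∀ p, G p = 0 → F p = 0 ∧ deriv G p ≠ 0) :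
    ∃ H : ℂ → ℂ, Differentiable ℂ H ∧ ∀ z, F z = G z * H z := by
  classical
  let H : ℂ → ℂ := fun z => if G z = 0 then deriv F z / deriv G z else F z / G z
  refine ⟨H, fun p => ?_, fun z => ?_⟩
  · by_cases hp : G p = 0
    · obtain ⟨hFp, hG'⟩ := hzero p hp
      have dF : Differentiable ℂ (dslope F p) :=
        differentiableOn_univ.1 ((Complex.differentiableOn_dslope Filter.univ_mem).2
          hF.differentiableOn)
      have dG : Differentiable ℂ (dslope G p) :=
        differentiableOn_univ.1 ((Complex.differentiableOn_dslope Filter.univ_mem).2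
          hG.differentiableOn)
      have hne : dslope G p p ≠ 0 := by rwa [dslope_same]
      have hev : ∀ᶠ z in nhds p, dslope G p z ≠ 0 := (dG p).continuousAt.eventually_ne hne
      have heq : H =ᶠ[nhds p] fun z => dslope F p z / dslope G p z := by
        filter_upwards [hev] with z hz
        by_cases hzp : z = p
        · subst hzp
          simp [H, hp, dslope_same]
        · have eF : F z = (z - p) * dslope F p z := by
            have := sub_smul_dslope F p z
            rw [hFp, sub_zero] at this
            simpa using this.symm
          have eG : G z = (z - p) * dslope G p z := by
            have := sub_smul_dslope G p z
            rw [hp, sub_zero] at this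
            simpa using this.symm
          have hsub : z - p ≠ 0 := sub_ne_zero.2 hzp
          have hGz : G z ≠ 0 := by rw [eG]; exact mul_ne_zero hsub hz
          simp only [H, if_neg hGz]
          rw [eF, eG, mul_div_mul_left _ _ hsub]
      exact ((dF p).div (dG p) hne).congr_of_eventuallyEq heq
    · have hev : ∀ᶠ z in nhds p, G z ≠ 0 := (hG p).continuousAt.eventually_ne hp
      refine ((hF p).div (hG p) hp).congr_of_eventuallyEq ?_
      filter_upwards [hev] with z hz
      simp [H, hz]
  · by_cases hz : G z = 0
    · rw [hz, (hzero z hz).1, zero_mul]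
    · simp only [H, if_neg hz]
      field_simp

/-- An entire function whose modulus is doubly periodic is constant. -/
theorem eq_const_of_norm_periodic {H : ℂ → ℂ} (hH : Differentiable ℂ H) {T : ℝ} (hT : 0 < T)
    (h1 : ∀ z, ‖H (z + 2 * Real.pi)‖ = ‖H z‖) (h2 : ∀ z, ‖H (z + T * Complex.I)‖ = ‖H z‖) (z : ℂ) :
    H z = H 0 := by
  refine hH.apply_eq_apply_of_bounded ?_ z 0
  have hK : IsCompact (Set.Icc 0 (2 * Real.pi) ×ℂ Set.Icc 0 T) :=
    isCompact_Icc.reProdIm isCompact_Icc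
  obtain ⟨C, hC⟩ := hK.exists_bound_of_continuousOn hH.continuous.continuousOn
  refine isBounded_iff_forall_norm_le.2 ⟨C, ?_⟩
  rintro _ ⟨z, rfl⟩
  let m : ℤ := toIcoDiv Real.two_pi_pos 0 z.re
  let l : ℤ := toIcoDiv hT 0 z.im
  let w : ℂ := ⟨toIcoMod Real.two_pi_pos 0 z.re, toIcoMod hT 0 z.im⟩
  have hw : z = w + m * (2 * Real.pi) + l * (T * Complex.I) := by
    apply Complex.ext
    · simp [w, m]
    · simp [w, l]
  have hwK : w ∈ Set.Icc 0 (2 * Real.pi) ×ℂ Set.Icc 0 T := by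
    rw [Complex.mem_reProdIm]
    have a := toIcoMod_mem_Ico Real.two_pi_pos 0 z.re
    have b := toIcoMod_mem_Ico hT 0 z.im
    rw [zero_add] at a b
    exact ⟨Set.Ico_subset_Icc_self a, Set.Ico_subset_Icc_self b⟩
  have e1 : ‖H (w + m * (2 * Real.pi))‖ ≤ C :=
    forall_int_mul_of_iff (p := fun z => ‖H z‖ ≤ C) (fun z => by rw [h1]) (hC w hwK) m
  rw [hw]
  exact forall_int_mul_of_iff (p := fun z => ‖H z‖ ≤ C) (fun z => by rw [h2]) e1 l

/-- A nonzero entire function of degree `n` for the lattice `2πℤ + iTℤ` with `n` distinct zeros on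
the real line modulo `2π` is a constant multiple of a product of `n` odd theta functions. So its
multipliers are determined by the zeros, and there are no further real zeros. -/
theorem constraints_of_real_zeros {T : ℝ} (hT : 0 < T) {F : ℂ → ℂ} (hF : Differentiable ℂ F)
    {ι : Type*} [Fintype ι] {σ ε : ℂ} (hσ : ‖σ‖ = 1) (hε : ‖ε‖ = 1)
    (h1 : ∀ z, F (z + 2 * Real.pi) = σ * F z)
    (h2 : ∀ z, F (z + T * Complex.I) = ε * Complex.exp (Fintype.card ι * T / 2) *
      Complex.exp (-(Complex.I * Fintype.card ι * z)) * F z)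
    (a : ι → ℝ) (ha : Function.Injective a) (had : ∀ i j, |a i - a j| < 2 * Real.pi)
    (hzero : ∀ i, F (a i) = 0) (hne : ∃ z, F z ≠ 0) :
    σ = (-1) ^ Fintype.card ι ∧
    ε = (-1) ^ Fintype.card ι * Complex.exp (Complex.I * ∑ i, (a i : ℂ)) ∧
    ∀ b : ℝ, (∀ i, b ≠ a i) → (∀ i, |b - a i| < 2 * Real.pi) → F b ≠ 0 := by
  classical
  set n := Fintype.card ι with hn
  set s : ℂ := Complex.exp (Complex.I * ∑ i, (a i : ℂ)) with hs
  let G : ℂ → ℂ := fun z => ∏ i, oddTheta T (z - a i)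
  have hd := differentiable_oddTheta hT
  have hdi : ∀ i, Differentiable ℂ fun z => oddTheta T (z - a i) := fun i =>
    hd.comp (by fun_prop)
  have hG : Differentiable ℂ G := by
    have : G = fun z => ∏ i, (fun i z => oddTheta T (z - a i)) i z := rfl
    rw [this]
    exact Differentiable.fun_finsetProd fun i _ => hdi i
  have g1 : ∀ z, G (z + 2 * Real.pi) = (-1) ^ n * G z := by
    intro z
    have : ∀ i, oddTheta T (z + 2 * Real.pi - a i) = -1 * oddTheta T (z - a i) := by
      intro i
      rw [show z + 2 * Real.pi - a i = z - a i + 2 * Real.pi by ring, oddTheta_add_two_pi]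
      ring
    simp only [G, this, Finset.prod_mul_distrib, Finset.prod_const, Finset.card_univ, ← hn]
  have g2 : ∀ z, G (z + T * Complex.I) = ((-1) ^ n * s) * Complex.exp (n * T / 2) *
      Complex.exp (-(Complex.I * n * z)) * G z := by
    intro z
    have : ∀ i, oddTheta T (z + T * Complex.I - a i) =
        (-1 * (Complex.exp (T / 2) * Complex.exp (-(Complex.I * z)) *
          Complex.exp (Complex.I * a i))) * oddTheta T (z - a i) := by
      intro i
      rw [show z + T * Complex.I - a i = z - a i + T * Complex.I by ring, oddTheta_add_mul_I hT,
        show -(Complex.I * (z - a i)) = -(Complex.I * z) + Complex.I * a i by ring,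
        Complex.exp_add]
      ring
    simp only [G, this, Finset.prod_mul_distrib, Finset.prod_const, Finset.card_univ, ← hn,
      ← Complex.exp_sum, ← Finset.mul_sum, ← hs, ← Complex.exp_nat_mul]
    rw [show (n : ℂ) * (T / 2) = n * T / 2 by ring,
      show (n : ℂ) * (-(Complex.I * z)) = -(Complex.I * n * z) by ring]
    ring
  have hlat : ∀ {b : ℝ} {i : ι} {m l : ℤ}, |b - a i| < 2 * Real.pi →
      (b : ℂ) - a i = 2 * Real.pi * m + l * (T * Complex.I) → b = a i := by
    intro b i m l hlt h
    have hre := congrArg Complex.re h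
    simp at hre
    rw [hre, abs_mul, abs_of_pos Real.two_pi_pos] at hlt
    have hm : |(m : ℝ)| < 1 := by
      by_contra hge
      exact absurd hlt (not_lt.2 (le_mul_of_one_le_right Real.two_pi_pos.le (not_lt.1 hge)))
    have hm0 : m = 0 := by
      rw [← Int.abs_lt_one_iff]
      exact_mod_cast hm
    rw [hm0] at hre
    simpa [sub_eq_zero] using hre
  have hGz : ∀ p, G p = 0 → F p = 0 ∧ deriv G p ≠ 0 := by
    intro p hp
    obtain ⟨i, _, hi⟩ := Finset.prod_eq_zero_iff.1 hp
    obtain ⟨m, l, hml⟩ := exists_eq_lattice_of_oddTheta_eq_zero hT hi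
    have hσ0 : σ ≠ 0 := by rw [← norm_ne_zero_iff, hσ]; exact one_ne_zero
    have hε0 : ε ≠ 0 := by rw [← norm_ne_zero_iff, hε]; exact one_ne_zero
    constructor
    · have e1 : F (a i + m * (2 * Real.pi)) = 0 :=
        forall_int_mul_of_iff (p := fun z => F z = 0) (fun z => by rw [h1]; simp [hσ0]) (hzero i) m
      have e2 : F (a i + m * (2 * Real.pi) + l * (T * Complex.I)) = 0 :=
        forall_int_mul_of_iff (p := fun z => F z = 0)
          (fun z => by rw [h2]; simp [hε0, Complex.exp_ne_zero]) e1 l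
      rw [← e2]
      congr 1
      linear_combination hml
    · have hsplit : G = fun z => oddTheta T (z - a i) *
          ∏ j ∈ Finset.univ.erase i, oddTheta T (z - a j) := by
        funext z
        exact (Finset.mul_prod_erase _ _ (Finset.mem_univ i)).symm
      have hrest : ∏ j ∈ Finset.univ.erase i, oddTheta T (p - a j) ≠ 0 := by
        refine Finset.prod_ne_zero_iff.2 fun j hj hj0 => ?_
        obtain ⟨m', l', hml'⟩ := exists_eq_lattice_of_oddTheta_eq_zero hT hj0
        refine (Finset.mem_erase.1 hj).1 (ha (hlat (m := m - m') (l := l - l') (had j i) ?_))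
        push_cast
        linear_combination hml - hml'
      have hdrest : Differentiable ℂ fun z =>
          ∏ j ∈ Finset.univ.erase i, (fun j z => oddTheta T (z - a j)) j z :=
        Differentiable.fun_finsetProd fun j _ => hdi j
      have hder := ((hdi i p).hasDerivAt.mul (hdrest p).hasDerivAt).deriv
      have hder' : deriv G p = deriv (fun z => oddTheta T (z - a i)) p *
          ∏ j ∈ Finset.univ.erase i, oddTheta T (p - a j) := by
        rw [hsplit]
        simpa [Pi.mul_def, hi] using hder
      rw [hder', deriv_comp_sub_const]
      exact mul_ne_zero (deriv_oddTheta_ne_zero hT hi) hrest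
  obtain ⟨H, hH, hFG⟩ := exists_differentiable_mul_eq hF hG hGz
  obtain ⟨z₀, hz₀⟩ := hne
  have hG0 : G z₀ ≠ 0 := fun h => hz₀ (by rw [hFG, h, zero_mul])
  have hs0 : s ≠ 0 := Complex.exp_ne_zero _
  have hsn : ‖s‖ = 1 := by
    rw [hs, ← Complex.ofReal_sum, mul_comm, Complex.norm_exp_ofReal_mul_I]
  -- Two entire functions that agree where `G` does not vanish are equal.
  have hext : ∀ H₁ H₂ : ℂ → ℂ, Differentiable ℂ H₁ → Differentiable ℂ H₂ →
      (∀ z, G z ≠ 0 → H₁ z = H₂ z) → ∀ z, H₁ z = H₂ z := by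
    intro H₁ H₂ d1 d2 h z
    have hev : H₁ =ᶠ[nhds z₀] H₂ := by
      filter_upwards [(hG z₀).continuousAt.eventually_ne hG0] with w hw using h w hw
    exact congrFun (AnalyticOnNhd.eq_of_eventuallyEq
      (fun w _ => d1.analyticAt w) (fun w _ => d2.analyticAt w) hev) z
  have k1 : ∀ z, H (z + 2 * Real.pi) = (σ * (-1) ^ n) * H z := by
    refine hext (fun z => H (z + 2 * Real.pi)) (fun z => (σ * (-1) ^ n) * H z)
      (hH.comp (by fun_prop)) (by fun_prop) fun z hz => ?_
    have e := h1 z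
    rw [hFG, hFG, g1] at e
    have hone : ((-1 : ℂ) ^ n) * (-1) ^ n = 1 := by
      rw [← mul_pow]; simp
    refine mul_left_cancel₀ hz ?_
    linear_combination (-1 : ℂ) ^ n * e - G z * H (z + 2 * Real.pi) * hone
  have k2 : ∀ z, H (z + T * Complex.I) = (ε * (-1) ^ n * s⁻¹) * H z := by
    refine hext (fun z => H (z + T * Complex.I)) (fun z => (ε * (-1) ^ n * s⁻¹) * H z)
      (hH.comp (by fun_prop)) (by fun_prop) fun z hz => ?_
    have e := h2 z
    rw [hFG, hFG, g2] at e
    have hone : ((-1 : ℂ) ^ n) * (-1) ^ n = 1 := by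
      rw [← mul_pow]; simp
    have hX : Complex.exp (n * T / 2) * Complex.exp (-(Complex.I * n * z)) ≠ 0 :=
      mul_ne_zero (Complex.exp_ne_zero _) (Complex.exp_ne_zero _)
    have hsi : s * s⁻¹ = 1 := mul_inv_cancel₀ hs0
    refine mul_left_cancel₀ (mul_ne_zero hX hz) ?_
    generalize Complex.exp (n * T / 2) = X at *
    generalize Complex.exp (-(Complex.I * n * z)) = Y at *
    linear_combination (-1 : ℂ) ^ n * s⁻¹ * e -
      X * Y * G z * H (z + T * Complex.I) * (s * s⁻¹ * hone + hsi)
  have n1 : ‖σ * (-1) ^ n‖ = 1 := by simp [hσ]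
  have n2 : ‖ε * (-1) ^ n * s⁻¹‖ = 1 := by simp [hε, hsn]
  have hconst := eq_const_of_norm_periodic hH hT
    (fun z => by rw [k1, norm_mul, n1, one_mul]) (fun z => by rw [k2, norm_mul, n2, one_mul])
  have hc : H 0 ≠ 0 := by
    intro h
    exact hz₀ (by rw [hFG, hconst, h, mul_zero])
  have c1 : σ * (-1) ^ n = 1 := by
    have := k1 0
    rw [hconst] at this
    exact (mul_eq_right₀ hc).1 this.symm
  have c2 : ε * (-1) ^ n * s⁻¹ = 1 := by
    have := k2 0
    rw [hconst] at this
    exact (mul_eq_right₀ hc).1 this.symm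
  have hone : ((-1 : ℂ) ^ n) * (-1) ^ n = 1 := by
    rw [← mul_pow]; simp
  refine ⟨?_, ?_, ?_⟩
  · linear_combination (-1 : ℂ) ^ n * c1 - σ * hone
  · have hsi : s * s⁻¹ = 1 := mul_inv_cancel₀ hs0
    linear_combination (-1 : ℂ) ^ n * s * c2 - ε * s * s⁻¹ * hone - ε * hsi
  · intro b hb hbd
    rw [hFG, hconst]
    refine mul_ne_zero (Finset.prod_ne_zero_iff.2 fun i _ h0 => ?_) hc
    obtain ⟨m, l, hml⟩ := exists_eq_lattice_of_oddTheta_eq_zero hT h0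
    exact hb i (hlat (hbd i) hml)

/-! ### Theta series with Gaussian coefficients -/

/-- The frequencies `c (n - 1/2) + J`, `n ∈ ℤ`. -/
noncomputable def freq (c J : ℝ) (n : ℤ) : ℝ := c * ((n : ℝ) - 1 / 2) + J

/-- The series `∑_n (-1)^{bn} e^{-s k_n²/2} e^{i k_n z}` over the frequencies
`k_n = c (n - 1/2) + J`. It is a `b`-twisted periodization of the heat kernel in Fourier space, and it
solves the heat equation in the time variable `s`. -/
noncomputable def wave (b : ℕ) (c J s : ℝ) (z : ℂ) : ℂ :=
  ∑' n : ℤ, ((-1 : ℂ) ^ b) ^ n * Complex.exp (-(s * freq c J n ^ 2) / 2) *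
    Complex.exp (Complex.I * freq c J n * z)

/-- The sum `∑_n e^{-s k_n²/2}` over the frequencies `k_n = c (n - 1/2) + J`. -/
noncomputable def waveNorm (c J s : ℝ) : ℝ := ∑' n : ℤ, Real.exp (-(s * freq c J n ^ 2) / 2)

theorem neg_one_pow_zpow_eq_exp (b : ℕ) (n : ℤ) :
    ((-1 : ℂ) ^ b) ^ n = Complex.exp (Real.pi * Complex.I * b * n) := by
  rw [← Complex.exp_pi_mul_I, ← Complex.exp_nat_mul, ← Complex.exp_int_mul]
  ring_nf

theorem wave_term_eq (b : ℕ) (c J s : ℝ) (z : ℂ) (n : ℤ) :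
    ((-1 : ℂ) ^ b) ^ n * Complex.exp (-(s * freq c J n ^ 2) / 2) *
      Complex.exp (Complex.I * freq c J n * z) =
    Complex.exp (-(s * ((J : ℂ) - c / 2) ^ 2) / 2 + Complex.I * (J - c / 2) * z) *
      jacobiTheta₂_term n ((c * z + Complex.I * s * c * (J - c / 2)) / (2 * Real.pi) + b / 2)
        (Complex.I * s * c ^ 2 / (2 * Real.pi)) := by
  have hpi : (Real.pi : ℂ) ≠ 0 := by exact_mod_cast Real.pi_ne_zero
  rw [neg_one_pow_zpow_eq_exp, jacobiTheta₂_term, ← Complex.exp_add, ← Complex.exp_add,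
    ← Complex.exp_add, freq]
  congr 1
  push_cast
  field_simp
  ring_nf
  rw [Complex.I_sq]
  ring

theorem wave_eq_jacobiTheta₂ (b : ℕ) (c J s : ℝ) (z : ℂ) :
    wave b c J s z =
      Complex.exp (-(s * ((J : ℂ) - c / 2) ^ 2) / 2 + Complex.I * (J - c / 2) * z) *
      jacobiTheta₂ ((c * z + Complex.I * s * c * (J - c / 2)) / (2 * Real.pi) + b / 2)
        (Complex.I * s * c ^ 2 / (2 * Real.pi)) := by
  rw [wave, jacobiTheta₂, ← tsum_mul_left]
  exact tsum_congr fun n => wave_term_eq b c J s z n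

theorem im_modulus_pos {c s : ℝ} (hc : c ≠ 0) (hs : 0 < s) :
    0 < (Complex.I * s * c ^ 2 / (2 * Real.pi) : ℂ).im := by
  have h : (Complex.I * s * c ^ 2 / (2 * Real.pi) : ℂ) =
      ((s * c ^ 2 / (2 * Real.pi) : ℝ) : ℂ) * Complex.I := by
    push_cast
    ring
  rw [h, Complex.im_ofReal_mul]
  simp only [Complex.I_im, mul_one]
  have := Real.pi_pos
  positivity

theorem summable_wave {c s : ℝ} (hc : c ≠ 0) (hs : 0 < s) (b : ℕ) (J : ℝ) (z : ℂ) :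
    Summable fun n : ℤ => ((-1 : ℂ) ^ b) ^ n * Complex.exp (-(s * freq c J n ^ 2) / 2) *
      Complex.exp (Complex.I * freq c J n * z) := by
  simp_rw [wave_term_eq]
  exact ((summable_jacobiTheta₂_term_iff _ _).2 (im_modulus_pos hc hs)).mul_left _

theorem summable_gaussian {c s : ℝ} (hc : c ≠ 0) (hs : 0 < s) (J : ℝ) :
    Summable fun n : ℤ => Real.exp (-(s * freq c J n ^ 2) / 2) := by
  have h := (summable_wave hc hs 0 J 0).norm
  refine h.congr fun n => ?_
  simp only [pow_zero, one_zpow, one_mul, mul_zero, Complex.exp_zero, mul_one]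
  rw [← Complex.norm_of_nonneg (Real.exp_pos _).le]
  push_cast
  rfl

theorem waveNorm_pos {c s : ℝ} (hc : c ≠ 0) (hs : 0 < s) (J : ℝ) : 0 < waveNorm c J s :=
  (summable_gaussian hc hs J).tsum_pos (fun _ => (Real.exp_pos _).le) 0 (Real.exp_pos _)

theorem differentiable_wave {c s : ℝ} (hc : c ≠ 0) (hs : 0 < s) (b : ℕ) (J : ℝ) :
    Differentiable ℂ (wave b c J s) := by
  have h : wave b c J s = fun z => Complex.exp (-(s * ((J : ℂ) - c / 2) ^ 2) / 2 +
      Complex.I * (J - c / 2) * z) *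
      jacobiTheta₂ ((c * z + Complex.I * s * c * (J - c / 2)) / (2 * Real.pi) + b / 2)
        (Complex.I * s * c ^ 2 / (2 * Real.pi)) := funext fun z => wave_eq_jacobiTheta₂ b c J s z
  rw [h]
  refine Differentiable.mul (by fun_prop) fun z => ?_
  have h1 := differentiableAt_jacobiTheta₂_fst
    ((c * z + Complex.I * s * c * (J - c / 2)) / (2 * Real.pi) + b / 2) (im_modulus_pos hc hs)
  exact h1.comp
    (f := fun z : ℂ => (c * z + Complex.I * s * c * (J - c / 2)) / (2 * Real.pi) + b / 2)
    z (by fun_prop)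

theorem continuousOn_wave_time {c : ℝ} (hc : c ≠ 0) (b : ℕ) (J : ℝ) (z : ℂ) :
    ContinuousOn (fun s : ℝ => wave b c J s z) (Set.Ioi 0) := by
  intro s hs
  refine ContinuousAt.continuousWithinAt ?_
  simp_rw [wave_eq_jacobiTheta₂]
  refine ContinuousAt.mul (by fun_prop) ?_
  have h1 := continuousAt_jacobiTheta₂
    ((c * z + Complex.I * s * c * (J - c / 2)) / (2 * Real.pi) + b / 2) (im_modulus_pos hc hs)
  exact ContinuousAt.comp (f := fun s : ℝ =>
    (((c * z + Complex.I * s * c * (J - c / 2)) / (2 * Real.pi) + b / 2 : ℂ),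
      (Complex.I * s * c ^ 2 / (2 * Real.pi) : ℂ))) h1 (by fun_prop)

theorem wave_add_mul_I (b : ℕ) (c J s : ℝ) (z : ℂ) :
    wave b c J s (z + (c * s : ℝ) * Complex.I) = (-1) ^ b * Complex.exp (c * (c * s : ℝ) / 2) *
      Complex.exp (-(Complex.I * c * z)) * wave b c J s z := by
  have hb : ((-1 : ℂ) ^ b) * (-1) ^ b = 1 := by rw [← mul_pow]; simp
  have hb0 : ((-1 : ℂ) ^ b) ≠ 0 := by simp
  -- The shift of `z` by the imaginary period is the index shift `n ↦ n + 1`.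
  rw [wave, wave, ← (Equiv.addRight (1 : ℤ)).tsum_eq (fun n : ℤ => ((-1 : ℂ) ^ b) ^ n *
    Complex.exp (-(s * freq c J n ^ 2) / 2) * Complex.exp (Complex.I * freq c J n * z)),
    ← tsum_mul_left]
  refine tsum_congr fun n => ?_
  rw [Equiv.coe_addRight, zpow_add_one₀ hb0]
  have h : Complex.exp (-(s * freq c J n ^ 2) / 2) *
      Complex.exp (Complex.I * freq c J n * (z + (c * s : ℝ) * Complex.I)) =
      Complex.exp (c * (c * s : ℝ) / 2) * Complex.exp (-(Complex.I * c * z)) *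
      (Complex.exp (-(s * freq c J (n + 1) ^ 2) / 2) *
        Complex.exp (Complex.I * freq c J (n + 1) * z)) := by
    simp only [← Complex.exp_add, freq]
    congr 1
    push_cast
    ring_nf
    rw [Complex.I_sq]
    ring
  linear_combination ((-1 : ℂ) ^ b) ^ n * h - ((-1 : ℂ) ^ b) ^ n *
    Complex.exp (c * (c * s : ℝ) / 2) * Complex.exp (-(Complex.I * c * z)) *
      (Complex.exp (-(s * freq c J (n + 1) ^ 2) / 2) *
        Complex.exp (Complex.I * freq c J (n + 1) * z)) * hb

theorem wave_neg_add_mul_I (b : ℕ) (c J s : ℝ) (z : ℂ) :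
    wave b c J s (-(z + (c * s : ℝ) * Complex.I)) =
      (-1) ^ b * Complex.exp (c * (c * s : ℝ) / 2) *
      Complex.exp (-(Complex.I * c * z)) * wave b c J s (-z) := by
  have hb : ((-1 : ℂ) ^ b) * (-1) ^ b = 1 := by rw [← mul_pow]; simp
  have h := wave_add_mul_I b c J s (-(z + (c * s : ℝ) * Complex.I))
  rw [show -(z + (c * s : ℝ) * Complex.I) + (c * s : ℝ) * Complex.I = -z by ring] at h
  have he : Complex.exp (c * (c * s : ℝ) / 2) * Complex.exp (-(Complex.I * c * z)) *
      (Complex.exp (c * (c * s : ℝ) / 2) *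
        Complex.exp (-(Complex.I * c * (-(z + (c * s : ℝ) * Complex.I))))) = 1 := by
    simp only [← Complex.exp_add]
    rw [Complex.exp_eq_one_iff]
    refine ⟨0, ?_⟩
    push_cast
    ring_nf
    rw [Complex.I_sq]
    ring
  rw [h]
  generalize wave b c J s (-(z + (c * s : ℝ) * Complex.I)) = W
  linear_combination -W * he - W * hb * (Complex.exp (c * (c * s : ℝ) / 2) *
    Complex.exp (-(Complex.I * c * z)) * (Complex.exp (c * (c * s : ℝ) / 2) *
        Complex.exp (-(Complex.I * c * (-(z + (c * s : ℝ) * Complex.I))))))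

theorem wave_add_two_pi {σ : ℂ} (b : ℕ) {c J : ℝ} (s : ℝ)
    (hσ : ∀ n, Complex.exp (Complex.I * freq c J n * (2 * Real.pi)) = σ) (z : ℂ) :
    wave b c J s (z + 2 * Real.pi) = σ * wave b c J s z := by
  rw [wave, wave, ← tsum_mul_left]
  refine tsum_congr fun n => ?_
  rw [mul_add, Complex.exp_add, hσ]
  ring

theorem conj_wave (b : ℕ) (c J s x : ℝ) :
    (starRingEnd ℂ) (wave b c J s x) = wave b c J s (-x) := by
  rw [wave, Complex.conj_tsum, wave]
  refine tsum_congr fun n => ?_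
  rw [map_mul, map_mul, ← Complex.exp_conj, ← Complex.exp_conj, map_zpow₀, map_pow]
  simp [map_ofNat]

/-- Reversing the sign of `z` replaces `J` by `c - J`. -/
theorem wave_neg_eq_sub (b : ℕ) (c J s : ℝ) (z : ℂ) :
    wave b c J s (-z) = wave b c (c - J) s z := by
  rw [wave, wave, ← (Equiv.neg ℤ).tsum_eq (fun n : ℤ => ((-1 : ℂ) ^ b) ^ n *
    Complex.exp (-(s * freq c (c - J) n ^ 2) / 2) * Complex.exp (Complex.I * freq c (c - J) n * z))]
  refine tsum_congr fun n => ?_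
  have h : freq c (c - J) (-n) = -freq c J n := by
    simp only [freq]
    push_cast
    ring
  have hb : ((-1 : ℂ) ^ b) ^ (-n) = ((-1 : ℂ) ^ b) ^ n := by
    rw [zpow_neg, ← inv_zpow, ← inv_pow]
    norm_num
  rw [Equiv.neg_apply, h, hb]
  push_cast
  ring_nf

/-- For `J = 0` reversing the sign of `z` is the reflection `n ↦ 1 - n`. -/
theorem wave_neg_of_eq_zero (b : ℕ) (c s : ℝ) (z : ℂ) :
    wave b c 0 s (-z) = (-1) ^ b * wave b c 0 s z := by
  rw [wave, wave, ← (Equiv.subLeft (1 : ℤ)).tsum_eq (fun n : ℤ => ((-1 : ℂ) ^ b) ^ n *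
    Complex.exp (-(s * freq c 0 n ^ 2) / 2) * Complex.exp (Complex.I * freq c 0 n * z)),
    ← tsum_mul_left]
  refine tsum_congr fun n => ?_
  have h : freq c 0 (1 - n) = -freq c 0 n := by
    simp only [freq]
    push_cast
    ring
  have hb0 : ((-1 : ℂ) ^ b) ≠ 0 := by simp
  have hb1 : ((-1 : ℂ) ^ b) * (-1) ^ b = 1 := by rw [← mul_pow]; simp
  have hb : ((-1 : ℂ) ^ b) ^ (1 - n) = (-1) ^ b * ((-1 : ℂ) ^ b) ^ n := by
    rw [sub_eq_add_neg, zpow_add₀ hb0, zpow_one, zpow_neg, ← inv_zpow, ← inv_pow]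
    norm_num
  rw [Equiv.subLeft_apply, h, hb]
  push_cast
  have e1 : -((s : ℂ) * (-(freq c 0 n : ℂ)) ^ 2) / 2 = -(s * (freq c 0 n : ℂ) ^ 2) / 2 := by ring
  have e2 : Complex.I * -(freq c 0 n : ℂ) * z = Complex.I * (freq c 0 n : ℂ) * -z := by ring
  rw [e1, e2]
  linear_combination -(((-1 : ℂ) ^ b) ^ n * Complex.exp (-(s * (freq c 0 n : ℂ) ^ 2) / 2) *
    Complex.exp (Complex.I * (freq c 0 n : ℂ) * -z)) * hb1

/-! ### Orthogonality on the circle -/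

theorem integral_exp_int (l : ℤ) :
    ∫ y in (0 : ℝ)..2 * Real.pi, Complex.exp (Complex.I * l * y) =
      if l = 0 then (2 * Real.pi : ℂ) else 0 := by
  split_ifs with h
  · subst h
    simp
  · have hl : Complex.I * l ≠ 0 := mul_ne_zero Complex.I_ne_zero (by exact_mod_cast h)
    rw [integral_exp_mul_complex hl]
    have : Complex.exp (Complex.I * l * (2 * Real.pi : ℝ)) = 1 := by
      rw [Complex.exp_eq_one_iff]
      exact ⟨l, by push_cast; ring⟩
    rw [this]
    simp

/-- The Fourier coefficients of an absolutely convergent trigonometric series. -/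
theorem integral_trigSeries_mul_exp {a : ℤ → ℂ} (ha : Summable fun n => ‖a n‖) {k : ℤ → ℝ} {l : ℝ}
    (hkl : ∀ n, ∃ m : ℤ, k n - l = m) {f : ℝ → ℂ}
    (hf : ∀ y, f y = ∑' n, a n * Complex.exp (Complex.I * k n * y)) :
    ∫ y in (0 : ℝ)..2 * Real.pi, f y * Complex.exp (Complex.I * l * (-y : ℂ)) =
      2 * Real.pi * ∑' n, if k n = l then a n else 0 := by
  classical
  have hterm : ∀ n (y : ℝ), ‖a n * Complex.exp (Complex.I * k n * y) *
      Complex.exp (Complex.I * l * (-y : ℂ))‖ = ‖a n‖ := by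
    intro n y
    rw [norm_mul, norm_mul,
      show Complex.I * k n * y = ((k n * y : ℝ) : ℂ) * Complex.I by push_cast; ring,
      show Complex.I * l * (-y : ℂ) = ((-(l * y) : ℝ) : ℂ) * Complex.I by push_cast; ring,
      Complex.norm_exp_ofReal_mul_I, Complex.norm_exp_ofReal_mul_I, mul_one, mul_one]
  have h := intervalIntegral.hasSum_integral_of_dominated_convergence
    (F := fun (n : ℤ) (y : ℝ) => a n * Complex.exp (Complex.I * k n * y) *
      Complex.exp (Complex.I * l * (-y : ℂ)))
    (f := fun y => f y * Complex.exp (Complex.I * l * (-y : ℂ)))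
    (a := 0) (b := 2 * Real.pi) (μ := volume) (fun n _ => ‖a n‖)
    (fun n => (by fun_prop : Continuous fun y : ℝ => a n * Complex.exp (Complex.I * k n * y) *
      Complex.exp (Complex.I * l * (-y : ℂ))).aestronglyMeasurable)
    (fun n => .of_forall fun y _ => (hterm n y).le)
    (.of_forall fun y _ => ha) (by simp)
    (.of_forall fun y _ => by
      rw [hf]
      refine HasSum.mul_right _ (Summable.hasSum ?_)
      refine Summable.of_norm (ha.congr fun n => ?_)
      rw [norm_mul, show Complex.I * k n * y = ((k n * y : ℝ) : ℂ) * Complex.I by push_cast; ring,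
        Complex.norm_exp_ofReal_mul_I, mul_one])
  rw [← h.tsum_eq, ← tsum_mul_left]
  refine tsum_congr fun n => ?_
  obtain ⟨m, hm⟩ := hkl n
  have h1 : ∀ y : ℝ, a n * Complex.exp (Complex.I * k n * y) *
      Complex.exp (Complex.I * l * (-y : ℂ)) = a n * Complex.exp (Complex.I * m * y) := by
    intro y
    rw [mul_assoc, ← Complex.exp_add]
    congr 2
    have : (k n : ℂ) - l = m := by exact_mod_cast hm
    linear_combination Complex.I * y * this
  simp_rw [h1]
  rw [intervalIntegral.integral_const_mul, integral_exp_int]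
  have h2 : m = 0 ↔ k n = l := by
    rw [← sub_eq_zero (a := k n), hm]
    exact_mod_cast Iff.rfl
  by_cases hk : k n = l
  · rw [if_pos (h2.2 hk), if_pos hk, mul_comm]
  · rw [if_neg (fun h => hk (h2.1 h)), if_neg hk, mul_zero, mul_zero]

/-- Parseval's formula for two absolutely convergent trigonometric series. -/
theorem integral_trigSeries_mul_trigSeries {a b : ℤ → ℂ} (ha : Summable fun n => ‖a n‖)
    (hb : Summable fun n => ‖b n‖) {k l : ℤ → ℝ} (hkl : ∀ n n', ∃ m : ℤ, k n - l n' = m)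
    {f g : ℝ → ℂ} (hf : ∀ y, f y = ∑' n, a n * Complex.exp (Complex.I * k n * y))
    (hg : ∀ y, g y = ∑' n, b n * Complex.exp (Complex.I * l n * (-y : ℂ))) (hfc : Continuous f) :
    ∫ y in (0 : ℝ)..2 * Real.pi, f y * g y =
      2 * Real.pi * ∑' n', b n' * ∑' n, if k n = l n' then a n else 0 := by
  have hfb : ∀ y, ‖f y‖ ≤ ∑' n, ‖a n‖ := by
    intro y
    rw [hf]
    refine (norm_tsum_le_tsum_norm ?_).trans_eq (tsum_congr fun n => ?_)
    · refine ha.congr fun n => ?_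
      rw [norm_mul, show Complex.I * k n * y = ((k n * y : ℝ) : ℂ) * Complex.I by push_cast; ring,
        Complex.norm_exp_ofReal_mul_I, mul_one]
    · rw [norm_mul, show Complex.I * k n * y = ((k n * y : ℝ) : ℂ) * Complex.I by push_cast; ring,
        Complex.norm_exp_ofReal_mul_I, mul_one]
  have hexp : ∀ n' (y : ℝ), ‖Complex.exp (Complex.I * l n' * (-y : ℂ))‖ = 1 := by
    intro n' y
    rw [show Complex.I * l n' * (-y : ℂ) = ((-(l n' * y) : ℝ) : ℂ) * Complex.I by push_cast; ring,
      Complex.norm_exp_ofReal_mul_I]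
  have h := intervalIntegral.hasSum_integral_of_dominated_convergence
    (F := fun (n' : ℤ) (y : ℝ) => b n' * (f y * Complex.exp (Complex.I * l n' * (-y : ℂ))))
    (f := fun y => f y * g y)
    (a := 0) (b := 2 * Real.pi) (μ := volume) (fun n' _ => ‖b n'‖ * ∑' n, ‖a n‖)
    (fun n' => (by fun_prop : Continuous fun y : ℝ =>
      b n' * (f y * Complex.exp (Complex.I * l n' * (-y : ℂ)))).aestronglyMeasurable)
    (fun n' => .of_forall fun y _ => by
      rw [norm_mul, norm_mul, hexp, mul_one]
      exact mul_le_mul_of_nonneg_left (hfb y) (norm_nonneg _))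
    (.of_forall fun y _ => hb.mul_right _) (by simp)
    (.of_forall fun y _ => by
      rw [hg]
      have hs : Summable fun n => b n * Complex.exp (Complex.I * l n * (-y : ℂ)) := by
        refine Summable.of_norm (hb.congr fun n => ?_)
        rw [norm_mul, hexp, mul_one]
      have := hs.hasSum.mul_left (f y)
      refine this.congr_fun fun n => ?_
      ring)
  rw [← h.tsum_eq, ← tsum_mul_left]
  refine tsum_congr fun n' => ?_
  rw [intervalIntegral.integral_const_mul, integral_trigSeries_mul_exp ha (fun n => hkl n n') hf]
  ring

theorem summable_norm_waveCoeff {c s : ℝ} (hc : c ≠ 0) (hs : 0 < s) (b : ℕ) (J : ℝ) :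
    Summable fun n : ℤ => ‖((-1 : ℂ) ^ b) ^ n * Complex.exp (-(s * freq c J n ^ 2) / 2)‖ := by
  have := (summable_wave hc hs b J 0).norm
  simpa using this

theorem continuous_wave_ofReal {c s : ℝ} (hc : c ≠ 0) (hs : 0 < s) (b : ℕ) (J : ℝ) :
    Continuous fun y : ℝ => wave b c J s y :=
  (differentiable_wave hc hs b J).continuous.comp Complex.continuous_ofReal

theorem continuous_wave_neg_ofReal {c s : ℝ} (hc : c ≠ 0) (hs : 0 < s) (b : ℕ) (J : ℝ) :
    Continuous fun y : ℝ => wave b c J s (-y) :=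
  (differentiable_wave hc hs b J).continuous.comp Complex.continuous_ofReal.neg

theorem integral_wave_mul_wave_neg_self {c s t : ℝ} (hc : c ≠ 0) (hcz : ∃ m : ℤ, c = m)
    (hs : 0 < s) (ht : 0 < t) (b : ℕ) (J : ℝ) :
    ∫ y in (0 : ℝ)..2 * Real.pi, wave b c J t y * wave b c J s (-y) =
      2 * Real.pi * waveNorm c J (s + t) := by
  obtain ⟨cz, hcz⟩ := hcz
  rw [integral_trigSeries_mul_trigSeries (f := fun y : ℝ => wave b c J t y)
    (g := fun y : ℝ => wave b c J s (-y))
    (summable_norm_waveCoeff hc ht b J)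
    (summable_norm_waveCoeff hc hs b J) (k := freq c J) (l := freq c J) _
    (fun y => rfl) (fun y => rfl) (continuous_wave_ofReal hc ht b J)]
  · congr 1
    rw [waveNorm, Complex.ofReal_tsum]
    refine tsum_congr fun n => ?_
    have hinj : ∀ n', freq c J n' = freq c J n ↔ n' = n := by
      intro n'
      simp [freq, hc]
    simp_rw [hinj]
    rw [tsum_ite_eq]
    have hb1 : ((-1 : ℂ) ^ b) * (-1) ^ b = 1 := by rw [← mul_pow]; simp
    have hbn : (((-1 : ℂ) ^ b) ^ n) * ((-1) ^ b) ^ n = 1 := by rw [← mul_zpow, hb1, one_zpow]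
    have he : Complex.exp (-(s * freq c J n ^ 2) / 2) * Complex.exp (-(t * freq c J n ^ 2) / 2) =
        ((Real.exp (-((s + t) * freq c J n ^ 2) / 2) : ℝ) : ℂ) := by
      rw [← Complex.exp_add]
      push_cast
      ring_nf
    rw [← he]
    linear_combination Complex.exp (-(s * freq c J n ^ 2) / 2) *
      Complex.exp (-(t * freq c J n ^ 2) / 2) * hbn
  · intro n n'
    refine ⟨cz * (n - n'), ?_⟩
    rw [freq, freq, hcz]
    push_cast
    ring

theorem integral_wave_mul_wave_neg_of_ne {c s t : ℝ} (hc : c ≠ 0) (hs : 0 < s) (ht : 0 < t)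
    (b : ℕ) {J J' : ℝ} (hint : ∀ n n', ∃ m : ℤ, freq c J n - freq c J' n' = m)
    (hne : ∀ n n', freq c J n ≠ freq c J' n') :
    ∫ y in (0 : ℝ)..2 * Real.pi, wave b c J t y * wave b c J' s (-y) = 0 := by
  rw [integral_trigSeries_mul_trigSeries (f := fun y : ℝ => wave b c J t y)
    (g := fun y : ℝ => wave b c J' s (-y))
    (summable_norm_waveCoeff hc ht b J)
    (summable_norm_waveCoeff hc hs b J') (k := freq c J) (l := freq c J') hint
    (fun y => rfl) (fun y => rfl) (continuous_wave_ofReal hc ht b J)]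
  simp [hne]

theorem integral_wave_mul_wave_of_ne {c s t : ℝ} (hc : c ≠ 0) (hs : 0 < s) (ht : 0 < t)
    (b : ℕ) {J J' : ℝ} (hint : ∀ n n', ∃ m : ℤ, freq c J n + freq c J' n' = m)
    (hne : ∀ n n', freq c J n ≠ -freq c J' n') :
    ∫ y in (0 : ℝ)..2 * Real.pi, wave b c J t y * wave b c J' s y = 0 := by
  rw [integral_trigSeries_mul_trigSeries (f := fun y : ℝ => wave b c J t y)
    (g := fun y : ℝ => wave b c J' s y)
    (summable_norm_waveCoeff hc ht b J)
    (summable_norm_waveCoeff hc hs b J') (k := freq c J) (l := fun n => -freq c J' n)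
    (fun n n' => by simpa using hint n n') (fun y => rfl) _
    (continuous_wave_ofReal hc ht b J)]
  · simp [hne]
  · intro y
    rw [wave]
    refine tsum_congr fun n => ?_
    push_cast
    ring_nf

/-! ### The seven families as reflected theta series -/

namespace EllipticDPP.AffineType

/-- The twist `b`: the series of `♯(R)` has alternating signs `(-1)^{bn}`. -/
def twist : AffineType → ℕ
  | B => 1
  | Bv => 1
  | _ => 0

/-- The sign of the reflection `z ↦ -z` in the definition of `Θ^{♯(R)}`; it is `0` in type `A`,
where there is no reflection. -/
noncomputable def reflSign : AffineType → ℂ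
  | A => 0
  | D => 1
  | _ => -1

/-- The constant phase in front of the series: the factor `i` in the definition of `ϑ₁`. -/
noncomputable def phase : AffineType → ℂ
  | B => Complex.I
  | Bv => Complex.I
  | _ => 1

/-- The number `𝒩^R` as a natural number. -/
def degree : AffineType → ℕ → ℕ
  | A, N => N
  | B, N => 2 * N - 1
  | Bv, N => 2 * N
  | C, N => 2 * N + 2
  | Cv, N => 2 * N
  | BC, N => 2 * N + 1
  | D, N => 2 * N - 2

/-- The indices `j` for which the frequencies of `M^R_j` are stable under `k ↦ -k`. -/
def IsFixed : AffineType → ℕ → ℕ → Prop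
  | B, _, j => j = 1
  | Bv, _, j => j = 1
  | D, N, j => j = 1 ∨ j = N
  | _, _, _ => False

theorem curlyN_eq_degree {N : ℕ} (hN : 1 ≤ N) (R : AffineType) :
    R.curlyN N = (R.degree N : ℝ) := by
  have h1 : ((2 * N - 1 : ℕ) : ℝ) = 2 * N - 1 := by
    rw [Nat.cast_sub (by omega)]; push_cast; ring
  have h2 : ((2 * N - 2 : ℕ) : ℝ) = 2 * (N - 1) := by
    rw [Nat.cast_sub (by omega)]; push_cast; ring
  cases R <;> simp only [curlyN, degree, h1, h2] <;> push_cast <;> ring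

theorem le_degree {N : ℕ} (hN : 1 ≤ N) (R : AffineType) (hD : R = D → 2 ≤ N) :
    N ≤ R.degree N := by
  cases R <;> simp [degree] at * <;> omega

theorem norm_phase (R : AffineType) : ‖R.phase‖ = 1 := by
  cases R <;> simp [phase]

theorem conj_reflSign (R : AffineType) : (starRingEnd ℂ) R.reflSign = R.reflSign := by
  cases R <;> simp [reflSign]

theorem reflSign_sq {R : AffineType} (hR : R ≠ A) : R.reflSign * R.reflSign = 1 := by
  cases R <;> simp [reflSign] at *

theorem J_sub_J (R : AffineType) (j l : ℕ) : R.J j - R.J l = (j : ℝ) - l := by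
  cases R <;> simp [J]

end EllipticDPP.AffineType

open EllipticDPP

/-- The series `w(z) ± w(-z)` (or `w(z)` in type `A`) underlying `M^R_j`. -/
noncomputable def foldedWave (R : AffineType) (c J s : ℝ) (z : ℂ) : ℂ :=
  wave R.twist c J s z + R.reflSign * wave R.twist c J s (-z)

theorem exp_mul_theta2 {c : ℝ} (hc : c ≠ 0) (J s : ℝ) (y : ℂ) :
    Complex.exp (2 * Real.pi * Complex.I * (J / c) * (c * (y / (2 * Real.pi)))) *
      theta2 (J / c * (c ^ 2 * (Complex.I * s / (2 * Real.pi))) + c * (y / (2 * Real.pi)))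
        (c ^ 2 * (Complex.I * s / (2 * Real.pi))) =
      Complex.exp (s * J ^ 2 / 2) * wave 0 c J s y := by
  have hpi : (Real.pi : ℂ) ≠ 0 := by exact_mod_cast Real.pi_ne_zero
  have hc' : (c : ℂ) ≠ 0 := by exact_mod_cast hc
  rw [theta2, wave, ← tsum_mul_left, ← tsum_mul_left]
  refine tsum_congr fun n => ?_
  simp only [pow_zero, one_zpow, one_mul, ← Complex.exp_add, freq]
  congr 1
  push_cast
  field_simp
  ring_nf
  rw [Complex.I_sq]
  ring

theorem exp_mul_theta1 {c : ℝ} (hc : c ≠ 0) (J s : ℝ) (y : ℂ) :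
    Complex.exp (2 * Real.pi * Complex.I * (J / c) * (c * (y / (2 * Real.pi)))) *
      theta1 (J / c * (c ^ 2 * (Complex.I * s / (2 * Real.pi))) + c * (y / (2 * Real.pi)))
        (c ^ 2 * (Complex.I * s / (2 * Real.pi))) =
      Complex.exp (s * J ^ 2 / 2) * (Complex.I * wave 1 c J s y) := by
  have hpi : (Real.pi : ℂ) ≠ 0 := by exact_mod_cast Real.pi_ne_zero
  have hc' : (c : ℂ) ≠ 0 := by exact_mod_cast hc
  have h2 : ∀ v w : ℂ, theta1 v w = Complex.I * ∑' n : ℤ, (-1 : ℂ) ^ n *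
      Complex.exp (Real.pi * Complex.I * w * ((n : ℂ) - 1 / 2) ^ 2) *
      Complex.exp (Real.pi * Complex.I * v * (2 * (n : ℂ) - 1)) := fun v w => rfl
  rw [h2, mul_left_comm, mul_left_comm (Complex.exp (s * J ^ 2 / 2))]
  congr 1
  rw [wave, ← tsum_mul_left, ← tsum_mul_left]
  refine tsum_congr fun n => ?_
  have h3 : Complex.exp (2 * Real.pi * Complex.I * (J / c) * (c * (y / (2 * Real.pi)))) *
      (Complex.exp (Real.pi * Complex.I * (c ^ 2 * (Complex.I * s / (2 * Real.pi))) *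
        ((n : ℂ) - 1 / 2) ^ 2) *
      Complex.exp (Real.pi * Complex.I * (J / c * (c ^ 2 * (Complex.I * s / (2 * Real.pi))) +
        c * (y / (2 * Real.pi))) * (2 * (n : ℂ) - 1))) =
      Complex.exp (s * J ^ 2 / 2) * (Complex.exp (-(s * freq c J n ^ 2) / 2) *
        Complex.exp (Complex.I * freq c J n * y)) := by
    simp only [← Complex.exp_add, freq]
    congr 1
    push_cast
    field_simp
    ring_nf
    rw [Complex.I_sq]
    ring
  rw [pow_one]
  linear_combination (-1 : ℂ) ^ n * h3

theorem M_eq_foldedWave (R : AffineType) {N : ℕ} (hc : R.curlyN N ≠ 0) {r : ℝ} (hr : r ≠ 0)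
    (j : ℕ) (x s : ℝ) :
    M R N r j x s = Complex.exp ((s / r ^ 2 : ℝ) * R.J j ^ 2 / 2) *
      (R.phase * foldedWave R (R.curlyN N) (R.J j) (s / r ^ 2) ((x / r : ℝ) : ℂ)) := by
  have hr' : (r : ℂ) ≠ 0 := by exact_mod_cast hr
  have hpi : (Real.pi : ℂ) ≠ 0 := by exact_mod_cast Real.pi_ne_zero
  have hxi : (xi r x : ℂ) = ((x / r : ℝ) : ℂ) / (2 * Real.pi) := by
    rw [xi]
    push_cast
    field_simp
  have htau : tau r s = Complex.I * ((s / r ^ 2 : ℝ) : ℂ) / (2 * Real.pi) := by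
    rw [tau]
    push_cast
    field_simp
  have hσ : ((R.J j / R.curlyN N : ℝ) : ℂ) = (R.J j : ℂ) / (R.curlyN N : ℂ) := by push_cast; rfl
  have e2 := exp_mul_theta2 hc (R.J j) (s / r ^ 2) ((x / r : ℝ) : ℂ)
  have e2' := exp_mul_theta2 hc (R.J j) (s / r ^ 2) (-((x / r : ℝ) : ℂ))
  have e1 := exp_mul_theta1 hc (R.J j) (s / r ^ 2) ((x / r : ℝ) : ℂ)
  have e1' := exp_mul_theta1 hc (R.J j) (s / r ^ 2) (-((x / r : ℝ) : ℂ))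
  rw [neg_div, mul_neg, mul_neg, ← sub_eq_add_neg] at e1' e2'
  rw [M, hxi, htau]
  cases R
  case A =>
    simp only [AffineType.bigTheta, bigThetaA, hσ, foldedWave, AffineType.twist,
      AffineType.reflSign, AffineType.phase]
    rw [e2]; ring
  case D =>
    simp only [AffineType.bigTheta, bigThetaD, hσ, foldedWave, AffineType.twist,
      AffineType.reflSign, AffineType.phase]
    rw [e2, e2']; ring
  case B =>
    simp only [AffineType.bigTheta, bigThetaB, hσ, foldedWave, AffineType.twist,
      AffineType.reflSign, AffineType.phase]
    rw [e1, e1']; ring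
  case Bv =>
    simp only [AffineType.bigTheta, bigThetaB, hσ, foldedWave, AffineType.twist,
      AffineType.reflSign, AffineType.phase]
    rw [e1, e1']; ring
  case C =>
    simp only [AffineType.bigTheta, bigThetaC, hσ, foldedWave, AffineType.twist,
      AffineType.reflSign, AffineType.phase]
    rw [e2, e2']; ring
  case Cv =>
    simp only [AffineType.bigTheta, bigThetaC, hσ, foldedWave, AffineType.twist,
      AffineType.reflSign, AffineType.phase]
    rw [e2, e2']; ring
  case BC =>
    simp only [AffineType.bigTheta, bigThetaC, hσ, foldedWave, AffineType.twist,
      AffineType.reflSign, AffineType.phase]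
    rw [e2, e2']; ring

/-- The constant `m^R_j(t) / c^R_j` as a real number: `m^R_j(t)` without the factor `2` for stable
frequencies. -/
noncomputable def normConst (R : AffineType) (N : ℕ) (r t : ℝ) (j : ℕ) : ℝ :=
  2 * Real.pi * r * (Real.exp (t / r ^ 2 * R.J j ^ 2 / 2) *
    waveNorm (R.curlyN N) (R.J j) (t / r ^ 2))

theorem mGeneric_eq (R : AffineType) (N : ℕ) {r : ℝ} (hr : r ≠ 0) (t : ℝ) (j : ℕ) :
    mGeneric R N r t j = normConst R N r t j := by
  have hr' : (r : ℂ) ≠ 0 := by exact_mod_cast hr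
  have hpi : (Real.pi : ℂ) ≠ 0 := by exact_mod_cast Real.pi_ne_zero
  rw [mGeneric, normConst, waveNorm, theta2]
  push_cast
  congr 1
  rw [← tsum_mul_left]
  refine tsum_congr fun n => ?_
  rw [← Complex.exp_add, ← Complex.exp_add, tau, freq]
  congr 1
  push_cast
  field_simp
  ring_nf
  rw [Complex.I_sq]
  ring

theorem m_eq_of_isFixed {R : AffineType} {N : ℕ} {r : ℝ} (hr : r ≠ 0) (t : ℝ) {j : ℕ}
    (h : R.IsFixed N j) : m R N r t j = 2 * normConst R N r t j := by
  rw [← mGeneric_eq R N hr]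
  cases R <;> simp only [AffineType.IsFixed] at h <;> simp only [m, if_pos h]

theorem m_eq_of_not_isFixed {R : AffineType} {N : ℕ} {r : ℝ} (hr : r ≠ 0) (t : ℝ) {j : ℕ}
    (h : ¬ R.IsFixed N j) : m R N r t j = normConst R N r t j := by
  rw [← mGeneric_eq R N hr]
  cases R <;> simp only [AffineType.IsFixed] at h <;> first | rfl | simp only [m, if_neg h]

theorem normConst_pos {R : AffineType} {N : ℕ} (hc : R.curlyN N ≠ 0) {r t : ℝ} (hr : 0 < r)
    (ht : 0 < t) (j : ℕ) : 0 < normConst R N r t j := by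
  have h1 := waveNorm_pos hc (div_pos ht (pow_pos hr 2)) (R.J j)
  have := Real.pi_pos
  unfold normConst
  positivity

/-- The constants `m^R_j` are positive real numbers. -/
theorem m_eq_ofReal_pos {R : AffineType} {N : ℕ} (hc : R.curlyN N ≠ 0) {r t : ℝ} (hr : 0 < r)
    (ht : 0 < t) (j : ℕ) : ∃ a : ℝ, 0 < a ∧ m R N r t j = a := by
  have h := normConst_pos hc hr ht j
  by_cases hf : R.IsFixed N j
  · exact ⟨2 * normConst R N r t j, by positivity, by
      rw [m_eq_of_isFixed hr.ne' t hf]; push_cast; rfl⟩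
  · exact ⟨normConst R N r t j, h, m_eq_of_not_isFixed hr.ne' t hf⟩

/-! ### Coincidences between frequencies -/

theorem freq_sub_freq_int (R : AffineType) (N j l : ℕ) (n n' : ℤ) :
    ∃ k : ℤ, freq (R.degree N : ℝ) (R.J j) n - freq (R.degree N : ℝ) (R.J l) n' = k := by
  refine ⟨R.degree N * (n - n') + (j - l), ?_⟩
  have := R.J_sub_J j l
  simp only [freq]
  push_cast
  linear_combination this

theorem freq_add_freq_int {R : AffineType} (hR : R ≠ AffineType.A) (N j l : ℕ) (n n' : ℤ) :
    ∃ k : ℤ, freq (R.degree N : ℝ) (R.J j) n + freq (R.degree N : ℝ) (R.J l) n' = k := by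
  have h : ∃ k : ℤ, R.J j + R.J l = k := by
    cases R
    case A => exact absurd rfl hR
    case B => exact ⟨j + l - 2, by simp only [AffineType.J]; push_cast; ring⟩
    case Bv => exact ⟨j + l - 2, by simp only [AffineType.J]; push_cast; ring⟩
    case C => exact ⟨j + l, by simp only [AffineType.J]; push_cast; ring⟩
    case Cv => exact ⟨j + l - 1, by simp only [AffineType.J]; push_cast; ring⟩
    case BC => exact ⟨j + l, by simp only [AffineType.J]; push_cast; ring⟩
    case D => exact ⟨j + l - 2, by simp only [AffineType.J]; push_cast; ring⟩
  obtain ⟨k, hk⟩ := h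
  refine ⟨R.degree N * (n + n' - 1) + k, ?_⟩
  simp only [freq]
  push_cast
  linear_combination hk

theorem eq_of_freq_eq {R : AffineType} {N : ℕ} (hN : 1 ≤ N) (hD : R = AffineType.D → 2 ≤ N)
    {j l : ℕ} (hj : 1 ≤ j) (hjN : j ≤ N) (hl : 1 ≤ l) (hlN : l ≤ N) {n n' : ℤ}
    (h : freq (R.degree N : ℝ) (R.J j) n = freq (R.degree N : ℝ) (R.J l) n') : j = l := by
  have hd := R.le_degree hN hD
  have hJ := R.J_sub_J j l
  have h1 : ((l : ℤ) - j : ℝ) = (R.degree N : ℝ) * (n - n') := by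
    simp only [freq] at h
    push_cast
    linear_combination hJ - h
  have h2 : (l : ℤ) - j = (R.degree N : ℤ) * (n - n') := by exact_mod_cast h1
  have h3 : (l : ℤ) - j = 0 := by
    refine Int.eq_zero_of_abs_lt_dvd ⟨_, h2⟩ ?_
    rw [abs_lt]
    constructor <;> omega
  omega

theorem isFixed_of_freq_eq_neg {R : AffineType} (hR : R ≠ AffineType.A) {N : ℕ}
    {j l : ℕ} (hj : 1 ≤ j) (hjN : j ≤ N) (hl : 1 ≤ l) (hlN : l ≤ N)
    {n n' : ℤ} (h : freq (R.degree N : ℝ) (R.J j) n = -freq (R.degree N : ℝ) (R.J l) n') :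
    j = l ∧ R.IsFixed N j := by
  obtain ⟨k, hk⟩ : ∃ k : ℤ, k = 1 - n - n' := ⟨_, rfl⟩
  have h1 : R.J j + R.J l = R.degree N * (k : ℝ) := by
    rw [hk]
    simp only [freq] at h
    push_cast
    linear_combination h
  have key : ∀ p d : ℤ, 0 < d → 0 < p → p < d → p = d * k → False := by
    intro p d hd hp hpd he
    have := Int.eq_zero_of_abs_lt_dvd ⟨k, he⟩ (by rw [abs_of_pos hp]; exact hpd)
    omega
  cases R
  case A => exact absurd rfl hR
  case B =>
    simp only [AffineType.J, AffineType.degree] at h1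
    rw [Nat.cast_sub (by omega)] at h1
    push_cast at h1
    have h2 : (j : ℤ) + l - 2 = (2 * N - 1) * k := by
      have : ((j : ℤ) + l - 2 : ℝ) = (2 * (N : ℤ) - 1) * k := by push_cast; linear_combination h1
      exact_mod_cast this
    simp only [AffineType.IsFixed]
    by_contra hne
    exact key _ _ (by omega) (by omega) (by omega) h2
  case Bv =>
    simp only [AffineType.J, AffineType.degree] at h1
    push_cast at h1
    have h2 : (j : ℤ) + l - 2 = (2 * N) * k := by
      have : ((j : ℤ) + l - 2 : ℝ) = (2 * (N : ℤ)) * k := by push_cast; linear_combination h1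
      exact_mod_cast this
    simp only [AffineType.IsFixed]
    by_contra hne
    exact key _ _ (by omega) (by omega) (by omega) h2
  case C =>
    simp only [AffineType.J, AffineType.degree] at h1
    have h2 : (j : ℤ) + l = (2 * N + 2) * k := by exact_mod_cast h1
    exact (key _ _ (by omega) (by omega) (by omega) h2).elim
  case Cv =>
    simp only [AffineType.J, AffineType.degree] at h1
    push_cast at h1
    have h2 : (j : ℤ) + l - 1 = (2 * N) * k := by
      have : ((j : ℤ) + l - 1 : ℝ) = (2 * (N : ℤ)) * k := by push_cast; linear_combination h1
      exact_mod_cast this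
    exact (key _ _ (by omega) (by omega) (by omega) h2).elim
  case BC =>
    simp only [AffineType.J, AffineType.degree] at h1
    have h2 : (j : ℤ) + l = (2 * N + 1) * k := by exact_mod_cast h1
    exact (key _ _ (by omega) (by omega) (by omega) h2).elim
  case D =>
    simp only [AffineType.J, AffineType.degree] at h1
    rw [Nat.cast_sub (by omega)] at h1
    push_cast at h1
    have h2 : (j : ℤ) + l - 2 = (2 * N - 2) * k := by
      have : ((j : ℤ) + l - 2 : ℝ) = (2 * (N : ℤ) - 2) * k := by push_cast; linear_combination h1
      exact_mod_cast this
    simp only [AffineType.IsFixed]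
    by_contra hne
    exact key _ _ (by omega) (by omega) (by omega) h2

theorem wave_neg_of_isFixed {R : AffineType} {N : ℕ} (hN : 1 ≤ N) {j : ℕ} (h : R.IsFixed N j)
    (s : ℝ) (z : ℂ) : wave R.twist (R.degree N) (R.J j) s (-z) =
      R.reflSign * wave R.twist (R.degree N) (R.J j) s z := by
  have h0 : R.J j = 0 → (-1 : ℂ) ^ R.twist = R.reflSign →
      wave R.twist (R.degree N) (R.J j) s (-z) =
        R.reflSign * wave R.twist (R.degree N) (R.J j) s z := by
    intro hJ hs
    rw [hJ, wave_neg_of_eq_zero, hs]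
  cases R <;> simp only [AffineType.IsFixed] at h
  case B => exact h0 (by simp [AffineType.J, h]) (by simp [AffineType.twist, AffineType.reflSign])
  case Bv => exact h0 (by simp [AffineType.J, h]) (by simp [AffineType.twist, AffineType.reflSign])
  case D =>
    rcases h with h | h
    · exact h0 (by simp [AffineType.J, h]) (by simp [AffineType.twist, AffineType.reflSign])
    · rw [wave_neg_eq_sub]
      have hJ : ((AffineType.D.degree N : ℕ) : ℝ) - AffineType.D.J j = AffineType.D.J j := by
        simp only [AffineType.degree, AffineType.J, h]
        rw [Nat.cast_sub (by omega)]
        push_cast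
        ring
      rw [hJ]
      simp [AffineType.reflSign]

/-! ### Biorthogonality of the functions `M^R_j` -/

theorem conj_foldedWave (R : AffineType) (c J s x : ℝ) :
    (starRingEnd ℂ) (foldedWave R c J s x) = foldedWave R c J s (-x) := by
  rw [foldedWave, foldedWave, map_add, map_mul, R.conj_reflSign, conj_wave]
  have := conj_wave R.twist c J s (-x)
  push_cast at this
  rw [this]

theorem foldedWave_neg {R : AffineType} (hR : R ≠ AffineType.A) (c J s : ℝ) (z : ℂ) :
    foldedWave R c J s (-z) = R.reflSign * foldedWave R c J s z := by
  have h := AffineType.reflSign_sq hR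
  rw [foldedWave, foldedWave, neg_neg]
  linear_combination -wave R.twist c J s (-z) * h

theorem exp_freq_mul_two_pi (R : AffineType) (N j l : ℕ) (n n' : ℤ) :
    Complex.exp (Complex.I * freq (R.degree N : ℝ) (R.J j) n * (2 * Real.pi)) =
      Complex.exp (Complex.I * freq (R.degree N : ℝ) (R.J l) n' * (2 * Real.pi)) := by
  obtain ⟨k, hk⟩ := freq_sub_freq_int R N j l n n'
  rw [Complex.exp_eq_exp_iff_exists_int]
  refine ⟨k, ?_⟩
  have : (freq (R.degree N : ℝ) (R.J j) n : ℂ) - freq (R.degree N : ℝ) (R.J l) n' = k := by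
    exact_mod_cast hk
  linear_combination Complex.I * (2 * Real.pi) * this

/-- The multiplier of the functions `M^R_j` under translation by the real period. -/
noncomputable def realMultiplier (R : AffineType) (N : ℕ) : ℂ :=
  Complex.exp (Complex.I * freq (R.degree N : ℝ) (R.J 1) 0 * (2 * Real.pi))

theorem norm_realMultiplier (R : AffineType) (N : ℕ) : ‖realMultiplier R N‖ = 1 := by
  rw [realMultiplier, show Complex.I * (freq (R.degree N : ℝ) (R.J 1) 0 : ℂ) * (2 * Real.pi) =
    ((freq (R.degree N : ℝ) (R.J 1) 0 * (2 * Real.pi) : ℝ) : ℂ) * Complex.I by push_cast; ring,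
    Complex.norm_exp_ofReal_mul_I]

theorem realMultiplier_sq {R : AffineType} (hR : R ≠ AffineType.A) (N : ℕ) :
    realMultiplier R N * realMultiplier R N = 1 := by
  obtain ⟨k, hk⟩ := freq_add_freq_int hR N 1 1 0 0
  have hk' : (freq (R.degree N : ℝ) (R.J 1) 0 : ℂ) + freq (R.degree N : ℝ) (R.J 1) 0 = k := by
    exact_mod_cast hk
  rw [realMultiplier, ← Complex.exp_add, Complex.exp_eq_one_iff]
  exact ⟨k, by linear_combination Complex.I * (2 * Real.pi) * hk'⟩

theorem foldedWave_add_two_pi (R : AffineType) (N j : ℕ) (s : ℝ) (z : ℂ) :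
    foldedWave R (R.degree N) (R.J j) s (z + 2 * Real.pi) =
      realMultiplier R N * foldedWave R (R.degree N) (R.J j) s z := by
  have h1 := fun z => wave_add_two_pi (σ := realMultiplier R N) R.twist s
    (fun n => exp_freq_mul_two_pi R N j 1 n 0) z
  rw [foldedWave, foldedWave, h1]
  by_cases hR : R = AffineType.A
  · subst hR
    simp [AffineType.reflSign]
  · have h2 := h1 (-(z + 2 * Real.pi))
    rw [show -(z + 2 * (Real.pi : ℂ)) + 2 * Real.pi = -z by ring] at h2
    have h3 := realMultiplier_sq hR N
    rw [h2]
    linear_combination -R.reflSign *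
      wave R.twist (R.degree N) (R.J j) s (-(z + 2 * Real.pi)) * h3

theorem differentiable_foldedWave {R : AffineType} {c s : ℝ} (hc : c ≠ 0) (hs : 0 < s) (J : ℝ) :
    Differentiable ℂ (foldedWave R c J s) := by
  have h := differentiable_wave hc hs R.twist J
  have h2 : Differentiable ℂ fun z => wave R.twist c J s (-z) := h.comp (by fun_prop)
  unfold foldedWave
  fun_prop

/-- Biorthogonality of the reflected series on a full period, for the types with a reflection. -/
theorem integral_foldedWave_mul {R : AffineType} (hR : R ≠ AffineType.A) {N : ℕ} (hN : 1 ≤ N)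
    (hD : R = AffineType.D → 2 ≤ N) {s t : ℝ} (hs : 0 < s) (ht : 0 < t) {j l : ℕ}
    (hj : 1 ≤ j) (hjN : j ≤ N) (hl : 1 ≤ l) (hlN : l ≤ N) [Decidable (R.IsFixed N j)] :
    ∫ y in (0 : ℝ)..2 * Real.pi, foldedWave R (R.degree N) (R.J l) t y *
        foldedWave R (R.degree N) (R.J j) s (-y) =
      if j = l then (if R.IsFixed N j then (2 : ℂ) else 1) *
        (2 * (2 * Real.pi * (waveNorm (R.degree N) (R.J j) (s + t) : ℂ))) else 0 := by
  have hd : ((R.degree N : ℕ) : ℝ) ≠ 0 := by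
    have := R.le_degree hN hD
    exact_mod_cast (by omega : R.degree N ≠ 0)
  have hδ := AffineType.reflSign_sq hR
  have hI : ∀ {s t : ℝ}, 0 < s → 0 < t → ∀ {j l : ℕ}, 1 ≤ j → j ≤ N → 1 ≤ l → l ≤ N →
      ∫ y in (0 : ℝ)..2 * Real.pi, wave R.twist (R.degree N) (R.J l) t y *
        wave R.twist (R.degree N) (R.J j) s (-y) =
      if j = l then 2 * Real.pi * (waveNorm (R.degree N) (R.J j) (s + t) : ℂ) else 0 := by
    intro s t hs ht j l hj hjN hl hlN
    split_ifs with hjl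
    · subst hjl
      exact integral_wave_mul_wave_neg_self hd ⟨R.degree N, by simp⟩ hs ht _ _
    · refine integral_wave_mul_wave_neg_of_ne hd hs ht _ (freq_sub_freq_int R N l j) ?_
      intro n n' h
      exact hjl (eq_of_freq_eq hN hD hl hlN hj hjN h).symm
  by_cases hfix : j = l ∧ R.IsFixed N j
  · -- The series is then even or odd already, so that reflecting it doubles it.
    obtain ⟨rfl, hf⟩ := hfix
    have h1 : ∀ y : ℝ, foldedWave R (R.degree N) (R.J j) t y *
        foldedWave R (R.degree N) (R.J j) s (-y) =
        4 * (wave R.twist (R.degree N) (R.J j) t y *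
          wave R.twist (R.degree N) (R.J j) s (-y)) := by
      intro y
      have e1 := wave_neg_of_isFixed hN hf t (y : ℂ)
      have e2 := wave_neg_of_isFixed hN hf s (-(y : ℂ))
      rw [foldedWave, foldedWave, e1, e2]
      linear_combination wave R.twist (R.degree N) (R.J j) t y *
        wave R.twist (R.degree N) (R.J j) s (-y) * (3 + R.reflSign * R.reflSign) * hδ
    simp_rw [h1]
    rw [intervalIntegral.integral_const_mul, hI hs ht hj hjN hl hlN, if_pos rfl,
      if_pos trivial, if_pos hf]
    ring
  · -- The products of two series of the same orientation integrate to zero, because no frequency is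
    -- the negative of another one.
    have c1 := continuous_wave_ofReal hd ht R.twist (R.J l)
    have c2 := continuous_wave_neg_ofReal hd ht R.twist (R.J l)
    have c3 := continuous_wave_ofReal hd hs R.twist (R.J j)
    have c4 := continuous_wave_neg_ofReal hd hs R.twist (R.J j)
    have h1 : ∀ y : ℝ, foldedWave R (R.degree N) (R.J l) t y *
        foldedWave R (R.degree N) (R.J j) s (-y) =
        (wave R.twist (R.degree N) (R.J l) t y * wave R.twist (R.degree N) (R.J j) s (-y) +
        wave R.twist (R.degree N) (R.J j) s y * wave R.twist (R.degree N) (R.J l) t (-y)) +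
        (R.reflSign * (wave R.twist (R.degree N) (R.J l) t y *
          wave R.twist (R.degree N) (R.J j) s y) +
        R.reflSign * (wave R.twist (R.degree N) (R.degree N - R.J l) t y *
          wave R.twist (R.degree N) (R.degree N - R.J j) s y)) := by
      intro y
      rw [foldedWave, foldedWave, ← wave_neg_eq_sub, ← wave_neg_eq_sub, neg_neg]
      linear_combination wave R.twist (R.degree N) (R.J j) s y *
        wave R.twist (R.degree N) (R.J l) t (-y) * hδ
    have hz1 : ∫ y in (0 : ℝ)..2 * Real.pi, wave R.twist (R.degree N) (R.J l) t y *
          wave R.twist (R.degree N) (R.J j) s y = 0 := by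
      refine integral_wave_mul_wave_of_ne hd hs ht _ (freq_add_freq_int hR N l j) ?_
      intro n n' h
      have := isFixed_of_freq_eq_neg hR hl hlN hj hjN h
      exact hfix ⟨this.1.symm, this.1 ▸ this.2⟩
    have hrefl : ∀ (J : ℝ) (n : ℤ), freq (R.degree N) (R.degree N - J) n =
        -freq (R.degree N) J (-n) := by
      intro J n
      simp only [freq]
      push_cast
      ring
    have hz2 : ∫ y in (0 : ℝ)..2 * Real.pi, wave R.twist (R.degree N) (R.degree N - R.J l) t y *
          wave R.twist (R.degree N) (R.degree N - R.J j) s y = 0 := by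
      refine integral_wave_mul_wave_of_ne hd hs ht _ ?_ ?_
      · intro n n'
        obtain ⟨k, hk⟩ := freq_add_freq_int hR N l j (-n) (-n')
        refine ⟨-k, ?_⟩
        rw [hrefl, hrefl]
        push_cast
        linear_combination -hk
      · intro n n' h
        rw [hrefl, hrefl] at h
        have := isFixed_of_freq_eq_neg hR hl hlN hj hjN (neg_inj.1 h)
        exact hfix ⟨this.1.symm, this.1 ▸ this.2⟩
    have d1 := continuous_wave_ofReal hd ht R.twist (R.degree N - R.J l)
    have d2 := continuous_wave_ofReal hd hs R.twist (R.degree N - R.J j)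
    simp_rw [h1]
    rw [intervalIntegral.integral_add, intervalIntegral.integral_add,
      intervalIntegral.integral_add, intervalIntegral.integral_const_mul,
      intervalIntegral.integral_const_mul, hz1, hz2, hI hs ht hj hjN hl hlN,
      hI ht hs hl hlN hj hjN]
    · by_cases hjl : j = l
      · subst hjl
        have hf : ¬ R.IsFixed N j := fun hf => hfix ⟨rfl, hf⟩
        simp only [↓reduceIte, hf, add_comm t s]
        ring
      · rw [if_neg hjl, if_neg (Ne.symm hjl), if_neg hjl]
        ring
    all_goals exact Continuous.intervalIntegrable (by fun_prop) _ _

/-- Biorthogonality on the half period. -/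
theorem integral_half_foldedWave_mul {R : AffineType} (hR : R ≠ AffineType.A) {N : ℕ} (hN : 1 ≤ N)
    (hD : R = AffineType.D → 2 ≤ N) {s t : ℝ} (hs : 0 < s) (ht : 0 < t) {j l : ℕ}
    (hj : 1 ≤ j) (hjN : j ≤ N) (hl : 1 ≤ l) (hlN : l ≤ N) [Decidable (R.IsFixed N j)] :
    ∫ y in (0 : ℝ)..Real.pi, foldedWave R (R.degree N) (R.J l) t y *
        foldedWave R (R.degree N) (R.J j) s (-y) =
      if j = l then (if R.IsFixed N j then (2 : ℂ) else 1) *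
        (2 * Real.pi * (waveNorm (R.degree N) (R.J j) (s + t) : ℂ)) else 0 := by
  have hd : ((R.degree N : ℕ) : ℝ) ≠ 0 := by
    have := R.le_degree hN hD
    exact_mod_cast (by omega : R.degree N ≠ 0)
  have hδ := AffineType.reflSign_sq hR
  set f : ℝ → ℂ := fun y => foldedWave R (R.degree N) (R.J l) t y *
        foldedWave R (R.degree N) (R.J j) s (-y) with hf
  have hfc : Continuous f :=
    ((differentiable_foldedWave hd ht (R.J l)).continuous.comp Complex.continuous_ofReal).mul
      ((differentiable_foldedWave hd hs (R.J j)).continuous.comp Complex.continuous_ofReal.neg)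
  have hsymm : ∀ y, f (2 * Real.pi - y) = f y := by
    intro y
    have e1 := foldedWave_add_two_pi R N l t (-(y : ℂ))
    have e2 := foldedWave_add_two_pi R N j s ((y : ℂ) - 2 * Real.pi)
    rw [foldedWave_neg hR, show -(y : ℂ) + 2 * Real.pi = ((2 * Real.pi - y : ℝ) : ℂ) by
      push_cast; ring] at e1
    rw [show (y : ℂ) - 2 * Real.pi + 2 * Real.pi = y by ring,
      show (y : ℂ) - 2 * Real.pi = -((2 * Real.pi - y : ℝ) : ℂ) by push_cast; ring] at e2
    simp only [hf]
    rw [e1, foldedWave_neg hR (R.degree N) (R.J j) s y, e2]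
    ring
  have hsplit := intervalIntegral.integral_add_adjacent_intervals
    (hfc.intervalIntegrable 0 Real.pi) (hfc.intervalIntegrable (μ := volume) Real.pi (2 * Real.pi))
  have hback : ∫ y in Real.pi..2 * Real.pi, f y = ∫ y in (0 : ℝ)..Real.pi, f y := by
    have := intervalIntegral.integral_comp_sub_left (a := 0) (b := Real.pi) f (2 * Real.pi)
    rw [sub_zero, show 2 * Real.pi - Real.pi = Real.pi by ring] at this
    rw [← this]
    exact intervalIntegral.integral_congr fun y _ => hsymm y
  rw [hback, integral_foldedWave_mul hR hN hD hs ht hj hjN hl hlN] at hsplit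
  split_ifs at hsplit ⊢ <;> linear_combination hsplit / 2

theorem integral_foldedWave_mul_typeA {N : ℕ} (hN : 1 ≤ N) {s t : ℝ} (hs : 0 < s) (ht : 0 < t)
    {j l : ℕ} (hj : 1 ≤ j) (hjN : j ≤ N) (hl : 1 ≤ l) (hlN : l ≤ N) :
    ∫ y in (0 : ℝ)..2 * Real.pi, foldedWave .A (AffineType.A.degree N) (AffineType.A.J l) t y *
        foldedWave .A (AffineType.A.degree N) (AffineType.A.J j) s (-y) =
      if j = l then 2 * Real.pi *
        (waveNorm (AffineType.A.degree N) (AffineType.A.J j) (s + t) : ℂ) else 0 := by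
  have hD : AffineType.A = AffineType.D → 2 ≤ N := fun h => by cases h
  have hd : ((AffineType.A.degree N : ℕ) : ℝ) ≠ 0 := by
    have := AffineType.le_degree hN AffineType.A hD
    exact_mod_cast (by omega : AffineType.A.degree N ≠ 0)
  simp only [foldedWave, AffineType.reflSign, zero_mul, add_zero]
  split_ifs with hjl
  · subst hjl
    exact integral_wave_mul_wave_neg_self hd ⟨AffineType.A.degree N, by simp⟩ hs ht _ _
  · refine integral_wave_mul_wave_neg_of_ne hd hs ht _ (freq_sub_freq_int .A N l j) ?_
    intro n n' h
    exact hjl (eq_of_freq_eq hN hD hl hlN hj hjN h).symm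

/-- The length of the state space for `r = 1`. -/
noncomputable def stateLength : AffineType → ℝ
  | .A => 2 * Real.pi
  | _ => Real.pi

theorem stateLength_pos (R : AffineType) : 0 < stateLength R := by
  have := Real.pi_pos
  cases R <;> simp only [stateLength] <;> positivity

theorem setIntegral_stateSpace (R : AffineType) {r : ℝ} (hr : 0 < r) (f : ℝ → ℂ) :
    ∫ x in R.stateSpace r, f (x / r) = r * ∫ y in (0 : ℝ)..stateLength R, f y := by
  have h : ∫ x in R.stateSpace r, f (x / r) =
      ∫ x in (0 : ℝ)..stateLength R * r, f (x / r) := by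
    have hp := (mul_pos (stateLength_pos R) hr).le
    rw [intervalIntegral.integral_of_le hp]
    cases R <;>
      simp only [AffineType.stateSpace, stateLength, integral_Ico_eq_integral_Ioc,
        integral_Icc_eq_integral_Ioc]
  rw [h, intervalIntegral.integral_comp_div f hr.ne', zero_div, mul_div_assoc, div_self hr.ne',
    mul_one, Complex.real_smul]

/-- Biorthogonality of the functions `M^R_j(·, s)` and `M^R_l(·, t)`. -/
theorem integral_conj_M_mul_M {R : AffineType} {N : ℕ} (hN : 1 ≤ N)
    (hD : R = AffineType.D → 2 ≤ N) {r s t : ℝ} (hr : 0 < r) (hs : 0 < s) (ht : 0 < t) {j l : ℕ}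
    (hj : 1 ≤ j) (hjN : j ≤ N) (hl : 1 ≤ l) (hlN : l ≤ N) :
    ∫ x in R.stateSpace r, (starRingEnd ℂ) (M R N r j x s) * M R N r l x t =
      if j = l then m R N r (s + t) j else 0 := by
  classical
  have hd : R.curlyN N ≠ 0 := by
    rw [R.curlyN_eq_degree hN]
    have := R.le_degree hN hD
    exact_mod_cast (by omega : R.degree N ≠ 0)
  have hs' : 0 < s / r ^ 2 := by positivity
  have ht' : 0 < t / r ^ 2 := by positivity
  have hph : (starRingEnd ℂ) R.phase * R.phase = 1 := by
    rw [mul_comm, Complex.mul_conj, Complex.normSq_eq_norm_sq, R.norm_phase]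
    simp
  have hce : ∀ a b : ℝ, (starRingEnd ℂ) (Complex.exp ((a : ℂ) * (b : ℂ) ^ 2 / 2)) =
      Complex.exp ((a : ℂ) * (b : ℂ) ^ 2 / 2) := by
    intro a b
    rw [← Complex.exp_conj]
    simp [map_ofNat]
  have h1 : ∀ x : ℝ, (starRingEnd ℂ) (M R N r j x s) * M R N r l x t =
      (fun y : ℝ => (Complex.exp ((s / r ^ 2 : ℝ) * R.J j ^ 2 / 2) *
        Complex.exp ((t / r ^ 2 : ℝ) * R.J l ^ 2 / 2)) *
        (foldedWave R (R.degree N) (R.J l) (t / r ^ 2) y *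
          foldedWave R (R.degree N) (R.J j) (s / r ^ 2) (-y))) (x / r) := by
    intro x
    rw [M_eq_foldedWave R hd hr.ne', M_eq_foldedWave R hd hr.ne', map_mul, map_mul, hce,
      conj_foldedWave, R.curlyN_eq_degree hN]
    linear_combination Complex.exp ((s / r ^ 2 : ℝ) * R.J j ^ 2 / 2) *
        Complex.exp ((t / r ^ 2 : ℝ) * R.J l ^ 2 / 2) *
        (foldedWave R (R.degree N) (R.J l) (t / r ^ 2) ((x / r : ℝ) : ℂ) *
          foldedWave R (R.degree N) (R.J j) (s / r ^ 2) (-((x / r : ℝ) : ℂ))) * hph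
  simp_rw [h1]
  rw [setIntegral_stateSpace R hr (fun y : ℝ => (Complex.exp ((s / r ^ 2 : ℝ) * R.J j ^ 2 / 2) *
        Complex.exp ((t / r ^ 2 : ℝ) * R.J l ^ 2 / 2)) *
        (foldedWave R (R.degree N) (R.J l) (t / r ^ 2) y *
          foldedWave R (R.degree N) (R.J j) (s / r ^ 2) (-y))),
    intervalIntegral.integral_const_mul]
  have hnorm : (normConst R N r (s + t) j : ℂ) =
        r * (Complex.exp ((s / r ^ 2 : ℝ) * R.J j ^ 2 / 2) *
      Complex.exp ((t / r ^ 2 : ℝ) * R.J j ^ 2 / 2) *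
      (2 * Real.pi * waveNorm (R.degree N) (R.J j) (s / r ^ 2 + t / r ^ 2))) := by
    rw [normConst, R.curlyN_eq_degree hN, add_div, ← Complex.exp_add]
    push_cast
    rw [show ((s : ℂ) / r ^ 2 + t / r ^ 2) * R.J j ^ 2 / 2 =
      (s : ℂ) / r ^ 2 * R.J j ^ 2 / 2 + t / r ^ 2 * R.J j ^ 2 / 2 by ring]
    ring
  by_cases hR : R = AffineType.A
  · subst hR
    simp only [stateLength]
    rw [integral_foldedWave_mul_typeA hN hs' ht' hj hjN hl hlN]
    split_ifs with hjl
    · subst hjl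
      rw [m_eq_of_not_isFixed hr.ne' _ (by simp [AffineType.IsFixed]), hnorm]
    · simp
  · have hL : stateLength R = Real.pi := by
      cases R <;> first | rfl | exact absurd rfl hR
    rw [hL, integral_half_foldedWave_mul hR hN hD hs' ht' hj hjN hl hlN]
    split_ifs with hjl hf
    · subst hjl
      rw [m_eq_of_isFixed hr.ne' _ hf, hnorm]
      ring
    · subst hjl
      rw [m_eq_of_not_isFixed hr.ne' _ hf, hnorm]
      ring
    · simp

/-! ### Real zeros of linear combinations of the functions `M^R_j` -/

theorem foldedWave_add_mul_I (R : AffineType) (c J s : ℝ) (z : ℂ) :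
    foldedWave R c J s (z + (c * s : ℝ) * Complex.I) =
      (-1) ^ R.twist * Complex.exp (c * (c * s : ℝ) / 2) *
      Complex.exp (-(Complex.I * c * z)) * foldedWave R c J s z := by
  rw [foldedWave, wave_add_mul_I, wave_neg_add_mul_I, foldedWave]
  ring

/-- The case of `constraints_of_real_zeros` in which the zeros are pairs `± x_k` together with some
of the points `0, π`, which the reflection fixes modulo `2π`. The pairs contribute nothing to the
multipliers. -/
theorem constraints_of_reflected_zeros {T : ℝ} (hT : 0 < T) {F : ℂ → ℂ} (hF : Differentiable ℂ F)
    {n d : ℕ} {κ : Type} [Fintype κ] (hd : d = n + n + Fintype.card κ)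
    {σ ε : ℂ} (hσ : ‖σ‖ = 1) (hε : ‖ε‖ = 1)
    (h1 : ∀ z, F (z + 2 * Real.pi) = σ * F z)
    (h2 : ∀ z, F (z + T * Complex.I) = ε * Complex.exp (d * T / 2) *
      Complex.exp (-(Complex.I * d * z)) * F z)
    {x : Fin n → ℝ} (hx : Function.Injective x) (hx0 : ∀ i, x i ∈ Set.Ioo 0 Real.pi)
    {e : κ → ℝ} (he : Function.Injective e) (he0 : ∀ i, e i = 0 ∨ e i = Real.pi)
    (hFx : ∀ i, F (x i) = 0) (hFx' : ∀ i, F (-(x i)) = 0) (hFe : ∀ i, F (e i) = 0)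
    (hne : ∃ z, F z ≠ 0) :
    σ = (-1) ^ d ∧ ε = (-1) ^ d * Complex.exp (Complex.I * ∑ i, (e i : ℂ)) ∧
    ∀ b ∈ Set.Ioo 0 Real.pi, (∀ i, b ≠ x i) → F b ≠ 0 := by
  let a : (Fin n ⊕ Fin n) ⊕ κ → ℝ := Sum.elim (Sum.elim x fun i => -x i) e
  have hcard : Fintype.card ((Fin n ⊕ Fin n) ⊕ κ) = d := by
    rw [hd, Fintype.card_sum, Fintype.card_sum, Fintype.card_fin]
  have hpi := Real.pi_pos
  have ha : Function.Injective a := by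
    refine Function.Injective.sumElim (Function.Injective.sumElim hx
      (fun i j h => hx (neg_injective h)) ?_) he ?_
    · intro i j h
      have := (hx0 i).1
      have := (hx0 j).1
      linarith
    · rintro (i | i) j <;> simp only [Sum.elim_inl, Sum.elim_inr] <;> intro h <;>
        have := (hx0 i).1 <;> have := (hx0 i).2 <;> rcases he0 j with h' | h' <;> linarith
  have hrange : ∀ i, -Real.pi < a i ∧ a i ≤ Real.pi := by
    rintro ((i | i) | i)
    · exact ⟨by have := (hx0 i).1; simp only [a, Sum.elim_inl]; linarith, (hx0 i).2.le⟩
    · have := (hx0 i).1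
      have := (hx0 i).2
      simp only [a, Sum.elim_inl, Sum.elim_inr]
      constructor <;> linarith
    · simp only [a, Sum.elim_inr]
      rcases he0 i with h | h <;> rw [h] <;> constructor <;> linarith
  have had : ∀ i j, |a i - a j| < 2 * Real.pi := by
    intro i j
    have := hrange i
    have := hrange j
    rw [abs_lt]
    constructor <;> linarith
  have hz : ∀ i, F (a i) = 0 := by
    rintro ((i | i) | i)
    · exact hFx i
    · simpa [a] using hFx' i
    · exact hFe i
  rw [← hcard] at h2
  obtain ⟨c1, c2, c3⟩ := constraints_of_real_zeros hT hF hσ hε h1 h2 a ha had hz hne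
  rw [hcard] at c1 c2
  refine ⟨c1, ?_, ?_⟩
  · have : ∑ i, (a i : ℂ) = ∑ i, (e i : ℂ) := by
      rw [Fintype.sum_sum_type, Fintype.sum_sum_type]
      simp [a]
    rw [this] at c2
    exact c2
  · intro b hb hbx
    refine c3 b ?_ ?_
    · rintro ((i | i) | i)
      · exact hbx i
      · intro h
        have h' : b = -x i := h
        have := (hx0 i).1
        have := hb.1
        linarith
      · intro h
        have h' : b = e i := h
        have := hb.1
        have := hb.2
        rcases he0 i with h'' | h'' <;> linarith
    · intro i
      have := hrange i
      have := hb.1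
      have := hb.2
      rw [abs_lt]
      constructor <;> linarith

theorem realMultiplier_eq (R : AffineType) {N : ℕ} (hN : 1 ≤ N) :
    realMultiplier R N = match R with
      | .A => -(-1) ^ N
      | .B => -1
      | .Bv => 1
      | .C => 1
      | .Cv => -1
      | .BC => -1
      | .D => 1 := by
  have key : ∀ k : ℤ, freq (R.degree N : ℝ) (R.J 1) 0 * 2 = k →
      realMultiplier R N = (-1) ^ k := by
    intro k hk
    rw [realMultiplier, ← Complex.exp_pi_mul_I, ← Complex.exp_int_mul]
    congr 1
    have : (freq (R.degree N : ℝ) (R.J 1) 0 : ℂ) * 2 = k := by exact_mod_cast hk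
    linear_combination Complex.I * Real.pi * this
  cases R
  case A =>
    rw [key (1 - N) (by simp only [freq, AffineType.degree, AffineType.J]; push_cast; ring)]
    rw [zpow_sub₀ (by norm_num), zpow_one, zpow_natCast, div_eq_mul_inv, ← inv_pow]
    norm_num
  case B =>
    rw [key (1 - 2 * N) (by
      simp only [freq, AffineType.degree, AffineType.J]
      rw [Nat.cast_sub (by omega)]; push_cast; ring)]
    exact Odd.neg_one_zpow ⟨-N, by ring⟩
  case Bv =>
    rw [key (2 * (-N)) (by simp only [freq, AffineType.degree, AffineType.J]; push_cast; ring)]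
    exact Even.neg_one_zpow ⟨-N, by ring⟩
  case C =>
    rw [key (2 * (-N)) (by simp only [freq, AffineType.degree, AffineType.J]; push_cast; ring)]
    exact Even.neg_one_zpow ⟨-N, by ring⟩
  case Cv =>
    rw [key (1 - 2 * N) (by simp only [freq, AffineType.degree, AffineType.J]; push_cast; ring)]
    exact Odd.neg_one_zpow ⟨-N, by ring⟩
  case BC =>
    rw [key (1 - 2 * N) (by simp only [freq, AffineType.degree, AffineType.J]; push_cast; ring)]
    exact Odd.neg_one_zpow ⟨-N, by ring⟩
  case D =>
    rw [key (2 * (1 - N)) (by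
      simp only [freq, AffineType.degree, AffineType.J]
      rw [Nat.cast_sub (by omega)]; push_cast; ring)]
    exact Even.neg_one_zpow ⟨1 - N, by ring⟩

/-- A function in the span of the `M^R_j` that vanishes at `N` distinct interior points of the
state space is identically zero. The zeros used, besides the given ones and their reflections, are
those that the symmetries force at `0` and `π`. In types `B`, `B^∨`, `D` the first `N - 1` points
already account for all zeros, and the last point is one too many; in the other types the
multipliers of a product of theta functions with these zeros are not those of `F`. -/
theorem eq_zero_of_zeros {R : AffineType} {N : ℕ} (hN : 1 ≤ N) (hD : R = AffineType.D → 2 ≤ N)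
    {s : ℝ} (hs : 0 < s) (v : Fin N → ℂ) {x : Fin N → ℝ} (hx : Function.Injective x)
    (hx0 : ∀ k, x k ∈ Set.Ioo 0 (stateLength R))
    (hzero : ∀ k, ∑ j : Fin N, v j * foldedWave R (R.degree N) (R.J ((j : ℕ) + 1)) s (x k) = 0)
    (z : ℂ) : ∑ j : Fin N, v j * foldedWave R (R.degree N) (R.J ((j : ℕ) + 1)) s z = 0 := by
  set F : ℂ → ℂ := fun z =>
    ∑ j : Fin N, v j * foldedWave R (R.degree N) (R.J ((j : ℕ) + 1)) s z with hFdef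
  have hd : 0 < (R.degree N : ℝ) := by
    have := R.le_degree hN hD
    exact_mod_cast (by omega : 0 < R.degree N)
  have hT : 0 < (R.degree N : ℝ) * s := mul_pos hd hs
  have hF : Differentiable ℂ F :=
    Differentiable.fun_sum fun j _ => (differentiable_foldedWave hd.ne' hs _).const_mul _
  have hσ := norm_realMultiplier R N
  have hε : ‖((-1 : ℂ) ^ R.twist)‖ = 1 := by simp
  have h1 : ∀ z, F (z + 2 * Real.pi) = realMultiplier R N * F z := by
    intro z
    simp only [hFdef, foldedWave_add_two_pi, Finset.mul_sum]
    exact Finset.sum_congr rfl fun j _ => by ring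
  have h2 : ∀ z, F (z + ((R.degree N : ℝ) * s : ℝ) * Complex.I) = (-1) ^ R.twist *
      Complex.exp (R.degree N * ((R.degree N : ℝ) * s : ℝ) / 2) *
      Complex.exp (-(Complex.I * R.degree N * z)) * F z := by
    intro z
    simp only [hFdef, foldedWave_add_mul_I, Finset.mul_sum]
    exact Finset.sum_congr rfl fun j _ => by push_cast; ring
  have hneg : R ≠ AffineType.A → ∀ z, F (-z) = R.reflSign * F z := by
    intro hR z
    simp only [hFdef, foldedWave_neg hR, Finset.mul_sum]
    exact Finset.sum_congr rfl fun j _ => by ring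
  have hzero' : R ≠ AffineType.A → ∀ k, F (-(x k)) = 0 := by
    intro hR k
    rw [hneg hR, show F (x k) = 0 from hzero k, mul_zero]
  have hF0 : R.reflSign = -1 → R ≠ AffineType.A → F (0 : ℝ) = 0 := by
    intro hr hR
    have := hneg hR 0
    rw [hr, neg_zero] at this
    rw [Complex.ofReal_zero]
    linear_combination this / 2
  have hFpi : R.reflSign = -1 → R ≠ AffineType.A → realMultiplier R N = 1 →
      F (Real.pi : ℝ) = 0 := by
    intro hr hR hm
    have e1 := hneg hR Real.pi
    have e2 := h1 (-Real.pi)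
    rw [hm, show -(Real.pi : ℂ) + 2 * Real.pi = Real.pi by ring, e1, hr] at e2
    linear_combination e2 / 2
  by_contra hz
  have hne : ∃ z, F z ≠ 0 := ⟨z, hz⟩
  have hmul := realMultiplier_eq R hN
  have hbool : Function.Injective (fun b : Bool => if b then Real.pi else 0) := by
    intro a b
    have := Real.pi_pos.ne
    cases a <;> cases b <;> simp [Real.pi_ne_zero, Real.pi_ne_zero.symm]
  have hbool0 : ∀ b : Bool, (fun b : Bool => if b then Real.pi else 0) b = 0 ∨
      (fun b : Bool => if b then Real.pi else 0) b = Real.pi := by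
    intro b; cases b <;> simp
  have hboolsum : Complex.exp (Complex.I *
      ∑ b : Bool, (((fun b : Bool => if b then Real.pi else 0) b : ℝ) : ℂ)) = -1 := by
    simp [mul_comm Complex.I]
  cases R
  case A =>
    have h2' : ∀ z, F (z + ((AffineType.A.degree N : ℝ) * s : ℝ) * Complex.I) =
        (-1) ^ AffineType.A.twist *
        Complex.exp (Fintype.card (Fin N) * ((AffineType.A.degree N : ℝ) * s : ℝ) / 2) *
        Complex.exp (-(Complex.I * Fintype.card (Fin N) * z)) * F z := by
      intro z
      have := h2 z
      rw [Fintype.card_fin]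
      exact this
    have := (constraints_of_real_zeros hT hF hσ hε h1 h2' x hx (fun i j => by
      have a1 := hx0 i
      have a2 := hx0 j
      simp only [stateLength, Set.mem_Ioo] at a1 a2
      rw [abs_lt]
      constructor <;> linarith) hzero hne).1
    rw [hmul, Fintype.card_fin] at this
    have h0 : ((-1 : ℂ)) ^ N ≠ 0 := by simp
    exact h0 (by linear_combination -this / 2)
  case B =>
    have hR : AffineType.B ≠ AffineType.A := by simp
    obtain ⟨n, rfl⟩ : ∃ n, N = n + 1 := ⟨N - 1, by omega⟩
    have := (constraints_of_reflected_zeros hT hF (n := n) (κ := Unit) (d := AffineType.B.degree _)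
      (by simp [AffineType.degree]; omega) hσ hε h1 h2 (x := x ∘ Fin.castSucc)
      (hx.comp (Fin.castSucc_injective n)) (fun i => hx0 _) (e := fun _ => 0)
      (fun _ _ _ => rfl) (fun _ => Or.inl rfl) (fun i => hzero _) (fun i => hzero' hR _)
      (fun _ => hF0 rfl hR) hne).2.2 (x (Fin.last n)) (hx0 _)
      (fun i h => (Fin.castSucc_lt_last i).ne' (hx h))
    exact this (hzero _)
  case Bv =>
    have hR : AffineType.Bv ≠ AffineType.A := by simp
    obtain ⟨n, rfl⟩ : ∃ n, N = n + 1 := ⟨N - 1, by omega⟩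
    have := (constraints_of_reflected_zeros hT hF (n := n) (κ := Bool)
      (d := AffineType.Bv.degree _)
      (by simp [AffineType.degree]; omega) hσ hε h1 h2 (x := x ∘ Fin.castSucc)
      (hx.comp (Fin.castSucc_injective n)) (fun i => hx0 _)
      hbool hbool0 (fun i => hzero _) (fun i => hzero' hR _)
      (fun b => by cases b; exacts [hF0 rfl hR, hFpi rfl hR hmul]) hne).2.2 (x (Fin.last n)) (hx0 _)
      (fun i h => (Fin.castSucc_lt_last i).ne' (hx h))
    exact this (hzero _)
  case C =>
    have hR : AffineType.C ≠ AffineType.A := by simp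
    have := (constraints_of_reflected_zeros hT hF (n := N) (κ := Bool)
      (d := AffineType.C.degree _)
      (by simp [AffineType.degree]; omega) hσ hε h1 h2 hx hx0
      hbool hbool0 (fun i => hzero _) (fun i => hzero' hR _)
      (fun b => by cases b; exacts [hF0 rfl hR, hFpi rfl hR hmul]) hne).2.1
    have hpar : (-1 : ℂ) ^ AffineType.C.degree N = 1 :=
      Even.neg_one_pow ⟨N + 1, by simp only [AffineType.degree]; ring⟩
    rw [hboolsum, hpar] at this
    norm_num [AffineType.twist] at this
  case Cv =>
    have hR : AffineType.Cv ≠ AffineType.A := by simp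
    have := (constraints_of_reflected_zeros hT hF (n := N) (κ := Empty)
      (d := AffineType.Cv.degree _)
      (by simp [AffineType.degree]; omega) hσ hε h1 h2 hx hx0 (e := fun e => e.elim)
      (fun e => e.elim) (fun e => e.elim) (fun i => hzero _) (fun i => hzero' hR _)
      (fun e => e.elim) hne).1
    have hpar : (-1 : ℂ) ^ AffineType.Cv.degree N = 1 :=
      Even.neg_one_pow ⟨N, by simp only [AffineType.degree]; ring⟩
    rw [hmul, hpar] at this
    norm_num at this
  case BC =>
    have hR : AffineType.BC ≠ AffineType.A := by simp
    have := (constraints_of_reflected_zeros hT hF (n := N) (κ := Unit)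
      (d := AffineType.BC.degree _)
      (by simp [AffineType.degree]; omega) hσ hε h1 h2 hx hx0 (e := fun _ => 0)
      (fun _ _ _ => rfl) (fun _ => Or.inl rfl) (fun i => hzero _) (fun i => hzero' hR _)
      (fun _ => hF0 rfl hR) hne).2.1
    have hpar : (-1 : ℂ) ^ AffineType.BC.degree N = -1 :=
      Odd.neg_one_pow ⟨N, by simp only [AffineType.degree]⟩
    rw [hpar] at this
    norm_num [AffineType.twist] at this
  case D =>
    have hR : AffineType.D ≠ AffineType.A := by simp
    obtain ⟨n, rfl⟩ : ∃ n, N = n + 1 := ⟨N - 1, by omega⟩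
    have := (constraints_of_reflected_zeros hT hF (n := n) (κ := Empty)
      (d := AffineType.D.degree _)
      (by simp [AffineType.degree]; omega) hσ hε h1 h2 (x := x ∘ Fin.castSucc)
      (hx.comp (Fin.castSucc_injective n)) (fun i => hx0 _) (e := fun e => e.elim)
      (fun e => e.elim) (fun e => e.elim) (fun i => hzero _) (fun i => hzero' hR _)
      (fun e => e.elim) hne).2.2 (x (Fin.last n)) (hx0 _)
      (fun i h => (Fin.castSucc_lt_last i).ne' (hx h))
    exact this (hzero _)

/-! ### Sign of the density -/

/-- The determinant `det[M^R_j(x_k, s)]`. -/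
noncomputable def detM (R : AffineType) (N : ℕ) (r s : ℝ) (x : Fin N → ℝ) : ℂ :=
  (Matrix.of fun j k : Fin N => M R N r ((j : ℕ) + 1) (x k) s).det

theorem q_eq_detM (R : AffineType) (N : ℕ) (r tstar t : ℝ) (x : Fin N → ℝ) :
    q R N r tstar t x = (starRingEnd ℂ) (detM R N r (tstar - t) x) * detM R N r t x := by
  rw [q, detM, detM, RingHom.map_det]
  rfl

theorem continuous_M {R : AffineType} {N : ℕ} (hc : R.curlyN N ≠ 0) {r s : ℝ} (hr : 0 < r)
    (hs : 0 < s) (j : ℕ) : Continuous fun x => M R N r j x s := by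
  have hs' : 0 < s / r ^ 2 := by positivity
  simp_rw [M_eq_foldedWave R hc hr.ne']
  have h : Continuous fun x : ℝ =>
      foldedWave R (R.curlyN N) (R.J j) (s / r ^ 2) ((x / r : ℝ) : ℂ) :=
    (differentiable_foldedWave hc hs' (R.J j)).continuous.comp (by fun_prop)
  fun_prop

theorem continuousOn_M_time {R : AffineType} {N : ℕ} (hc : R.curlyN N ≠ 0) {r : ℝ} (hr : 0 < r)
    (j : ℕ) (x : ℝ) : ContinuousOn (fun s => M R N r j x s) (Set.Ioi 0) := by
  simp_rw [M_eq_foldedWave R hc hr.ne']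
  have hmap : Set.MapsTo (fun s : ℝ => s / r ^ 2) (Set.Ioi 0) (Set.Ioi 0) := by
    intro s hs
    exact div_pos hs (pow_pos hr 2)
  have h : ∀ z : ℂ, ContinuousOn (fun s : ℝ =>
      wave R.twist (R.curlyN N) (R.J j) (s / r ^ 2) z) (Set.Ioi 0) := fun z =>
    (continuousOn_wave_time hc R.twist (R.J j) z).comp (by fun_prop) hmap
  refine ContinuousOn.mul (by fun_prop) (continuousOn_const.mul ?_)
  exact (h _).add (continuousOn_const.mul (h _))

theorem continuous_detM {R : AffineType} {N : ℕ} (hc : R.curlyN N ≠ 0) {r s : ℝ} (hr : 0 < r)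
    (hs : 0 < s) : Continuous (detM R N r s) := by
  unfold detM
  refine Continuous.matrix_det (continuous_matrix fun j k => ?_)
  exact (continuous_M hc hr hs _).comp (continuous_apply k)

theorem continuousOn_detM_time {R : AffineType} {N : ℕ} (hc : R.curlyN N ≠ 0) {r : ℝ} (hr : 0 < r)
    (x : Fin N → ℝ) : ContinuousOn (fun s => detM R N r s x) (Set.Ioi 0) := by
  have h : ∀ s, detM R N r s x = ∑ σ : Equiv.Perm (Fin N), (Equiv.Perm.sign σ : ℂ) *
      ∏ k, M R N r ((σ k : ℕ) + 1) (x k) s := by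
    intro s
    rw [detM, Matrix.det_apply']
    rfl
  simp_rw [h]
  refine continuousOn_finsetSum _ fun σ _ => continuousOn_const.mul ?_
  exact continuousOn_finsetProd _ fun k _ => continuousOn_M_time hc hr _ _

theorem measurableSet_stateSpace (R : AffineType) (r : ℝ) : MeasurableSet (R.stateSpace r) := by
  cases R <;> simp [AffineType.stateSpace]

theorem isBounded_stateSpace (R : AffineType) (r : ℝ) : Bornology.IsBounded (R.stateSpace r) := by
  cases R <;> simp [AffineType.stateSpace, Metric.isBounded_Icc, Metric.isBounded_Ico]

/-- The functions `M^R_1, …, M^R_N` form a Chebyshev system on the interior of the state space. -/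
theorem detM_ne_zero {R : AffineType} {N : ℕ} (hN : 1 ≤ N) (hD : R = AffineType.D → 2 ≤ N)
    {r s : ℝ} (hr : 0 < r) (hs : 0 < s) {x : Fin N → ℝ} (hx : Function.Injective x)
    (hx0 : ∀ k, x k ∈ Set.Ioo 0 (stateLength R * r)) : detM R N r s x ≠ 0 := by
  have hdeg := R.curlyN_eq_degree hN
  have hd : R.curlyN N ≠ 0 := by
    rw [hdeg]
    have := R.le_degree hN hD
    exact_mod_cast (by omega : R.degree N ≠ 0)
  intro hdet
  obtain ⟨v, hv0, hv⟩ := Matrix.exists_vecMul_eq_zero_iff.2 hdet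
  have hs' : 0 < s / r ^ 2 := by positivity
  let w : Fin N → ℂ := fun j => v j * (Complex.exp ((s / r ^ 2 : ℝ) * R.J ((j : ℕ) + 1) ^ 2 / 2) *
    R.phase)
  have hsum : ∀ x : ℝ, ∑ j : Fin N, v j * M R N r ((j : ℕ) + 1) x s =
      ∑ j : Fin N, w j * foldedWave R (R.degree N) (R.J ((j : ℕ) + 1)) (s / r ^ 2)
        ((x / r : ℝ) : ℂ) := by
    intro x
    refine Finset.sum_congr rfl fun j _ => ?_
    rw [M_eq_foldedWave R hd hr.ne', hdeg]
    ring
  have hall := eq_zero_of_zeros hN hD hs' w (x := fun k => x k / r)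
    (fun i j h => hx (by simpa [hr.ne'] using h))
    (fun k => ⟨div_pos (hx0 k).1 hr, by rw [div_lt_iff₀ hr]; exact (hx0 k).2⟩)
    (fun k => by
      rw [← hsum]
      exact congrFun hv k)
  -- The coefficients are recovered from the function by biorthogonality.
  refine hv0 (funext fun i => ?_)
  have h0 : ∫ x in R.stateSpace r, (starRingEnd ℂ) (M R N r ((i : ℕ) + 1) x s) *
      ∑ j : Fin N, v j * M R N r ((j : ℕ) + 1) x s = 0 := by
    simp_rw [hsum, hall]
    simp
  have h1 : ∫ x in R.stateSpace r, (starRingEnd ℂ) (M R N r ((i : ℕ) + 1) x s) *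
      ∑ j : Fin N, v j * M R N r ((j : ℕ) + 1) x s = v i * m R N r (s + s) ((i : ℕ) + 1) := by
    simp_rw [Finset.mul_sum]
    have hcont := fun j => continuous_M hd hr hs j
    rw [integral_finsetSum]
    · have : ∀ j : Fin N, ∫ x in R.stateSpace r, (starRingEnd ℂ) (M R N r ((i : ℕ) + 1) x s) *
          (v j * M R N r ((j : ℕ) + 1) x s) =
          if i = j then v j * m R N r (s + s) ((i : ℕ) + 1) else 0 := by
        intro j
        simp_rw [mul_left_comm _ (v j)]
        rw [integral_const_mul, integral_conj_M_mul_M (j := (i : ℕ) + 1) (l := (j : ℕ) + 1) hN hD hr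
          hs hs (by omega) (by omega) (by omega) (by omega)]
        by_cases hij : i = j
        · simp [hij]
        · have : ¬ ((i : ℕ) + 1 = (j : ℕ) + 1) := fun h => hij (Fin.ext (by omega))
          rw [if_neg this, if_neg hij, mul_zero]
      simp_rw [this]
      simp
    · intro j _
      refine integrableOn_of_continuous_of_isBounded (isBounded_stateSpace R r) ?_
      exact (Complex.continuous_conj.comp (hcont _)).mul (continuous_const.mul (hcont _))
  rw [h1] at h0
  obtain ⟨a, ha, hma⟩ := m_eq_ofReal_pos hd hr (add_pos hs hs) ((i : ℕ) + 1)
  rw [hma] at h0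
  exact (mul_eq_zero.1 h0).resolve_right (by exact_mod_cast ha.ne')

/-- Complex conjugation multiplies the `M^R_j` by a common sign or, in type `A`, permutes them by
`j ↦ N + 1 - j` up to factors of product one. So the determinant is real or purely imaginary, at all
times simultaneously. -/
theorem exists_conj_detM (R : AffineType) {N : ℕ} (hN : 1 ≤ N) (hD : R = AffineType.D → 2 ≤ N)
    {r : ℝ} (hr : 0 < r) (x : Fin N → ℝ) :
    ∃ η : ℂ, η * η = 1 ∧ ∀ s, (starRingEnd ℂ) (detM R N r s x) = η * detM R N r s x := by
  have hdeg := R.curlyN_eq_degree hN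
  have hd : R.curlyN N ≠ 0 := by
    rw [hdeg]
    have := R.le_degree hN hD
    exact_mod_cast (by omega : R.degree N ≠ 0)
  have hce : ∀ a b : ℝ, (starRingEnd ℂ) (Complex.exp ((a : ℂ) * (b : ℂ) ^ 2 / 2)) =
      Complex.exp ((a : ℂ) * (b : ℂ) ^ 2 / 2) := by
    intro a b
    rw [← Complex.exp_conj]
    simp [map_ofNat]
  have hconj : ∀ s, (starRingEnd ℂ) (detM R N r s x) =
      (Matrix.of fun j k : Fin N => (starRingEnd ℂ) (M R N r ((j : ℕ) + 1) (x k) s)).det := by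
    intro s
    rw [detM, RingHom.map_det]
    rfl
  by_cases hR : R = AffineType.A
  · subst hR
    refine ⟨(Equiv.Perm.sign (Fin.revPerm : Equiv.Perm (Fin N)) : ℂ), ?_, fun s => ?_⟩
    · have := Int.units_mul_self (Equiv.Perm.sign (Fin.revPerm : Equiv.Perm (Fin N)))
      rw [← Int.cast_mul, ← Units.val_mul, this]
      simp
    · let g : Fin N → ℂ := fun j =>
        Complex.exp ((s / r ^ 2 : ℝ) * AffineType.A.J ((j : ℕ) + 1) ^ 2 / 2)
      have hg : ∏ j, (g j / g (Fin.rev j)) = 1 := by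
        rw [Finset.prod_div_distrib]
        have : ∏ j : Fin N, g (Fin.rev j) = ∏ j, g j := Equiv.prod_comp Fin.revPerm g
        rw [this]
        exact div_self (Finset.prod_ne_zero_iff.2 fun j _ => Complex.exp_ne_zero _)
      have hentry : ∀ j k : Fin N, (starRingEnd ℂ) (M .A N r ((j : ℕ) + 1) (x k) s) =
          (g j / g (Fin.rev j)) * M .A N r ((Fin.rev j : ℕ) + 1) (x k) s := by
        intro j k
        rw [M_eq_foldedWave _ hd hr.ne', M_eq_foldedWave _ hd hr.ne', map_mul, map_mul, hce,
          conj_foldedWave]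
        have hJ : AffineType.A.curlyN N - AffineType.A.J ((j : ℕ) + 1) =
            AffineType.A.J ((Fin.rev j : ℕ) + 1) := by
          simp only [AffineType.curlyN, AffineType.J, Fin.val_rev]
          rw [Nat.cast_add ((N - ((j : ℕ) + 1))), Nat.cast_sub (by omega)]
          push_cast
          ring
        have hw : foldedWave .A (AffineType.A.curlyN N) (AffineType.A.J ((j : ℕ) + 1)) (s / r ^ 2)
            (-((x k / r : ℝ) : ℂ)) = foldedWave .A (AffineType.A.curlyN N)
              (AffineType.A.J ((Fin.rev j : ℕ) + 1)) (s / r ^ 2) ((x k / r : ℝ) : ℂ) := by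
          simp only [foldedWave, AffineType.reflSign, zero_mul, add_zero]
          rw [wave_neg_eq_sub, hJ]
        rw [hw]
        simp only [AffineType.phase, map_one, g]
        field_simp [Complex.exp_ne_zero]
      rw [hconj]
      simp_rw [hentry]
      have h1 := Matrix.det_mul_column (fun j => g j / g (Fin.rev j))
        (Matrix.of fun j k : Fin N => M .A N r ((Fin.rev j : ℕ) + 1) (x k) s)
      rw [hg, one_mul] at h1
      refine h1.trans ?_
      exact Matrix.det_permute (Fin.revPerm : Equiv.Perm (Fin N))
        (Matrix.of fun j k : Fin N => M .A N r ((j : ℕ) + 1) (x k) s)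
  · obtain ⟨ζ, hζ, hζu⟩ : ∃ ζ : ℂ, ζ * ζ = 1 ∧
        (starRingEnd ℂ) R.phase * R.reflSign = ζ * R.phase := by
      cases R
      case A => exact absurd rfl hR
      case B => exact ⟨1, by norm_num, by simp [AffineType.phase, AffineType.reflSign]⟩
      case Bv => exact ⟨1, by norm_num, by simp [AffineType.phase, AffineType.reflSign]⟩
      case C => exact ⟨-1, by norm_num, by simp [AffineType.phase, AffineType.reflSign]⟩
      case Cv => exact ⟨-1, by norm_num, by simp [AffineType.phase, AffineType.reflSign]⟩
      case BC => exact ⟨-1, by norm_num, by simp [AffineType.phase, AffineType.reflSign]⟩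
      case D => exact ⟨1, by norm_num, by simp [AffineType.phase, AffineType.reflSign]⟩
    refine ⟨ζ ^ N, by rw [← mul_pow, hζ, one_pow], fun s => ?_⟩
    have hentry : ∀ j k : Fin N, (starRingEnd ℂ) (M R N r ((j : ℕ) + 1) (x k) s) =
        ζ * M R N r ((j : ℕ) + 1) (x k) s := by
      intro j k
      rw [M_eq_foldedWave _ hd hr.ne', map_mul, map_mul, hce, conj_foldedWave, foldedWave_neg hR]
      linear_combination Complex.exp ((s / r ^ 2 : ℝ) * R.J ((j : ℕ) + 1) ^ 2 / 2) *
        foldedWave R (R.curlyN N) (R.J ((j : ℕ) + 1)) (s / r ^ 2) ((x k / r : ℝ) : ℂ) * hζu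
    rw [hconj]
    simp_rw [hentry]
    have h1 := Matrix.det_smul (Matrix.of fun j k : Fin N => M R N r ((j : ℕ) + 1) (x k) s) ζ
    rw [Fintype.card_fin] at h1
    exact h1

theorem im_conj_detM_mul_detM (R : AffineType) {N : ℕ} (hN : 1 ≤ N)
    (hD : R = AffineType.D → 2 ≤ N) {r : ℝ} (hr : 0 < r) (s t : ℝ) (x : Fin N → ℝ) :
    ((starRingEnd ℂ) (detM R N r s x) * detM R N r t x).im = 0 := by
  obtain ⟨η, hη, h⟩ := exists_conj_detM R hN hD hr x
  rw [← Complex.conj_eq_iff_im, map_mul, Complex.conj_conj, h t, h s]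
  ring_nf

/-- On the interior of the state space the determinants at two times have the same phase: the
product below is real, does not vanish, is continuous in `s`, and is positive for `s = t`. -/
theorem re_conj_detM_mul_detM_pos {R : AffineType} {N : ℕ} (hN : 1 ≤ N)
    (hD : R = AffineType.D → 2 ≤ N) {r s t : ℝ} (hr : 0 < r) (hs : 0 < s) (ht : 0 < t)
    {x : Fin N → ℝ} (hx : Function.Injective x)
    (hx0 : ∀ k, x k ∈ Set.Ioo 0 (stateLength R * r)) :
    0 < ((starRingEnd ℂ) (detM R N r s x) * detM R N r t x).re := by
  have hd : R.curlyN N ≠ 0 := by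
    rw [R.curlyN_eq_degree hN]
    have := R.le_degree hN hD
    exact_mod_cast (by omega : R.degree N ≠ 0)
  let f : ℝ → ℝ := fun s => ((starRingEnd ℂ) (detM R N r s x) * detM R N r t x).re
  have hf : ContinuousOn f (Set.Ioi 0) :=
    Complex.continuous_re.comp_continuousOn ((Complex.continuous_conj.comp_continuousOn
      (continuousOn_detM_time hd hr x)).mul continuousOn_const)
  have hne : ∀ s ∈ Set.Ioi (0 : ℝ), f s ≠ 0 := by
    intro s hs h0
    have hz : (starRingEnd ℂ) (detM R N r s x) * detM R N r t x = 0 :=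
      Complex.ext h0 (im_conj_detM_mul_detM R hN hD hr s t x)
    rcases mul_eq_zero.1 hz with h | h
    · exact detM_ne_zero hN hD hr hs hx hx0 ((map_eq_zero _).1 h)
    · exact detM_ne_zero hN hD hr ht hx hx0 h
  have hft : 0 < f t := by
    have h0 : 0 ≤ f t := by
      simp only [f]
      rw [mul_comm, Complex.mul_conj, Complex.ofReal_re]
      exact Complex.normSq_nonneg _
    exact lt_of_le_of_ne h0 (hne t ht).symm
  by_contra hle
  obtain ⟨u, hu, hu0⟩ := isPreconnected_Ioi.intermediate_value hs ht hf
    ⟨not_lt.1 hle, hft.le⟩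
  exact hne u hu hu0

theorem mem_Icc_of_mem_stateSpace {R : AffineType} {r x : ℝ} (hx : x ∈ R.stateSpace r) :
    x ∈ Set.Icc 0 (stateLength R * r) := by
  cases R
  case A => exact ⟨hx.1, hx.2.le⟩
  all_goals exact hx

theorem re_conj_detM_mul_detM_nonneg {R : AffineType} {N : ℕ} (hN : 1 ≤ N)
    (hD : R = AffineType.D → 2 ≤ N) {r s t : ℝ} (hr : 0 < r) (hs : 0 < s) (ht : 0 < t)
    {x : Fin N → ℝ} (hx0 : x ∈ power (R.stateSpace r) N) :
    0 ≤ ((starRingEnd ℂ) (detM R N r s x) * detM R N r t x).re := by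
  have hd : R.curlyN N ≠ 0 := by
    rw [R.curlyN_eq_degree hN]
    have := R.le_degree hN hD
    exact_mod_cast (by omega : R.degree N ≠ 0)
  by_cases hx : Function.Injective x
  · -- Contract the configuration towards the midpoint of the state space.
    let L := stateLength R * r
    have hL : 0 < L := mul_pos (stateLength_pos R) hr
    let y : ℝ → Fin N → ℝ := fun u k => (1 - u) * x k + u * (L / 2)
    have hy : Continuous y := by
      refine continuous_pi fun k => ?_
      fun_prop
    have hy0 : y 0 = x := by
      funext k
      simp [y]
    let f : ℝ → ℝ := fun u =>
      ((starRingEnd ℂ) (detM R N r s (y u)) * detM R N r t (y u)).re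
    have hf : Continuous f :=
      Complex.continuous_re.comp ((Complex.continuous_conj.comp
        ((continuous_detM hd hr hs).comp hy)).mul ((continuous_detM hd hr ht).comp hy))
    have hpos : ∀ u ∈ Set.Ioo (0 : ℝ) 1, 0 ≤ f u := by
      intro u hu
      have hu0 := hu.1
      have hu1 := sub_pos.2 hu.2
      refine (re_conj_detM_mul_detM_pos hN hD hr hs ht ?_ fun k => ?_).le
      · intro i j hij
        refine hx (mul_left_cancel₀ hu1.ne' ?_)
        simpa [y] using hij
      · have hk := mem_Icc_of_mem_stateSpace (hx0 k trivial)
        have e1 : 0 ≤ (1 - u) * x k := mul_nonneg hu1.le hk.1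
        have e2 : (1 - u) * x k ≤ (1 - u) * L := mul_le_mul_of_nonneg_left hk.2 hu1.le
        have e3 : 0 < u * L := mul_pos hu0 hL
        show 0 < (1 - u) * x k + u * (L / 2) ∧ (1 - u) * x k + u * (L / 2) < L
        constructor <;> nlinarith
    have hlim : Filter.Tendsto f (nhdsWithin 0 (Set.Ioi 0)) (nhds (f 0)) :=
      hf.continuousAt.tendsto.mono_left nhdsWithin_le_nhds
    have h0 : 0 ≤ f 0 := by
      refine ge_of_tendsto hlim ?_
      filter_upwards [Ioo_mem_nhdsGT (zero_lt_one' ℝ)] with u hu using hpos u hu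
    simpa [f, hy0] using h0
  · obtain ⟨i, j, hij, hne⟩ : ∃ i j, x i = x j ∧ i ≠ j := by
      simpa [Function.Injective] using hx
    have : detM R N r t x = 0 :=
      Matrix.det_zero_of_column_eq hne fun k => by simp [hij]
    rw [this, mul_zero, Complex.zero_re]

/-! ### The correlation kernel -/

theorem Icc_one_eq_image (N : ℕ) :
    Finset.Icc 1 N = Finset.univ.image fun i : Fin N => (i : ℕ) + 1 := by
  ext n
  simp only [Finset.mem_Icc, Finset.mem_image, Finset.mem_univ, true_and]
  constructor
  · rintro ⟨h1, h2⟩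
    exact ⟨⟨n - 1, by omega⟩, by simp only; omega⟩
  · rintro ⟨i, rfl⟩
    omega

theorem sum_Icc_one_eq {N : ℕ} (f : ℕ → ℂ) :
    ∑ n ∈ Finset.Icc 1 N, f n = ∑ i : Fin N, f ((i : ℕ) + 1) := by
  rw [Icc_one_eq_image, Finset.sum_image fun i _ j _ h => Fin.ext (by simpa using h)]

theorem prod_Icc_one_eq {N : ℕ} (f : ℕ → ℂ) :
    ∏ n ∈ Finset.Icc 1 N, f n = ∏ i : Fin N, f ((i : ℕ) + 1) := by
  rw [Icc_one_eq_image, Finset.prod_image fun i _ j _ h => Fin.ext (by simpa using h)]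

/-- The normalized weight is the determinant of the kernel, by multiplicativity of `det`. -/
theorem weight_eq_kernelDet (R : AffineType) (N : ℕ) (r tstar t : ℝ) (x : Fin N → ℝ) :
    weight R N r tstar t x = kernelDet (kernel R N r tstar t) x := by
  let Φ : Matrix (Fin N) (Fin N) ℂ := Matrix.of fun j k : Fin N =>
    (starRingEnd ℂ) (M R N r ((j : ℕ) + 1) (x k) (tstar - t))
  let Ψ : Matrix (Fin N) (Fin N) ℂ := Matrix.of fun j k : Fin N => M R N r ((j : ℕ) + 1) (x k) t
  have h : (Matrix.of fun j k : Fin N => kernel R N r tstar t (x j) (x k)) =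
      Ψ.transpose * (Matrix.diagonal fun i : Fin N => 1 / m R N r tstar ((i : ℕ) + 1)) * Φ := by
    ext j k
    rw [Matrix.mul_apply]
    simp only [Matrix.mul_diagonal, Matrix.of_apply, kernel, sum_Icc_one_eq]
    refine Finset.sum_congr rfl fun i _ => ?_
    simp only [Φ, Ψ, Matrix.transpose_apply, Matrix.of_apply]
    ring
  rw [kernelDet, h, Matrix.det_mul, Matrix.det_mul, Matrix.det_transpose, Matrix.det_diagonal,
    weight, q, prod_Icc_one_eq, Finset.prod_div_distrib, Finset.prod_const_one]
  simp only [Φ, Ψ]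
  ring

theorem continuous_kernel {R : AffineType} {N : ℕ} (hc : R.curlyN N ≠ 0) {r tstar t : ℝ}
    (hr : 0 < r) (ht : 0 < t) (htstar : t < tstar) :
    Continuous (Function.uncurry (kernel R N r tstar t)) := by
  have h1 := fun n => continuous_M hc hr ht n
  have h2 := fun n => Complex.continuous_conj.comp (continuous_M hc hr (sub_pos.2 htstar) n)
  have h3 : Continuous fun z : ℝ × ℝ => ∑ n ∈ Finset.Icc 1 N, 1 / m R N r tstar n *
      M R N r n z.1 t * (starRingEnd ℂ) (M R N r n z.2 (tstar - t)) :=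
    continuous_finsetSum _ fun n _ =>
      (continuous_const.mul ((h1 n).comp continuous_fst)).mul ((h2 n).comp continuous_snd)
  exact h3

theorem integral_conj_M_mul_M_complement {R : AffineType} {N : ℕ} (hN : 1 ≤ N)
    (hD : R = AffineType.D → 2 ≤ N) {r tstar t : ℝ} (hr : 0 < r) (ht : 0 < t) (htstar : t < tstar)
    {n l : ℕ} (hn : n ∈ Finset.Icc 1 N) (hl : l ∈ Finset.Icc 1 N) :
    ∫ y in R.stateSpace r, (starRingEnd ℂ) (M R N r n y (tstar - t)) * M R N r l y t =
      if n = l then m R N r tstar n else 0 := by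
  rw [Finset.mem_Icc] at hn hl
  have := integral_conj_M_mul_M hN hD hr (sub_pos.2 htstar) ht hn.1 hn.2 hl.1 hl.2
  rwa [sub_add_cancel] at this

/-- The kernel is a projection: `∫ K(x, y) K(y, z) dy = K(x, z)`. -/
theorem integral_kernel_mul_kernel {R : AffineType} {N : ℕ} (hN : 1 ≤ N)
    (hD : R = AffineType.D → 2 ≤ N) {r tstar t : ℝ} (hr : 0 < r) (ht : 0 < t) (htstar : t < tstar)
    (x z : ℝ) :
    ∫ y in R.stateSpace r, kernel R N r tstar t x y * kernel R N r tstar t y z =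
      kernel R N r tstar t x z := by
  have hd : R.curlyN N ≠ 0 := by
    rw [R.curlyN_eq_degree hN]
    have := R.le_degree hN hD
    exact_mod_cast (by omega : R.degree N ≠ 0)
  have h1 : ∀ y, kernel R N r tstar t x y * kernel R N r tstar t y z =
      ∑ n ∈ Finset.Icc 1 N, ∑ l ∈ Finset.Icc 1 N,
        (1 / m R N r tstar n * M R N r n x t) *
          (1 / m R N r tstar l * (starRingEnd ℂ) (M R N r l z (tstar - t))) *
        ((starRingEnd ℂ) (M R N r n y (tstar - t)) * M R N r l y t) := by
    intro y
    rw [kernel, kernel, Finset.sum_mul_sum]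
    exact Finset.sum_congr rfl fun n _ => Finset.sum_congr rfl fun l _ => by ring
  have hint : ∀ n l, IntegrableOn (fun y => (1 / m R N r tstar n * M R N r n x t) *
          (1 / m R N r tstar l * (starRingEnd ℂ) (M R N r l z (tstar - t))) *
        ((starRingEnd ℂ) (M R N r n y (tstar - t)) * M R N r l y t)) (R.stateSpace r) := by
    intro n l
    refine integrableOn_of_continuous_of_isBounded (isBounded_stateSpace R r) ?_
    exact continuous_const.mul ((Complex.continuous_conj.comp
      (continuous_M hd hr (sub_pos.2 htstar) n)).mul (continuous_M hd hr ht l))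
  simp_rw [h1]
  rw [integral_finsetSum _ fun n _ => integrable_finsetSum _ fun l _ => hint n l, kernel]
  refine Finset.sum_congr rfl fun n hn => ?_
  rw [integral_finsetSum _ fun l _ => hint n l, Finset.sum_eq_single_of_mem n hn]
  · rw [integral_const_mul, integral_conj_M_mul_M_complement hN hD hr ht htstar hn hn, if_pos rfl]
    obtain ⟨a, ha, hma⟩ := m_eq_ofReal_pos hd hr (ht.trans htstar) n
    have ha' : (a : ℂ) ≠ 0 := by exact_mod_cast ha.ne'
    rw [hma]
    field_simp
  · intro l hl hln
    rw [integral_const_mul, integral_conj_M_mul_M_complement hN hD hr ht htstar hn hl,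
      if_neg hln.symm, mul_zero]

theorem integral_kernel_diag {R : AffineType} {N : ℕ} (hN : 1 ≤ N)
    (hD : R = AffineType.D → 2 ≤ N) {r tstar t : ℝ} (hr : 0 < r) (ht : 0 < t)
    (htstar : t < tstar) :
    ∫ y in R.stateSpace r, kernel R N r tstar t y y = N := by
  have hd : R.curlyN N ≠ 0 := by
    rw [R.curlyN_eq_degree hN]
    have := R.le_degree hN hD
    exact_mod_cast (by omega : R.degree N ≠ 0)
  have h1 : ∀ y, kernel R N r tstar t y y = ∑ n ∈ Finset.Icc 1 N, 1 / m R N r tstar n *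
        ((starRingEnd ℂ) (M R N r n y (tstar - t)) * M R N r n y t) := fun y =>
    Finset.sum_congr rfl fun n _ => by ring
  simp_rw [h1]
  rw [integral_finsetSum]
  · have h2 : ∀ n ∈ Finset.Icc 1 N, ∫ y in R.stateSpace r, 1 / m R N r tstar n *
        ((starRingEnd ℂ) (M R N r n y (tstar - t)) * M R N r n y t) = 1 := by
      intro n hn
      rw [integral_const_mul, integral_conj_M_mul_M_complement hN hD hr ht htstar hn hn,
        if_pos rfl]
      obtain ⟨a, ha, hma⟩ := m_eq_ofReal_pos hd hr (ht.trans htstar) n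
      have ha' : (a : ℂ) ≠ 0 := by exact_mod_cast ha.ne'
      rw [hma]
      field_simp
    rw [Finset.sum_congr rfl h2]
    simp
  · intro n _
    refine integrableOn_of_continuous_of_isBounded (isBounded_stateSpace R r) ?_
    exact continuous_const.mul ((Complex.continuous_conj.comp
      (continuous_M hd hr (sub_pos.2 htstar) n)).mul (continuous_M hd hr ht n))

theorem theorem3p4 (R : EllipticDPP.AffineType) (N : ℕ) (hN : 1 ≤ N)
    (hD : R = EllipticDPP.AffineType.D → 2 ≤ N)
    (r tstar t : ℝ) (hr : 0 < r) (ht : 0 < t) (htstar : t < tstar) :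
    (∀ n ∈ Finset.Icc 1 N,
      (EllipticDPP.m R N r tstar n).im = 0 ∧ 0 < (EllipticDPP.m R N r tstar n).re) ∧
    (∀ x ∈ EllipticDPP.power (R.stateSpace r) N,
      (EllipticDPP.density R N r tstar t x : ℂ) = EllipticDPP.weight R N r tstar t x) ∧
    EllipticDPP.DefinesPointProcess (R.stateSpace r) (EllipticDPP.density R N r tstar t) ∧
    EllipticDPP.IsDeterminantal (R.stateSpace r) (EllipticDPP.density R N r tstar t)
      (EllipticDPP.kernel R N r tstar t) := by
  have hd : R.curlyN N ≠ 0 := by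
    rw [R.curlyN_eq_degree hN]
    have := R.le_degree hN hD
    exact_mod_cast (by omega : R.degree N ≠ 0)
  have hm := fun n => m_eq_ofReal_pos (R := R) (N := N) hd hr (ht.trans htstar) n
  choose a ha hma using hm
  have hweight : ∀ x, weight R N r tstar t x =
      ((starRingEnd ℂ) (detM R N r (tstar - t) x) * detM R N r t x) *
        (((∏ n ∈ Finset.Icc 1 N, a n)⁻¹ : ℝ) : ℂ) := by
    intro x
    rw [weight, q_eq_detM]
    simp_rw [hma]
    push_cast
    rfl
  have hreal : ∀ x, (density R N r tstar t x : ℂ) = weight R N r tstar t x := by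
    intro x
    refine Complex.ext rfl ?_
    rw [Complex.ofReal_im, hweight, Complex.im_mul_ofReal,
      im_conj_detM_mul_detM R hN hD hr, zero_mul]
  have hpos : ∀ x ∈ power (R.stateSpace r) N, 0 ≤ density R N r tstar t x := by
    intro x hx
    rw [density, hweight, Complex.re_mul_ofReal]
    exact mul_nonneg (re_conj_detM_mul_detM_nonneg hN hD hr (sub_pos.2 htstar) ht hx)
      (inv_nonneg.2 (Finset.prod_nonneg fun n _ => (ha n).le))
  have hK := continuous_kernel (R := R) (N := N) hd hr ht htstar
  have hcont : Continuous (density R N r tstar t) := by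
    have : density R N r tstar t = fun x => (kernelDet (kernel R N r tstar t) x).re := by
      funext x
      rw [density, weight_eq_kernelDet]
    rw [this]
    exact Complex.continuous_re.comp (continuous_kernelDet hK N)
  refine ⟨fun n _ => ?_, fun x _ => hreal x, ?_⟩
  · rw [hma]
    exact ⟨Complex.ofReal_im _, ha n⟩
  · exact isDeterminantal_of_reproducing (measurableSet_stateSpace R r) (isBounded_stateSpace R r)
      hK (integral_kernel_mul_kernel hN hD hr ht htstar) (integral_kernel_diag hN hD hr ht htstar)
      hcont (fun x _ => by rw [hreal, weight_eq_kernelDet]) hpos
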